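/- **Setting.** A *differential function* over an open interval $V\subset\mathbb R$ is a function $F(x,t,\varepsilon;u,u_x,u_{xx},\dots)$ of finitely many of the variables $u^{(j)}$ that is smooth in all its arguments for $u\in V$. Put $\frac{d}{dx}=\partial_x+\sum_{k\ge0}u^{(k+1)}\frac{\partial}{\partial u^{(k)}}$ and let $\mathcal E(F)=\sum_{k\ge0}(-1)^k\frac{d^k}{dx^k}\frac{\partial F}{\partial u^{(k)}}$ be the Euler–Lagrange operator; write $\frac{\delta}{\delta u}\int F\,dx=\mathcal E(F)$ for the formal functional with density $F$. Let $\varphi:\mathbb R\to\mathbb R$, let $I=(x_-,x_+)$ be a nonempty, possibly unbounded, open interval on which $\varphi$ is strictly monotone, and $V=\varphi(I)$. Let $h,c,p,s$ be smooth on $V$ with $c\ne0$ on $V$, and let $H=\int \mathfrak h\,dx$ be the Hamiltonian with density $$\mathfrak h=h-\tfrac{\varepsilon^2}{2}c_h u_x^2+\varepsilon^4\big(p_h u_{xx}^2+s_h u_x^4\big)+\sum_{k=3}^M\varepsilon^{2k}\mathfrak h_k(u,u_x,\dots),$$ where $c_h=c\,h'''$, $p_h=p\,h'''+\frac3{10}c^2h^{(4)}$,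 $s_h=s\,h'''-\frac{cc''}8h^{(4)}-\frac{cc'}8h^{(5)}-\frac{c^2}{24}h^{(6)}-\frac{p'}6h^{(4)}-\frac p6h^{(5)}$, and the $\mathfrak h_k$ are differential functions over $V$ of $u,u_x,\dots$ only (the sum may be empty). Define $f'$ on $V$ by $f'(\varphi(x))=x/c(\varphi(x))$, $x\in I$. Let $N\ge0$. Assume the perturbation admits a variational string equation of order $2N$: there are a formal functional $S_f$, with density a differential function over $V$, and a differential function $r$ over $V$ such that for $u\in V$ $$\partial_t\frac{\delta S_f}{\delta u}+\mathcal E\Big(\frac{\delta S_f}{\delta u}\frac{d}{dx}\frac{\delta H}{\delta u}\Big)=\varepsilon^{2N+2}r,\qquad \frac{\delta S_f}{\delta u}\Big|_{\varepsilon=0}=\frac1{c(u)}\big(x+h''(u)t-c(u)f'(u)\big),$$ and $\frac{\delta S_f}{\delta u}\big|_{t=0,\,u=\varphi(x)}=0$ for $x\in I$ and all $\varepsilon\in\mathbb R$. Let $L$ be such that the linear equation $$\sigma_t=\sum_{i\ge0}\Big(\frac{\partial}{\partial u^{(i)}}\frac{\delta H}{\delta u}\Big)\partial_x^{i+1}\sigma+\varepsilon^{2N+2}r,\qquad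 \sigma=\frac{\delta S_f}{\delta u},$$ depends on $u$ and its first $L$ derivatives only; that is, so do $\frac{\delta S_f}{\delta u}$, $r$ and, for each $i$ with $\frac{\partial}{\partial u^{(i)}}\frac{\delta H}{\delta u}\not\equiv0$ on $V$, both this coefficient and $\frac{d^{i+1}}{dx^{i+1}}\frac{\delta S_f}{\delta u}$. Let $T>0$ and let $u(x,t,\varepsilon)$, $x\in\mathbb R$, $t\in[0,T]$, $\varepsilon\in\mathbb R$, be continuous in $(x,t)$ for each $\varepsilon$, with $u(x,0,\varepsilon)=\varphi(x)$. Let $\Omega=\{(x,t,\varepsilon):t\in[0,T],\ u(x,t,\varepsilon)\in V\}$ and let $\Omega^c$ be the connected component of $\Omega$ containing $I\times\{0\}\times\mathbb R$. Assume that on $\Omega^c$ the function $u$ satisfies $$u_t=\partial_x\frac{\delta H}{\delta u}=h''(u)u_x+O(\varepsilon^2)$$ (one-sided $t$-derivatives at $t=0,T$), that $u$ is continuous (as a function on $\mathbb R\times[0,T]\times\mathbb R$) at each point of $\Omega^c$, and that $\partial_x^j\partial_\varepsilon^{2k}u$ exists and is continuous on $\Omega^c$ for all $j\le L$, $k\le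 N$. Put $\sigma(x,t,\varepsilon)=\frac{\delta S_f}{\delta u}\big|_{u=u(x,t,\varepsilon)}$, and let $$D_0=\{(y-h''(\varphi(y))t,\;t): y\in I,\ t\in[0,T]\}$$ be the region filled by the characteristic lines of $v_t=h''(v)v_x$, $v(x,0)=\varphi(x)$, issuing from $I$. **Theorem.** 1. $D_0\times\{0\}\subset\Omega^c$. 2. $\sigma=O(\varepsilon^{2N+2})$ on compact sets: for every compact $K\subset\Omega^c$ with $K\cap\{\varepsilon=0\}\subset D_0\times\{0\}$ there is a constant $C$ such that $|\sigma(x,t,\varepsilon)|\le C|\varepsilon|^{2N+2}$ for all $(x,t,\varepsilon)\in K$. (If $D_0\times\{0\}$ is the whole slice $\Omega^c\cap\{\varepsilon=0\}$, this holds for all compact $K\subset\Omega^c$.) 3. For every $(x,t)\in D_0$ the function $\varepsilon\mapsto\sigma(x,t,\varepsilon)$ is $2N$ times continuously differentiable near $\varepsilon=0$, and $\dfrac{\partial^{2k}\sigma}{\partial\varepsilon^{2k}}(x,t,0)=0$ for $k=0,\dots,N$. -/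

import Mathlib

open scoped ContDiff

noncomputable section

namespace StringEq

/-! ### Differential functions and the formal variational calculus -/

/-- A function `F x t ε w` of the variables `x`, `t`, of the parameter `ε` and of the jet variables
`w j = u^(j)` (`w 0 = u`, `w 1 = u_x`, ...). A formal local functional `∫ F dx` is represented by
its density `F`. -/
abbrev DiffFun : Type := ℝ → ℝ → ℝ → (ℕ → ℝ) → ℝ

/-- `F` involves finitely many jet variables, and is a smooth function of all its arguments as long
as `u` lies in `V`. (Differential polynomials whose coefficients are smooth functions of `u` on `V`,
polynomial in `x`, `t`, `ε`, are examples.) -/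
def IsDiffFun (V : Set ℝ) (F : DiffFun) : Prop :=
  ∃ (n : ℕ) (G : ℝ × ℝ × ℝ × (Fin (n + 1) → ℝ) → ℝ),
    ContDiffOn ℝ ∞ G {q | q.2.2.2 0 ∈ V} ∧
    ∀ x t ε w, F x t ε w = G (x, t, ε, fun i => w i)

/-- For `u` in `V`, the differential function `F` depends only on `x`, `t`, `ε`, on `u` and on the
first `L` derivatives of `u`. -/
def DependsOnJet (V : Set ℝ) (L : ℕ) (F : DiffFun) : Prop :=
  ∀ x t ε (w w' : ℕ → ℝ), w 0 ∈ V → (∀ j ≤ L, w j = w' j) → F x t ε w = F x t ε w'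

/-- The partial derivative `∂F/∂u^(k)`. -/
def jetPartial (k : ℕ) (F : DiffFun) : DiffFun := fun x t ε w =>
  deriv (fun s => F x t ε (Function.update w k s)) (w k)

/-- The partial derivative of `F` with respect to its explicit dependence on `x`. -/
def xPartial (F : DiffFun) : DiffFun := fun x t ε w => deriv (fun y => F y t ε w) x

/-- The partial derivative of `F` with respect to its explicit dependence on `t`. -/
def tPartial (F : DiffFun) : DiffFun := fun x t ε w => deriv (fun τ => F x τ ε w) t

/-- The total derivative `d/dx = ∂/∂x + ∑ₖ u^(k+1) ∂/∂u^(k)`. The sum is finite for functions of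
finitely many jet variables. -/
def totalDeriv (F : DiffFun) : DiffFun := fun x t ε w =>
  xPartial F x t ε w + ∑ᶠ k : ℕ, w (k + 1) * jetPartial k F x t ε w

/-- The Euler-Lagrange operator `ℰ(F) = ∑ₖ (-1)^k (d/dx)^k (∂F/∂u^(k))`, i.e. the variational
derivative `δ/δu` of the formal functional `∫ F dx`. -/
def euler (F : DiffFun) : DiffFun := fun x t ε w =>
  ∑ᶠ k : ℕ, (-1 : ℝ) ^ k * (totalDeriv^[k] (jetPartial k F)) x t ε w

/-! ### Hamiltonian perturbations -/

/-- `c_h = c h'''`. -/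
def coeffC (h c : ℝ → ℝ) (v : ℝ) : ℝ := c v * iteratedDeriv 3 h v

/-- `p_h = p h''' + (3/10) c² h''''`. -/
def coeffP (h c p : ℝ → ℝ) (v : ℝ) : ℝ :=
  p v * iteratedDeriv 3 h v + 3 / 10 * c v ^ 2 * iteratedDeriv 4 h v

/-- The coefficient `s_h`. -/
def coeffS (h c p s : ℝ → ℝ) (v : ℝ) : ℝ :=
  s v * iteratedDeriv 3 h v
    - c v * iteratedDeriv 2 c v / 8 * iteratedDeriv 4 h v
    - c v * deriv c v / 8 * iteratedDeriv 5 h v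
    - c v ^ 2 / 24 * iteratedDeriv 6 h v
    - deriv p v / 6 * iteratedDeriv 4 h v
    - p v / 6 * iteratedDeriv 5 h v

/-- The `D`-operator: `D_(c,p,s)(h) = h - ε²/2 c_h u_x² + ε⁴ (p_h u_xx² + s_h u_x⁴)`. -/
def dOperator (c p s h : ℝ → ℝ) : DiffFun := fun _ _ ε w =>
  h (w 0) - ε ^ 2 / 2 * coeffC h c (w 0) * w 1 ^ 2
    + ε ^ 4 * (coeffP h c p (w 0) * w 2 ^ 2 + coeffS h c p s (w 0) * w 1 ^ 4)

/-- The Hamiltonian density `D_(c,p,s)(h) + ∑_{k=3}^M ε^(2k) H_k(u, u_x, ...)`. The fourth order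
perturbations are those without the additional terms `H_k` (for instance `M = 0`). -/
def hamDensity (c p s h : ℝ → ℝ) (M : ℕ) (H : ℕ → (ℕ → ℝ) → ℝ) : DiffFun := fun x t ε w =>
  dOperator c p s h x t ε w + ∑ k ∈ Finset.Icc 3 M, ε ^ (2 * k) * H k w

/-! ### The variational string equation -/

/-- The jet `(v, v', v'', ...)` of a function of one variable at `x`. -/
def jet (v : ℝ → ℝ) (x : ℝ) : ℕ → ℝ := fun j => iteratedDeriv j v x

/-- The formal functional `∫ S dx` defines a variational string equation of order `2N`, with
remainder `r`, for the Hamiltonian density `𝓗 = h(u) + O(ε²)` and the initial datum `φ` on the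
interval `I`; `fp` is the function `f'` on `φ(I)`. -/
structure IsStringFunctional (I : Set ℝ) (φ h c fp : ℝ → ℝ) (𝓗 : DiffFun) (N : ℕ)
    (S r : DiffFun) : Prop where
  smooth : IsDiffFun (φ '' I) S
  smooth_remainder : IsDiffFun (φ '' I) r
  /-- `∂ₜ(δS/δu) + ℰ(δS/δu · d/dx δH/δu) = ε^(2N+2) r`. -/
  quasi_conserved : ∀ x t ε w, w 0 ∈ φ '' I →
    tPartial (euler S) x t ε w
      + euler (fun x t ε w => euler S x t ε w * totalDeriv (euler 𝓗) x t ε w) x t ε w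
      = ε ^ (2 * N + 2) * r x t ε w
  /-- At `ε = 0` the functional gives the equation of characteristics. -/
  dispersionless : ∀ x t w, w 0 ∈ φ '' I →
    euler S x t 0 w = 1 / c (w 0) * (x + iteratedDeriv 2 h (w 0) * t - c (w 0) * fp (w 0))
  /-- `δS/δu` vanishes at `t = 0`, `u = φ`. -/
  initial : ∀ ε, ∀ x ∈ I, euler S x 0 ε (jet φ x) = 0

/-- The linear equation
`σ_t = ∑ᵢ (∂/∂u^(i) δH/δu) ∂_x^(i+1) σ + ε^(2N+2) r`, where `σ` is `δS/δu` evaluated along a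
solution, depends only on `u` and on the first `L` derivatives of `u` (values of `u` in `V`). -/
def LinearEqDependsOnJet (V : Set ℝ) (L : ℕ) (𝓗 S r : DiffFun) : Prop :=
  DependsOnJet V L (euler S) ∧ DependsOnJet V L r ∧
  ∀ i : ℕ, (∃ x t ε w, w 0 ∈ V ∧ jetPartial i (euler 𝓗) x t ε w ≠ 0) →
    DependsOnJet V L (jetPartial i (euler 𝓗)) ∧
    DependsOnJet V L (totalDeriv^[i + 1] (euler S))

/-! ### The domain, and functions along a solution. Points of `ℝ³` are triples `(x, t, ε)`. -/

/-- `F` evaluated at `u = u(x, t, ε)`. -/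
def along (F : DiffFun) (u : ℝ → ℝ → ℝ → ℝ) (x t ε : ℝ) : ℝ :=
  F x t ε (jet (fun y => u y t ε) x)

/-- `Ω = {(x, t, ε) : t ∈ [0, T], u(x, t, ε) ∈ V}`. -/
def domain (V : Set ℝ) (T : ℝ) (u : ℝ → ℝ → ℝ → ℝ) : Set (ℝ × ℝ × ℝ) :=
  {q | q.2.1 ∈ Set.Icc 0 T ∧ u q.1 q.2.1 q.2.2 ∈ V}

/-- `Ωᶜ`, the connected component of `Ω` containing the (connected) set `I × {0} × ℝ`, where
`V = φ(I)`. -/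
def domainComp (I : Set ℝ) (φ : ℝ → ℝ) (T : ℝ) (u : ℝ → ℝ → ℝ → ℝ) : Set (ℝ × ℝ × ℝ) :=
  ⋃ y ∈ I, connectedComponentIn (domain (φ '' I) T u) (y, 0, 0)

/-- The region of `ℝ × [0, T]` filled by the characteristic lines of the unperturbed equation
`v_t = h''(v) v_x`, `v(x, 0) = φ(x)`, with initial point in `I`. -/
def charRegion (I : Set ℝ) (φ h : ℝ → ℝ) (T : ℝ) : Set (ℝ × ℝ) :=
  {q | q.2 ∈ Set.Icc 0 T ∧ ∃ y ∈ I, q.1 = y - iteratedDeriv 2 h (φ y) * q.2}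

/-- The mixed derivative `∂_x^j ∂_ε^m u`. -/
def mixedDeriv (u : ℝ → ℝ → ℝ → ℝ) (j m : ℕ) (x t ε : ℝ) : ℝ :=
  iteratedDeriv j (fun y => iteratedDeriv m (fun e => u y t e) ε) x

/-- The derivatives `∂_x^j ∂_ε^(2k) u` exist and are continuous on `D` for `j ≤ L`, `k ≤ N`. -/
structure HasMixedDerivs (u : ℝ → ℝ → ℝ → ℝ) (L N : ℕ) (D : Set (ℝ × ℝ × ℝ)) : Prop where
  diff_eps : ∀ x t ε, (x, t, ε) ∈ D → ∀ m < 2 * N,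
    DifferentiableAt ℝ (iteratedDeriv m (fun e => u x t e)) ε
  diff_x : ∀ x t ε, (x, t, ε) ∈ D → ∀ j < L, ∀ k ≤ N,
    DifferentiableAt ℝ (fun y => mixedDeriv u j (2 * k) y t ε) x
  continuous : ∀ j ≤ L, ∀ k ≤ N,
    ContinuousOn (fun q : ℝ × ℝ × ℝ => mixedDeriv u j (2 * k) q.1 q.2.1 q.2.2) D

end StringEq

end

/-! Write `A = δS/δu`, `E = δH/δu`, `D = d/dx`. The Fréchet derivative of a variational derivative
is self-adjoint (`adjFrechet_eulerOp`), hence `ℰ(A · D E)` is the derivative of `A` in the direction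
`D E` minus the derivative of `E` in the direction `D A` (`eulerOp_mul_D_eulerOp`). Along a solution
of `u_t = D E` the quasi-conservation law therefore becomes a linear equation for `σ`: `σ_t = ∑ᵢ
(∂E/∂u^(i)) ∂ₓ^(i+1) σ + ε^(2N+2) r`. Since `E = h'(u) + O(ε²)`, every coefficient with `i > 0`
carries a factor `ε²`. So `σ` solves a transport equation with speed `∂E/∂u`, zero initial data, and
a forcing made of `ε²` times `x`-derivatives of `σ` plus `ε^(2N+2) r`
(`RelOpen.hasDerivWithinAt_line_evW`).

The estimate is a bootstrap in a tube around a characteristic (`RelOpen.exists_bound_transport`). If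
`σ = O(ε^(2k))` with `k ≤ N`, then the `ε`-derivatives of `σ` of order below `2k` vanish at `ε = 0`.
They commute with `∂ₓ`, so Taylor's formula gives `∂ₓ^i σ = O(ε^(2k))` on a thinner tube
(`RelOpen.exists_bound_derivs`). The forcing is then `O(ε^(2k+2))`, and the maximum principle on a
shrinking neighbourhood of the characteristic (`abs_transport_le`) yields `σ = O(ε^(2k+2))`. After
`N + 1` rounds the exponent is `2N + 2`.

The tubes exist because at `ε = 0` the solution is constant on each characteristic issuing from `I`:
a Grönwall argument continued in `t` (`eq_initial_along_characteristic`) keeps the line inside the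
relatively open component. Compactness turns the tube estimates into the estimate on `K`, and an
estimate `O(ε^(2N+1))` kills all `ε`-derivatives up to order `2N`.

Two points concern regularity. Only even `ε`-derivatives of `u` are assumed; the odd ones are
recovered by Taylor's formula with integral remainder (`exists_second_deriv_of_mixed`). The
`t`-derivatives of the jets come from a theorem on mixed derivatives, and `L` derivatives suffice
because total derivatives never lower the top order (`orderLE_top_le`). -/

noncomputable section

namespace StringEq

/-! ### The Euler operator in an abstract differential algebra -/

section Abstract

variable {R : Type*} [CommRing R]

/-- A differential algebra of jets: a total derivative `D` and commuting partial derivatives `d k`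
with `[d (k + 1), D] = d k`, `[d 0, D] = 0`, where each element depends on finitely many jet
variables. -/
structure IsJetAlgebra (D : Derivation ℤ R R) (d : ℕ → Derivation ℤ R R) : Prop where
  comm : ∀ i j f, d i (d j f) = d j (d i f)
  comm_zero : ∀ f, d 0 (D f) = D (d 0 f)
  comm_succ : ∀ k f, d (k + 1) (D f) = D (d (k + 1) f) + d k f
  finite : ∀ f, ∃ n, ∀ k, n ≤ k → d k f = 0

variable (D : Derivation ℤ R R) (d : ℕ → Derivation ℤ R R)

/-- The power `(-D)^k` as an additive map. -/
def negPow (k : ℕ) : R →ₗ[ℤ] R := (-(D : R →ₗ[ℤ] R)) ^ k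

/-- The adjoint Fréchet derivative of `f`, applied to `g`. -/
def adjFrechet (f g : R) : R := ∑ᶠ k : ℕ, negPow D k (d k f * g)

/-- The Fréchet derivative of `f`, applied to `g`. -/
def frechet (f g : R) : R := ∑ᶠ k : ℕ, d k f * D^[k] g

/-- The Euler operator. -/
def eulerOp (f : R) : R := ∑ᶠ k : ℕ, negPow D k (d k f)

variable {D d}

@[simp] lemma negPow_zero (f : R) : negPow D 0 f = f := by simp [negPow]

lemma negPow_succ (k : ℕ) (f : R) : negPow D (k + 1) f = - D (negPow D k f) := by
  simp [negPow, pow_succ']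

lemma negPow_succ' (k : ℕ) (f : R) : negPow D (k + 1) f = negPow D k (- D f) := by
  simp [negPow, pow_succ]

lemma finsum_eq_sum_range {M : Type*} [AddCommMonoid M] {a : ℕ → M} {n : ℕ}
    (h : ∀ k, n ≤ k → a k = 0) : ∑ᶠ k, a k = ∑ k ∈ Finset.range n, a k := by
  apply finsum_eq_sum_of_support_subset
  intro k hk
  by_contra hk'
  exact hk (h k (by simpa using hk'))

lemma adjFrechet_eq {f : R} {n : ℕ} (h : ∀ k, n ≤ k → d k f = 0) (g : R) :
    adjFrechet D d f g = ∑ k ∈ Finset.range n, negPow D k (d k f * g) :=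
  finsum_eq_sum_range fun k hk => by simp [h k hk]

lemma frechet_eq {f : R} {n : ℕ} (h : ∀ k, n ≤ k → d k f = 0) (g : R) :
    frechet D d f g = ∑ k ∈ Finset.range n, d k f * D^[k] g :=
  finsum_eq_sum_range fun k hk => by simp [h k hk]

lemma eulerOp_eq {f : R} {n : ℕ} (h : ∀ k, n ≤ k → d k f = 0) :
    eulerOp D d f = ∑ k ∈ Finset.range n, negPow D k (d k f) :=
  finsum_eq_sum_range fun k hk => by simp [h k hk]

lemma eulerOp_eq_adjFrechet_one (f : R) : eulerOp D d f = adjFrechet D d f 1 := by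
  simp [eulerOp, adjFrechet]

lemma eulerOp_zero : eulerOp D d (0 : R) = 0 := by
  simp [eulerOp]

namespace IsJetAlgebra

variable (hA : IsJetAlgebra D d)
include hA

lemma exists_bound₂ (f g : R) : ∃ n, (∀ k, n ≤ k → d k f = 0) ∧ ∀ k, n ≤ k → d k g = 0 := by
  obtain ⟨n, hn⟩ := hA.finite f
  obtain ⟨m, hm⟩ := hA.finite g
  exact ⟨max n m, fun k hk => hn k (le_trans (le_max_left _ _) hk),
    fun k hk => hm k (le_trans (le_max_right _ _) hk)⟩

lemma vanish_D {f : R} {n : ℕ} (h : ∀ k, n ≤ k → d k f = 0) :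
    ∀ k, n + 1 ≤ k → d k (D f) = 0 := by
  intro k hk
  obtain ⟨k, rfl⟩ : ∃ j, k = j + 1 := ⟨k - 1, by omega⟩
  rw [hA.comm_succ, h k (by omega), h (k + 1) (by omega)]
  simp

lemma adjFrechet_add_left (f₁ f₂ g : R) :
    adjFrechet D d (f₁ + f₂) g = adjFrechet D d f₁ g + adjFrechet D d f₂ g := by
  obtain ⟨n, h₁, h₂⟩ := hA.exists_bound₂ f₁ f₂
  rw [adjFrechet_eq h₁, adjFrechet_eq h₂, adjFrechet_eq (n := n)
    (fun k hk => by simp [h₁ k hk, h₂ k hk]), ← Finset.sum_add_distrib]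
  simp [add_mul]

lemma adjFrechet_sum_right {ι : Type*} (s : Finset ι) (f : R) (g : ι → R) :
    adjFrechet D d f (∑ i ∈ s, g i) = ∑ i ∈ s, adjFrechet D d f (g i) := by
  obtain ⟨n, h⟩ := hA.finite f
  simp only [adjFrechet_eq h, Finset.mul_sum, map_sum]
  exact Finset.sum_comm

lemma adjFrechet_neg_right (f g : R) :
    adjFrechet D d f (-g) = - adjFrechet D d f g := by
  obtain ⟨n, h⟩ := hA.finite f
  simp [adjFrechet_eq h]

lemma eulerOp_add (f g : R) : eulerOp D d (f + g) = eulerOp D d f + eulerOp D d g := by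
  simp only [eulerOp_eq_adjFrechet_one, hA.adjFrechet_add_left]

lemma eulerOp_sum {ι : Type*} (s : Finset ι) (f : ι → R) :
    eulerOp D d (∑ i ∈ s, f i) = ∑ i ∈ s, eulerOp D d (f i) := by
  classical
  induction s using Finset.induction_on with
  | empty => simp [eulerOp_zero]
  | insert a s ha ih => rw [Finset.sum_insert ha, Finset.sum_insert ha, hA.eulerOp_add, ih]

/-- The Leibniz rule for the Euler operator. -/
lemma eulerOp_mul (f g : R) :
    eulerOp D d (f * g) = adjFrechet D d f g + adjFrechet D d g f := by
  obtain ⟨n, h₁, h₂⟩ := hA.exists_bound₂ f g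
  rw [adjFrechet_eq h₁, adjFrechet_eq h₂, eulerOp_eq (n := n)
    (fun k hk => by simp [h₁ k hk, h₂ k hk]), ← Finset.sum_add_distrib]
  refine Finset.sum_congr rfl fun k _ => ?_
  rw [← map_add, Derivation.leibniz, smul_eq_mul, smul_eq_mul]
  congr 1
  ring

/-- The adjoint of the Fréchet derivative of `D f`. -/
lemma adjFrechet_D (f g : R) : adjFrechet D d (D f) g = - adjFrechet D d f (D g) := by
  obtain ⟨n, h⟩ := hA.finite f
  rw [adjFrechet_eq (hA.vanish_D h), adjFrechet_eq h, Finset.sum_range_succ', ← Finset.sum_neg_distrib]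
  -- By `comm_succ` each summand is a difference of consecutive values of `negPow D k (D (d k f) *
  -- g)`, which telescopes, plus the term wanted on the right.
  have h1 : ∀ k, negPow D (k + 1) (d (k + 1) (D f) * g)
      = (negPow D (k + 1) (D (d (k + 1) f) * g) - negPow D k (D (d k f) * g))
        + - negPow D k (d k f * D g) := by
    intro k
    rw [hA.comm_succ, add_mul, map_add, negPow_succ' k (d k f * g), Derivation.leibniz,
      smul_eq_mul, smul_eq_mul]
    simp only [map_neg, map_add]
    rw [mul_comm g]
    ring
  rw [Finset.sum_congr rfl fun k _ => h1 k, Finset.sum_add_distrib, Finset.sum_range_sub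
    (fun k => negPow D k (D (d k f) * g)), h n le_rfl, hA.comm_zero]
  simp

lemma adjFrechet_iterate_D (j : ℕ) (f g : R) :
    adjFrechet D d (D^[j] f) g = adjFrechet D d f (negPow D j g) := by
  induction j generalizing g with
  | zero => simp
  | succ j ih =>
    rw [Function.iterate_succ_apply', hA.adjFrechet_D, ih, ← map_neg_apply_aux D j g]
    exact hA.adjFrechet_neg_right _ _ |>.symm
where
  map_neg_apply_aux (D : Derivation ℤ R R) (j : ℕ) (g : R) :
      - negPow D j (D g) = negPow D (j + 1) g := by
    rw [negPow_succ', map_neg]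

/-- Null Lagrangians: `adjFrechet_D` with second argument `1`, and `D 1 = 0`. -/
lemma eulerOp_D (f : R) : eulerOp D d (D f) = 0 := by
  obtain ⟨n, h⟩ := hA.finite f
  rw [eulerOp_eq_adjFrechet_one, hA.adjFrechet_D, adjFrechet_eq h]
  simp

/-- Integration by parts. -/
lemma eulerOp_mul_iterate_D (j : ℕ) (f g : R) :
    eulerOp D d (f * D^[j] g) = eulerOp D d (negPow D j f * g) := by
  induction j generalizing f with
  | zero => simp
  | succ j ih =>
    have h1 : f * D (D^[j] g) = D (f * D^[j] g) + (-D f) * D^[j] g := by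
      rw [Derivation.leibniz, smul_eq_mul, smul_eq_mul]
      ring
    rw [Function.iterate_succ_apply', h1, hA.eulerOp_add, hA.eulerOp_D, zero_add, ih, negPow_succ']

/-- The evolutionary derivation with characteristic `g` commutes with `D`. In coordinates, the terms
produced by `comm_succ` cancel against the terms where `D` hits `D^[k] g`, after a shift of the
index. -/
lemma frechet_D (f g : R) : frechet D d (D f) g = D (frechet D d f g) := by
  obtain ⟨n, h⟩ := hA.finite f
  rw [frechet_eq (hA.vanish_D h), frechet_eq (n := n + 1) (fun k hk => h k (by omega)), map_sum,
    Finset.sum_range_succ', Finset.sum_range_succ' (fun k => D (d k f * D^[k] g)), hA.comm_zero]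
  have h1 : ∀ k, d (k + 1) (D f) * D^[k + 1] g = (D (d (k + 1) f * D^[k + 1] g)
      - d (k + 1) f * D^[k + 2] g) + d k f * D^[k + 1] g := by
    intro k
    rw [hA.comm_succ, Derivation.leibniz, smul_eq_mul, smul_eq_mul,
      Function.iterate_succ_apply' (f := D) (k + 1)]
    ring
  have h2 : ∑ k ∈ Finset.range n, d (k + 1) f * D^[k + 2] g + d 0 f * D^[0 + 1] g
      = ∑ k ∈ Finset.range n, d k f * D^[k + 1] g := by
    rw [← Finset.sum_range_succ' (fun k => d k f * D^[k + 1] g), Finset.sum_range_succ, h n le_rfl]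
    simp
  rw [Finset.sum_congr rfl fun k _ => h1 k, Finset.sum_add_distrib, Finset.sum_sub_distrib, ← h2]
  simp only [Function.iterate_zero, id, Derivation.leibniz, smul_eq_mul, zero_add,
    Function.iterate_one]
  ring

lemma frechet_add_left (f₁ f₂ g : R) :
    frechet D d (f₁ + f₂) g = frechet D d f₁ g + frechet D d f₂ g := by
  obtain ⟨n, h₁, h₂⟩ := hA.exists_bound₂ f₁ f₂
  rw [frechet_eq h₁, frechet_eq h₂, frechet_eq (n := n)
    (fun k hk => by simp [h₁ k hk, h₂ k hk]), ← Finset.sum_add_distrib]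
  simp [add_mul]

lemma frechet_neg_left (f g : R) : frechet D d (-f) g = - frechet D d f g := by
  obtain ⟨n, h⟩ := hA.finite f
  rw [frechet_eq h, frechet_eq (n := n) (fun k hk => by simp [h k hk])]
  simp

lemma frechet_sum_left {ι : Type*} (s : Finset ι) (f : ι → R) (g : R) :
    frechet D d (∑ i ∈ s, f i) g = ∑ i ∈ s, frechet D d (f i) g := by
  classical
  induction s using Finset.induction_on with
  | empty => simp [frechet]
  | insert a s ha ih => rw [Finset.sum_insert ha, Finset.sum_insert ha, hA.frechet_add_left, ih]

lemma frechet_negPow (k : ℕ) (f g : R) :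
    frechet D d (negPow D k f) g = negPow D k (frechet D d f g) := by
  induction k with
  | zero => simp
  | succ k ih => rw [negPow_succ, hA.frechet_neg_left, hA.frechet_D, ih, negPow_succ]

/-- The Helmholtz condition: the Fréchet derivative of a variational derivative is
self-adjoint. -/
theorem adjFrechet_eulerOp (f g : R) :
    adjFrechet D d (eulerOp D d f) g = frechet D d (eulerOp D d f) g := by
  obtain ⟨n, h⟩ := hA.finite f
  -- The variational derivative of `frechet D d f g` is computed twice: here after integrating by
  -- parts to `eulerOp D d f * g`, in `h2` by the Leibniz rule in each summand. Both results contain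
  -- `adjFrechet D d g (eulerOp D d f)`, which cancels.
  have h1 : eulerOp D d (frechet D d f g)
      = adjFrechet D d (eulerOp D d f) g + adjFrechet D d g (eulerOp D d f) := by
    rw [← hA.eulerOp_mul, frechet_eq h, hA.eulerOp_sum, eulerOp_eq h, Finset.sum_mul,
      hA.eulerOp_sum]
    exact Finset.sum_congr rfl fun j _ => hA.eulerOp_mul_iterate_D j _ _
  have h2 : eulerOp D d (frechet D d f g)
      = ∑ j ∈ Finset.range n, adjFrechet D d (d j f) (D^[j] g)
        + adjFrechet D d g (eulerOp D d f) := by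
    rw [frechet_eq h, hA.eulerOp_sum, eulerOp_eq h, hA.adjFrechet_sum_right,
      ← Finset.sum_add_distrib]
    refine Finset.sum_congr rfl fun j _ => ?_
    rw [hA.eulerOp_mul, hA.adjFrechet_iterate_D]
  have h3 : adjFrechet D d (eulerOp D d f) g
      = ∑ j ∈ Finset.range n, adjFrechet D d (d j f) (D^[j] g) :=
    add_right_cancel (h1.symm.trans h2)
  have h4 : ∀ j k, n ≤ k → d k (d j f) = 0 := fun j k hk => by rw [hA.comm, h k hk, map_zero]
  -- Both sides are the double sum of `(-D)^k (d k (d j f) * D^[j] g)`, up to the order of the two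
  -- partial derivatives.
  rw [h3, eulerOp_eq h, hA.frechet_sum_left]
  simp_rw [hA.frechet_negPow, frechet_eq (h4 _), adjFrechet_eq (h4 _), map_sum]
  rw [Finset.sum_comm]
  exact Finset.sum_congr rfl fun j _ => Finset.sum_congr rfl fun k _ => by rw [hA.comm]

/-- The evolution of a variational derivative along a Hamiltonian flow. -/
theorem eulerOp_mul_D_eulerOp (f g : R) :
    eulerOp D d (eulerOp D d f * D (eulerOp D d g))
      = frechet D d (eulerOp D d f) (D (eulerOp D d g))
        - frechet D d (eulerOp D d g) (D (eulerOp D d f)) := by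
  rw [hA.eulerOp_mul, hA.adjFrechet_eulerOp, hA.adjFrechet_D, hA.adjFrechet_eulerOp, sub_eq_add_neg]

/-- The highest jet variable is raised by `D^i` with the same symbol. -/
lemma d_iterate_D {f : R} {m : ℕ} (h : ∀ k, m < k → d k f = 0) (i : ℕ) :
    d (m + i) (D^[i] f) = d m f ∧ ∀ k, m + i < k → d k (D^[i] f) = 0 := by
  induction i with
  | zero => exact ⟨rfl, h⟩
  | succ i ih =>
    rw [Function.iterate_succ_apply']
    refine ⟨?_, fun k hk => hA.vanish_D (n := m + i + 1) (fun k hk => ih.2 k (by omega)) k (by omega)⟩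
    rw [← add_assoc, hA.comm_succ, ih.2 _ (by omega), ih.1]
    simp

end IsJetAlgebra
end Abstract
end StringEq

namespace StringEq

/-! ### The differential algebra of smooth functions of finitely many jet variables -/

open TopologicalSpace

/-- The points `(x, t, ε, w)`. -/
abbrev JetSpace : Type := ℝ × ℝ × ℝ × (ℕ → ℝ)

/-- The points `(x, t, ε, w)` with finitely many jet variables. -/
abbrev FinJetSpace (n : ℕ) : Type := ℝ × ℝ × ℝ × (Fin (n + 1) → ℝ)

/-- Forgetting the jet variables of order greater than `n`. -/
def jetProj (n : ℕ) : JetSpace →ₗ[ℝ] FinJetSpace n where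
  toFun q := (q.1, q.2.1, q.2.2.1, fun i => q.2.2.2 i)
  map_add' _ _ := rfl
  map_smul' _ _ := rfl

/-- The points with `u ∈ V`. -/
def jetDomain (V : Opens ℝ) : Set JetSpace := {q | q.2.2.2 0 ∈ V}

/-- The points with `u ∈ V`, with finitely many jet variables. -/
def finJetDomain (V : Opens ℝ) (n : ℕ) : Set (FinJetSpace n) := {q | q.2.2.2 0 ∈ (V : Set ℝ)}

lemma isOpen_finJetDomain (V : Opens ℝ) (n : ℕ) : IsOpen (finJetDomain V n) :=
  V.isOpen.preimage (by fun_prop)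

lemma jetProj_mem {V : Opens ℝ} {n : ℕ} {q : JetSpace} :
    jetProj n q ∈ finJetDomain V n ↔ q ∈ jetDomain V := by
  simp [jetProj, finJetDomain, jetDomain]

/-- The smooth function `G` of finitely many variables represents `f` for `u ∈ V`. -/
structure SmoothRep (V : Opens ℝ) (n : ℕ) (G : FinJetSpace n → ℝ) (f : jetDomain V → ℝ) : Prop where
  smooth : ContDiffOn ℝ ∞ G (finJetDomain V n)
  eq : ∀ q : jetDomain V, f q = G (jetProj n q)

lemma SmoothRep.mono {V : Opens ℝ} {n : ℕ} {G : FinJetSpace n → ℝ} {f : jetDomain V → ℝ}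
    (h : SmoothRep V n G f) {m : ℕ} (hnm : n ≤ m) : ∃ G', SmoothRep V m G' f := by
  refine ⟨fun q => G (q.1, q.2.1, q.2.2.1, fun i => q.2.2.2 (Fin.castLE (by omega) i)), ?_, ?_⟩
  · refine h.smooth.comp (t := finJetDomain V n) (ContDiff.contDiffOn (by fun_prop)) ?_
    intro q hq
    exact hq
  · intro q
    rw [h.eq]
    rfl

lemma exists_smoothRep₂ {V : Opens ℝ} {n m : ℕ} {G : FinJetSpace n → ℝ} {G' : FinJetSpace m → ℝ}
    {f g : jetDomain V → ℝ} (hf : SmoothRep V n G f) (hg : SmoothRep V m G' g) :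
    ∃ k G₁ G₂, SmoothRep V k G₁ f ∧ SmoothRep V k G₂ g := by
  obtain ⟨G₁, h₁⟩ := hf.mono (le_max_left n m)
  obtain ⟨G₂, h₂⟩ := hg.mono (le_max_right n m)
  exact ⟨_, G₁, G₂, h₁, h₂⟩

/-- The algebra of smooth functions of `x, t, ε` and finitely many jet variables, `u ∈ V`. -/
def jetSubalgebra (V : Opens ℝ) : Subalgebra ℝ (jetDomain V → ℝ) where
  carrier := {f | ∃ n G, SmoothRep V n G f}
  mul_mem' := by
    rintro f g ⟨n, G, hf⟩ ⟨m, G', hg⟩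
    obtain ⟨k, G₁, G₂, h₁, h₂⟩ := exists_smoothRep₂ hf hg
    exact ⟨k, G₁ * G₂, h₁.smooth.mul h₂.smooth, fun q => by simp [h₁.eq, h₂.eq]⟩
  add_mem' := by
    rintro f g ⟨n, G, hf⟩ ⟨m, G', hg⟩
    obtain ⟨k, G₁, G₂, h₁, h₂⟩ := exists_smoothRep₂ hf hg
    exact ⟨k, G₁ + G₂, h₁.smooth.add h₂.smooth, fun q => by simp [h₁.eq, h₂.eq]⟩
  algebraMap_mem' a := ⟨0, fun _ => a, contDiffOn_const, fun q => rfl⟩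

/-- The ring of smooth functions of `x, t, ε` and finitely many jet variables, `u ∈ V`. -/
def JetRing (V : Opens ℝ) : Type := jetSubalgebra V

instance (V : Opens ℝ) : CommRing (JetRing V) := inferInstanceAs (CommRing (jetSubalgebra V))

instance (V : Opens ℝ) : Algebra ℝ (JetRing V) := inferInstanceAs (Algebra ℝ (jetSubalgebra V))

variable {V : Opens ℝ}

/-- The value of an element of the jet ring (`0` outside the domain). -/
def ev (f : JetRing V) (q : JetSpace) : ℝ :=
  open Classical in if h : q ∈ jetDomain V then f.1 ⟨q, h⟩ else 0

lemma ev_of_mem (f : JetRing V) {q : JetSpace} (h : q ∈ jetDomain V) : ev f q = f.1 ⟨q, h⟩ := by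
  simp [ev, h]

lemma JetRing.ext_ev {f g : JetRing V} (h : ∀ q ∈ jetDomain V, ev f q = ev g q) : f = g := by
  apply Subtype.ext
  funext q
  have := h q.1 q.2
  rwa [ev_of_mem f q.2, ev_of_mem g q.2] at this

lemma ev_rep {f : JetRing V} {n : ℕ} {G : FinJetSpace n → ℝ} (h : SmoothRep V n G f.1)
    {q : JetSpace} (hq : q ∈ jetDomain V) : ev f q = G (jetProj n q) := by
  rw [ev_of_mem f hq, h.eq]

section ev
variable {q : JetSpace}

lemma ev_add (hq : q ∈ jetDomain V) (f g : JetRing V) : ev (f + g) q = ev f q + ev g q := by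
  simp only [ev_of_mem _ hq]
  rfl

lemma ev_mul (hq : q ∈ jetDomain V) (f g : JetRing V) : ev (f * g) q = ev f q * ev g q := by
  simp only [ev_of_mem _ hq]
  rfl

lemma ev_zero : ev (0 : JetRing V) q = 0 := by
  unfold ev
  split_ifs <;> rfl

lemma ev_one (hq : q ∈ jetDomain V) : ev (1 : JetRing V) q = 1 := by
  simp only [ev_of_mem _ hq]
  rfl

lemma ev_neg (hq : q ∈ jetDomain V) (f : JetRing V) : ev (-f) q = - ev f q := by
  simp only [ev_of_mem _ hq]
  rfl

lemma ev_pow (hq : q ∈ jetDomain V) (f : JetRing V) (k : ℕ) : ev (f ^ k) q = ev f q ^ k := by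
  simp only [ev_of_mem _ hq]
  rfl

lemma ev_algebraMap (hq : q ∈ jetDomain V) (a : ℝ) : ev (algebraMap ℝ (JetRing V) a) q = a := by
  rw [ev_of_mem _ hq]
  rfl

lemma ev_sum (hq : q ∈ jetDomain V) {ι : Type*} (s : Finset ι) (f : ι → JetRing V) :
    ev (∑ i ∈ s, f i) q = ∑ i ∈ s, ev (f i) q := by
  classical
  induction s using Finset.induction_on with
  | empty => simp [ev_zero]
  | insert a s ha ih => rw [Finset.sum_insert ha, Finset.sum_insert ha, ev_add hq, ih]
end ev

/-- The chain rule along a curve. -/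
lemma SmoothRep.hasDerivWithinAt {f : JetRing V} {n : ℕ} {G : FinJetSpace n → ℝ}
    (h : SmoothRep V n G f.1) {γ : ℝ → JetSpace} {v : FinJetSpace n} {S : Set ℝ} {s : ℝ}
    (hγ : HasDerivWithinAt (fun τ => jetProj n (γ τ)) v S s) (hs : γ s ∈ jetDomain V) :
    HasDerivWithinAt (fun τ => ev f (γ τ)) (fderiv ℝ G (jetProj n (γ s)) v) S s := by
  have hmem : finJetDomain V n ∈ nhds (jetProj n (γ s)) :=
    (isOpen_finJetDomain V n).mem_nhds (jetProj_mem.2 hs)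
  have hG : HasFDerivAt G (fderiv ℝ G (jetProj n (γ s))) (jetProj n (γ s)) :=
    ((h.smooth.contDiffAt hmem).differentiableAt (by simp)).hasFDerivAt
  refine (hG.comp_hasDerivWithinAt s hγ).congr_of_eventuallyEq ?_ (ev_rep h hs)
  have := hγ.continuousWithinAt.eventually hmem
  filter_upwards [this] with τ hτ
  exact ev_rep h (jetProj_mem.1 hτ)

lemma SmoothRep.lineDeriv_eq {f : JetRing V} {n : ℕ} {G : FinJetSpace n → ℝ}
    (h : SmoothRep V n G f.1) {q : JetSpace} (hq : q ∈ jetDomain V) (v : JetSpace) :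
    HasDerivAt (fun τ : ℝ => ev f (q + τ • v)) (fderiv ℝ G (jetProj n q) (jetProj n v)) 0 := by
  have h1 : HasDerivWithinAt (fun τ : ℝ => jetProj n (q + τ • v)) (jetProj n v) Set.univ 0 := by
    simp only [map_add, map_smul]
    have := ((hasDerivAt_id (0 : ℝ)).smul_const (jetProj n v)).const_add (jetProj n q)
    simpa using this
  have := h.hasDerivWithinAt h1 (by simpa using hq)
  simpa using this

/-- The directional derivative of a smooth representative is smooth in the same finitely many
variables; this makes `pd` an operator on the jet ring. -/
lemma lineDeriv_mem (f : JetRing V) (v : JetSpace) :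
    (fun q : jetDomain V => deriv (fun τ : ℝ => ev f (q + τ • v)) 0) ∈ jetSubalgebra V := by
  obtain ⟨n, G, h⟩ := f.2
  refine ⟨n, fun p => fderiv ℝ G p (jetProj n v), ?_, fun q => (h.lineDeriv_eq q.2 v).deriv⟩
  exact (h.smooth.fderiv_of_isOpen (isOpen_finJetDomain V n) (by simp)).clm_apply contDiffOn_const

lemma hasDerivAt_line (f : JetRing V) {q : JetSpace} (hq : q ∈ jetDomain V) (v : JetSpace) :
    HasDerivAt (fun τ : ℝ => ev f (q + τ • v)) (deriv (fun τ : ℝ => ev f (q + τ • v)) 0) 0 := by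
  obtain ⟨n, G, h⟩ := f.2
  exact (h.lineDeriv_eq hq v).differentiableAt.hasDerivAt

lemma eventually_line_mem {q : JetSpace} (hq : q ∈ jetDomain V) (v : JetSpace) :
    ∀ᶠ τ : ℝ in nhds 0, q + τ • v ∈ jetDomain V := by
  have hc : Continuous fun τ : ℝ => q.2.2.2 0 + τ * v.2.2.2 0 := by fun_prop
  have : ∀ᶠ τ : ℝ in nhds 0, q.2.2.2 0 + τ * v.2.2.2 0 ∈ (V : Set ℝ) :=
    hc.continuousAt.eventually (V.isOpen.mem_nhds (by simpa [jetDomain] using hq))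
  exact this

/-- The partial derivative in the direction `v`, as a derivation of the jet ring. -/
def pd (v : JetSpace) : Derivation ℤ (JetRing V) (JetRing V) :=
  Derivation.mk' (AddMonoidHom.toIntLinearMap
    { toFun := fun f => ⟨_, lineDeriv_mem f v⟩
      map_zero' := by
        apply Subtype.ext
        funext q
        simp only [ev_zero, deriv_const]
        rfl
      map_add' := fun f g => by
        apply Subtype.ext
        funext q
        have := ((hasDerivAt_line f q.2 v).add (hasDerivAt_line g q.2 v)).congr_of_eventuallyEq
          (f₁ := fun τ : ℝ => ev (f + g) (q.1 + τ • v)) (by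
            filter_upwards [eventually_line_mem q.2 v] with τ hτ using ev_add hτ f g)
        exact this.deriv })
    (fun f g => by
      apply Subtype.ext
      funext q
      have := ((hasDerivAt_line f q.2 v).mul (hasDerivAt_line g q.2 v)).congr_of_eventuallyEq
          (f₁ := fun τ : ℝ => ev (f * g) (q.1 + τ • v)) (by
            filter_upwards [eventually_line_mem q.2 v] with τ hτ using ev_mul hτ f g)
      refine this.deriv.trans ?_
      simp only [zero_smul, add_zero, ev_of_mem _ q.2]
      rw [add_comm, mul_comm (deriv _ _)]
      rfl)

lemma ev_pd (f : JetRing V) {q : JetSpace} (hq : q ∈ jetDomain V) (v : JetSpace) :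
    ev (pd v f) q = deriv (fun τ : ℝ => ev f (q + τ • v)) 0 := by
  rw [ev_of_mem _ hq]
  rfl

lemma SmoothRep.pd {f : JetRing V} {n : ℕ} {G : FinJetSpace n → ℝ}
    (h : SmoothRep V n G f.1) (v : JetSpace) :
    SmoothRep V n (fun p => fderiv ℝ G p (jetProj n v)) (StringEq.pd v f).1 :=
  ⟨(h.smooth.fderiv_of_isOpen (isOpen_finJetDomain V n) (by simp)).clm_apply contDiffOn_const,
    fun q => (h.lineDeriv_eq q.2 v).deriv⟩

/-- Symmetry of the second derivative of a representative. -/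
lemma pd_comm (v v' : JetSpace) (f : JetRing V) : pd v (pd v' f) = pd v' (pd v f) := by
  obtain ⟨n, G, h⟩ := f.2
  apply JetRing.ext_ev
  intro q hq
  have hmem : finJetDomain V n ∈ nhds (jetProj n q) :=
    (isOpen_finJetDomain V n).mem_nhds (jetProj_mem.2 hq)
  have hG := h.smooth.contDiffAt hmem
  have hd : DifferentiableAt ℝ (fderiv ℝ G) (jetProj n q) :=
    (hG.fderiv_right (m := 1) (by norm_cast)).differentiableAt (by simp)
  have hsymm : IsSymmSndFDerivAt ℝ G (jetProj n q) := hG.isSymmSndFDerivAt (by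
    simp only [minSmoothness_of_isRCLikeNormedField]
    exact WithTop.coe_le_coe.2 (le_top (a := (2 : ℕ∞))))
  have key : ∀ a b, fderiv ℝ (fun p => fderiv ℝ G p a) (jetProj n q) b
      = fderiv ℝ (fderiv ℝ G) (jetProj n q) b a := by
    intro a b
    rw [fderiv_clm_apply hd (differentiableAt_const _)]
    simp
  rw [ev_rep ((h.pd v').pd v) hq, ev_rep ((h.pd v).pd v') hq, key, key, hsymm.eq]

/-! #### Coordinates, and the total derivative -/

/-- The direction of the jet variable `u^(k)`. -/
def jetDir (k : ℕ) : JetSpace := (0, 0, 0, Pi.single k 1)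

/-- A smooth function of `x`, `t`, `ε`, `u` as an element of the jet ring. -/
def ofFinFun {n : ℕ} (G : FinJetSpace n → ℝ) (hG : ContDiffOn ℝ ∞ G (finJetDomain V n)) :
    JetRing V := ⟨fun q => G (jetProj n q), n, G, hG, fun _ => rfl⟩

lemma ofFinFun_rep {n : ℕ} (G : FinJetSpace n → ℝ) (hG : ContDiffOn ℝ ∞ G (finJetDomain V n)) :
    SmoothRep V n G (ofFinFun G hG).1 := ⟨hG, fun _ => rfl⟩

/-- The jet variable `u^(k)`. -/
def jetVar (V : Opens ℝ) (k : ℕ) : JetRing V :=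
  ofFinFun (n := k) (fun p => p.2.2.2 (Fin.last k)) (ContDiff.contDiffOn (by fun_prop))

/-- The parameter `ε`. -/
def epsVar (V : Opens ℝ) : JetRing V :=
  ofFinFun (n := 0) (fun p => p.2.2.1) (ContDiff.contDiffOn (by fun_prop))

lemma ev_jetVar {q : JetSpace} (hq : q ∈ jetDomain V) (k : ℕ) : ev (jetVar V k) q = q.2.2.2 k := by
  rw [ev_of_mem _ hq]
  rfl

lemma ev_epsVar {q : JetSpace} (hq : q ∈ jetDomain V) : ev (epsVar V) q = q.2.2.1 := by
  rw [ev_of_mem _ hq]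
  rfl

lemma pd_jetVar (v : JetSpace) (k : ℕ) :
    pd v (jetVar V k) = algebraMap ℝ (JetRing V) (v.2.2.2 k) := by
  apply JetRing.ext_ev
  intro q hq
  rw [ev_pd _ hq, ev_algebraMap hq]
  have : HasDerivAt (fun τ : ℝ => q.2.2.2 k + τ * v.2.2.2 k) (v.2.2.2 k) 0 := by
    simpa using ((hasDerivAt_id (0 : ℝ)).mul_const (v.2.2.2 k)).const_add (q.2.2.2 k)
  refine (this.congr_of_eventuallyEq ?_).deriv
  filter_upwards [eventually_line_mem hq v] with τ hτ
  rw [ev_jetVar hτ]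
  simp

lemma pd_epsVar (v : JetSpace) :
    pd v (epsVar V) = algebraMap ℝ (JetRing V) (v.2.2.1) := by
  apply JetRing.ext_ev
  intro q hq
  rw [ev_pd _ hq, ev_algebraMap hq]
  have : HasDerivAt (fun τ : ℝ => q.2.2.1 + τ * v.2.2.1) (v.2.2.1) 0 := by
    simpa using ((hasDerivAt_id (0 : ℝ)).mul_const (v.2.2.1)).const_add (q.2.2.1)
  refine (this.congr_of_eventuallyEq ?_).deriv
  filter_upwards [eventually_line_mem hq v] with τ hτ
  rw [ev_epsVar hτ]
  simp

/-- The partial derivative with respect to `u^(k)`. -/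
def dJ (k : ℕ) : Derivation ℤ (JetRing V) (JetRing V) := pd (jetDir k)

/-- The partial derivative with respect to `x`. -/
def dX : Derivation ℤ (JetRing V) (JetRing V) := pd (1, 0, 0, 0)

/-- The partial derivative with respect to `t`. -/
def dT : Derivation ℤ (JetRing V) (JetRing V) := pd (0, 1, 0, 0)

/-- The partial derivative with respect to `ε`. -/
def dE : Derivation ℤ (JetRing V) (JetRing V) := pd (0, 0, 1, 0)

/-- A representative in the variables up to `n` does not see `u^(k)` for `k > n`. All sums over jet
variables are finite for this reason. -/
lemma SmoothRep.dJ_eq_zero {f : JetRing V} {n : ℕ} {G : FinJetSpace n → ℝ}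
    (h : SmoothRep V n G f.1) {k : ℕ} (hk : n < k) : dJ k f = 0 := by
  apply JetRing.ext_ev
  intro q hq
  have : jetProj n (jetDir k) = 0 := by
    have h0 : ∀ i : Fin (n + 1), (Pi.single k (1 : ℝ) : ℕ → ℝ) i = 0 := fun i =>
      Pi.single_eq_of_ne (by omega) _
    simp only [jetProj, jetDir, LinearMap.coe_mk, AddHom.coe_mk, h0]
    rfl
  rw [dJ, ev_rep (h.pd _) hq, this, map_zero, ev_zero]

lemma exists_dJ_eq_zero (f : JetRing V) : ∃ n, ∀ k, n ≤ k → dJ k f = 0 := by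
  obtain ⟨n, G, h⟩ := f.2
  exact ⟨n + 1, fun k hk => SmoothRep.dJ_eq_zero h hk⟩

lemma totalD_eq {f : JetRing V} {n : ℕ} (h : ∀ k, n ≤ k → dJ k f = 0) :
    ∑ᶠ k, jetVar V (k + 1) * dJ k f = ∑ k ∈ Finset.range n, jetVar V (k + 1) * dJ k f :=
  finsum_eq_sum_range fun k hk => by simp [h k hk]

lemma exists_dJ_eq_zero₂ (f g : JetRing V) :
    ∃ n, (∀ k, n ≤ k → dJ k f = 0) ∧ ∀ k, n ≤ k → dJ k g = 0 := by
  obtain ⟨n, hn⟩ := exists_dJ_eq_zero f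
  obtain ⟨m, hm⟩ := exists_dJ_eq_zero g
  exact ⟨max n m, fun k hk => hn k (le_trans (le_max_left _ _) hk),
    fun k hk => hm k (le_trans (le_max_right _ _) hk)⟩

/-- The total `x`-derivative on the jet ring. -/
def totalD : Derivation ℤ (JetRing V) (JetRing V) :=
  Derivation.mk' (AddMonoidHom.toIntLinearMap
    { toFun := fun f => dX f + ∑ᶠ k, jetVar V (k + 1) * dJ k f
      map_zero' := by simp
      map_add' := fun f g => by
        obtain ⟨n, hf, hg⟩ := exists_dJ_eq_zero₂ f g
        rw [totalD_eq hf, totalD_eq hg, totalD_eq (n := n)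
          (fun k hk => by simp [hf k hk, hg k hk])]
        simp only [map_add, mul_add, Finset.sum_add_distrib]
        ring })
    (fun f g => by
      obtain ⟨n, hf, hg⟩ := exists_dJ_eq_zero₂ f g
      simp only [AddMonoidHom.coe_toIntLinearMap, AddMonoidHom.coe_mk, ZeroHom.coe_mk]
      rw [totalD_eq hf, totalD_eq hg, totalD_eq (n := n)
          (fun k hk => by simp [hf k hk, hg k hk])]
      simp only [Derivation.leibniz, smul_eq_mul, mul_add, Finset.mul_sum, Finset.sum_add_distrib]
      have h1 : ∀ k, jetVar V (k + 1) * (f * dJ k g) = f * (jetVar V (k + 1) * dJ k g) :=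
        fun k => by ring
      have h2 : ∀ k, jetVar V (k + 1) * (g * dJ k f) = g * (jetVar V (k + 1) * dJ k f) :=
        fun k => by ring
      simp only [h1, h2]
      ring)

lemma totalD_apply {f : JetRing V} {n : ℕ} (h : ∀ k, n ≤ k → dJ k f = 0) :
    totalD f = dX f + ∑ k ∈ Finset.range n, jetVar V (k + 1) * dJ k f := by
  rw [← totalD_eq h]
  rfl

/-- A direction whose jet components vanish commutes with the total derivative. -/
lemma pd_totalD_of_eq_zero {v : JetSpace} (hv : ∀ k, v.2.2.2 (k + 1) = 0) (f : JetRing V) :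
    pd v (totalD f) = totalD (pd v f) := by
  obtain ⟨n, h⟩ := exists_dJ_eq_zero f
  rw [totalD_apply h, totalD_apply (f := pd v f) (n := n)
    (fun k hk => by rw [dJ, pd_comm, ← dJ, h k hk, map_zero]), map_add, map_sum, dX, pd_comm]
  congr 1
  refine Finset.sum_congr rfl fun k _ => ?_
  rw [Derivation.leibniz, pd_jetVar, hv, dJ, pd_comm]
  simp

/-- The extra term arises from differentiating the coefficient `u^(k+1)` of `∂/∂u^(k)` in the total
derivative. -/
lemma dJ_succ_totalD (k : ℕ) (f : JetRing V) :
    dJ (k + 1) (totalD f) = totalD (dJ (k + 1) f) + dJ k f := by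
  obtain ⟨n, h⟩ := exists_dJ_eq_zero f
  -- The range of summation has to contain `k`, the index of the extra term.
  obtain ⟨N, hN, hkN⟩ : ∃ N, n ≤ N ∧ k < N := ⟨max n (k + 1), by simp, by simp⟩
  replace h : ∀ j, N ≤ j → dJ j f = 0 := fun j hj => h j (hN.trans hj)
  rw [totalD_apply h, totalD_apply (f := dJ (k + 1) f) (n := N)
    (fun j hj => by rw [dJ, dJ, pd_comm, ← dJ, ← dJ, h j hj, map_zero]), map_add, map_sum, dX, dJ,
    pd_comm, add_assoc]
  congr 1
  have h1 : ∀ j, pd (jetDir (k + 1)) (jetVar V (j + 1) * dJ j f)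
      = jetVar V (j + 1) * dJ j (pd (jetDir (k + 1)) f) + if j = k then dJ j f else 0 := by
    intro j
    rw [Derivation.leibniz, pd_jetVar, dJ, pd_comm, smul_eq_mul, smul_eq_mul]
    congr 1
    by_cases hjk : j = k
    · subst hjk
      simp [jetDir]
    · simp [jetDir, hjk]
  rw [Finset.sum_congr rfl fun j _ => h1 j, Finset.sum_add_distrib]
  simp [hkN]

/-- The jet ring is a jet algebra. -/
lemma isJetAlgebra : IsJetAlgebra (totalD (V := V)) dJ where
  comm i j f := pd_comm _ _ _
  comm_zero f := pd_totalD_of_eq_zero (fun k => by simp [jetDir]) f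
  comm_succ := dJ_succ_totalD
  finite := exists_dJ_eq_zero

/-! #### Differential functions as elements of the jet ring -/

/-- The differential function `F` is given by the element `f` of the jet ring, for `u ∈ V`. -/
def Represents (f : JetRing V) (F : DiffFun) : Prop :=
  ∀ q ∈ jetDomain V, F q.1 q.2.1 q.2.2.1 q.2.2.2 = ev f q

lemma Represents.apply {f : JetRing V} {F : DiffFun} (h : Represents f F) {x t ε : ℝ} {w : ℕ → ℝ}
    (hw : w 0 ∈ V) : F x t ε w = ev f (x, t, ε, w) := h (x, t, ε, w) hw

lemma IsDiffFun.exists_represents {F : DiffFun} (h : IsDiffFun (V : Set ℝ) F) :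
    ∃ f : JetRing V, Represents f F := by
  obtain ⟨n, G, hG, h⟩ := h
  refine ⟨ofFinFun G hG, fun q hq => ?_⟩
  rw [h, ev_rep (ofFinFun_rep G hG) hq]
  rfl

lemma Represents.lineDeriv {f : JetRing V} {F : DiffFun} (h : Represents f F) {q : JetSpace}
    (hq : q ∈ jetDomain V) (v : JetSpace) :
    HasDerivAt (fun τ : ℝ => F (q + τ • v).1 (q + τ • v).2.1 (q + τ • v).2.2.1 (q + τ • v).2.2.2)
      (ev (pd v f) q) 0 := by
  rw [ev_pd f hq]
  refine (hasDerivAt_line f hq v).congr_of_eventuallyEq ?_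
  filter_upwards [eventually_line_mem hq v] with τ hτ using h _ hτ

lemma deriv_eq_of_shift {g G : ℝ → ℝ} {a g' : ℝ} (h : HasDerivAt G g' 0)
    (hg : ∀ s, g (a + s) = G s) : deriv g a = g' := by
  have h1 : HasDerivAt (fun s => g (a + s)) g' 0 := by
    rw [show (fun s => g (a + s)) = G from funext hg]
    exact h
  have h3 := HasDerivAt.comp_sub_const a a (f := fun s => g (a + s)) (f' := g') (by simpa using h1)
  simpa using h3.deriv

lemma Represents.jetPartial {f : JetRing V} {F : DiffFun} (h : Represents f F) (k : ℕ) :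
    Represents (dJ k f) (jetPartial k F) := by
  intro q hq
  refine deriv_eq_of_shift (h.lineDeriv hq (jetDir k)) fun s => ?_
  simp only [jetDir, Prod.smul_mk, smul_zero, Prod.fst_add, Prod.snd_add, add_zero]
  congr 1
  funext j
  by_cases hj : j = k
  · subst hj
    simp
  · simp [hj]

lemma Represents.xPartial {f : JetRing V} {F : DiffFun} (h : Represents f F) :
    Represents (dX f) (xPartial F) := by
  intro q hq
  refine deriv_eq_of_shift (h.lineDeriv hq _) fun s => ?_
  simp

lemma Represents.tPartial {f : JetRing V} {F : DiffFun} (h : Represents f F) :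
    Represents (dT f) (tPartial F) := by
  intro q hq
  refine deriv_eq_of_shift (h.lineDeriv hq _) fun s => ?_
  simp

lemma Represents.mul {f g : JetRing V} {F G : DiffFun} (hf : Represents f F)
    (hg : Represents g G) :
    Represents (f * g) (fun x t ε w => F x t ε w * G x t ε w) := by
  intro q hq
  rw [ev_mul hq, ← hf q hq, ← hg q hq]

lemma Represents.totalDeriv {f : JetRing V} {F : DiffFun} (h : Represents f F) :
    Represents (totalD f) (totalDeriv F) := by
  intro q hq
  obtain ⟨n, hn⟩ := exists_dJ_eq_zero f
  rw [StringEq.totalDeriv, h.xPartial q hq, totalD_apply hn, ev_add hq, ev_sum hq]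
  congr 1
  rw [finsum_eq_sum_range (n := n)]
  · refine Finset.sum_congr rfl fun k _ => ?_
    rw [ev_mul hq, ev_jetVar hq, h.jetPartial k q hq]
  · intro k hk
    rw [h.jetPartial k q hq, hn k hk, ev_zero, mul_zero]

lemma Represents.totalDeriv_iterate {f : JetRing V} {F : DiffFun} (h : Represents f F) (k : ℕ) :
    Represents (totalD^[k] f) (StringEq.totalDeriv^[k] F) := by
  induction k with
  | zero => exact h
  | succ k ih =>
    rw [Function.iterate_succ_apply', Function.iterate_succ_apply']
    exact ih.totalDeriv

lemma ev_negPow {q : JetSpace} (hq : q ∈ jetDomain V) (k : ℕ) (f : JetRing V) :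
    ev (negPow totalD k f) q = (-1) ^ k * ev (totalD^[k] f) q := by
  have : ∀ k (f : JetRing V), negPow totalD k f = (-1) ^ k * totalD^[k] f := by
    intro k f
    induction k generalizing f with
    | zero => simp
    | succ k ih =>
      rw [negPow_succ', ih, Function.iterate_succ_apply, pow_succ, iterate_map_neg]
      ring
  rw [this, ev_mul hq, ev_pow hq, ev_neg hq, ev_one hq]

/-- The Euler operator on the jet ring. -/
def eulerR (f : JetRing V) : JetRing V := eulerOp totalD dJ f

/-- Through this, identities of the jet algebra hold for the concrete operators at every point with
`u ∈ V`. Values outside the domain do not interfere: `V` is open, so each `deriv` only sees points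
where the function agrees with its representative. -/
lemma Represents.euler {f : JetRing V} {F : DiffFun} (h : Represents f F) :
    Represents (eulerR f) (euler F) := by
  intro q hq
  obtain ⟨n, hn⟩ := exists_dJ_eq_zero f
  rw [StringEq.euler, eulerR, eulerOp_eq hn, ev_sum hq, finsum_eq_sum_range (n := n)]
  · refine Finset.sum_congr rfl fun k _ => ?_
    rw [ev_negPow hq, (h.jetPartial k).totalDeriv_iterate k q hq]
  · intro k hk
    rw [(h.jetPartial k).totalDeriv_iterate k q hq, hn k hk, iterate_map_zero, ev_zero, mul_zero]

end StringEq

namespace StringEq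

open TopologicalSpace

variable {V : Opens ℝ}

/-! ### Order of a differential function, and the chain rule -/

/-- `f` depends only on the jet variables of order at most `L`. -/
def OrderLE (L : ℕ) (f : JetRing V) : Prop := ∀ k, L < k → dJ k f = 0

lemma OrderLE.pd {L : ℕ} {f : JetRing V} (h : OrderLE L f) (v : JetSpace) :
    OrderLE L (pd v f) := fun k hk => by rw [dJ, pd_comm, ← dJ, h k hk, map_zero]

lemma OrderLE.mono {L M : ℕ} {f : JetRing V} (h : OrderLE L f) (hLM : L ≤ M) : OrderLE M f :=
  fun k hk => h k (lt_of_le_of_lt hLM hk)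

lemma OrderLE.totalD {L : ℕ} {f : JetRing V} (h : OrderLE L f) : OrderLE (L + 1) (totalD f) :=
  isJetAlgebra.vanish_D (n := L + 1) h

lemma OrderLE.totalD_iterate {L : ℕ} {f : JetRing V} (h : OrderLE L f) (i : ℕ) :
    OrderLE (L + i) (StringEq.totalD^[i] f) := (isJetAlgebra.d_iterate_D h i).2

lemma jetDir_add_mem {q : JetSpace} (hq : q ∈ jetDomain V) {k : ℕ} (hk : 0 < k) (τ : ℝ) :
    q + τ • jetDir k ∈ jetDomain V := by
  have : (q + τ • jetDir k).2.2.2 0 = q.2.2.2 0 := by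
    simp [jetDir, Pi.single_eq_of_ne hk.ne]
  rw [jetDomain, Set.mem_ofPred_eq, this]
  exact hq

lemma hasDerivAt_jetDir (f : JetRing V) {q : JetSpace} (v : JetSpace) {τ : ℝ}
    (hq : q + τ • v ∈ jetDomain V) :
    HasDerivAt (fun s : ℝ => ev f (q + s • v)) (ev (pd v f) (q + τ • v)) τ := by
  have h := hasDerivAt_line f hq v
  rw [← ev_pd f hq] at h
  have h3 := HasDerivAt.comp_sub_const τ τ (f := fun s : ℝ => ev f (q + τ • v + s • v))
    (by simpa using h)
  refine h3.congr_of_eventuallyEq (Filter.Eventually.of_forall fun s => ?_)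
  simp only [add_assoc, ← add_smul]
  congr 3
  ring

/-- The coordinates of order above `L` are exchanged one at a time. Such an exchange moves in a
direction `jetDir k` with `k > 0`, so it leaves `u` unchanged and remains in the domain whatever the
shape of `V`; the derivative along it is zero. -/
lemma OrderLE.ev_eq {L : ℕ} {f : JetRing V} (h : OrderLE L f) {x t ε : ℝ} {w w' : ℕ → ℝ}
    (hw : ∀ j ≤ L, w j = w' j) : ev f (x, t, ε, w) = ev f (x, t, ε, w') := by
  by_cases hq : (x, t, ε, w) ∈ jetDomain V
  swap
  · have hq' : (x, t, ε, w') ∉ jetDomain V := by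
      simpa [jetDomain, ← hw 0 (Nat.zero_le _)] using hq
    simp [ev, hq, hq']
  obtain ⟨n, G, hG⟩ := f.2
  -- `d` counts the coordinates still to be exchanged. For `d = 0` the two jets agree in all
  -- variables of the representative.
  suffices H : ∀ d m, m + d = max n L → L ≤ m → ∀ w w' : ℕ → ℝ, (x, t, ε, w) ∈ jetDomain V →
      (∀ j ≤ m, w j = w' j) → ev f (x, t, ε, w) = ev f (x, t, ε, w') from
    H (max n L - L) L (by omega) le_rfl w w' hq hw
  intro d
  induction d with
  | zero =>
    intro m hm hL w w' hq hw
    have hq' : (x, t, ε, w') ∈ jetDomain V := by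
      simpa [jetDomain, ← hw 0 (Nat.zero_le _)] using hq
    rw [ev_rep hG hq, ev_rep hG hq']
    congr 1
    simp only [jetProj, LinearMap.coe_mk, AddHom.coe_mk, Prod.mk.injEq, true_and]
    funext i
    exact hw i (by omega)
  | succ d ih =>
    intro m hm hL w w' hq hw
    have h1 : ∀ τ : ℝ, HasDerivAt (fun s : ℝ => ev f ((x, t, ε, w) + s • jetDir (m + 1))) 0 τ := by
      intro τ
      have hmem := jetDir_add_mem hq (k := m + 1) (by omega) τ
      have := hasDerivAt_jetDir f (jetDir (m + 1)) hmem
      rwa [← dJ, h (m + 1) (by omega), ev_zero] at this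
    have h2 := is_const_of_deriv_eq_zero (fun τ => (h1 τ).differentiableAt)
      (fun τ => (h1 τ).deriv) 0 (w' (m + 1) - w (m + 1))
    simp only [zero_smul, add_zero] at h2
    rw [h2]
    have hmem := jetDir_add_mem hq (k := m + 1) (by omega) (w' (m + 1) - w (m + 1))
    simp only [jetDir, Prod.smul_mk, Prod.mk_add_mk, smul_zero, add_zero] at hmem ⊢
    refine ih (m + 1) (by omega) (by omega) _ _ hmem fun j hj => ?_
    rcases Nat.lt_or_ge m j with hj' | hj'
    · obtain rfl : j = m + 1 := by omega
      simp
    · have : j ≠ m + 1 := by omega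
      simp [this, hw j hj']

lemma Represents.orderLE {f : JetRing V} {F : DiffFun} (h : Represents f F) {L : ℕ}
    (hF : DependsOnJet (V : Set ℝ) L F) : OrderLE L f := by
  intro k hk
  apply JetRing.ext_ev
  intro q hq
  rw [dJ, ev_pd f hq, ev_zero]
  have : (fun τ : ℝ => ev f (q + τ • jetDir k)) = fun _ => ev f q := by
    funext τ
    have hq' := jetDir_add_mem hq (k := k) (by omega) τ
    rw [← h _ hq', ← h _ hq]
    have e1 : (q + τ • jetDir k).1 = q.1 := by simp [jetDir]
    have e2 : (q + τ • jetDir k).2.1 = q.2.1 := by simp [jetDir]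
    have e3 : (q + τ • jetDir k).2.2.1 = q.2.2.1 := by simp [jetDir]
    rw [e1, e2, e3]
    refine hF _ _ _ _ _ hq' fun j hj => ?_
    have : j ≠ k := by omega
    simp [jetDir, this]
  rw [this, deriv_const]

/-- The chain rule for a function of order at most `L` along a curve in the jet space. -/
lemma OrderLE.hasDerivWithinAt {L : ℕ} {f : JetRing V} (h : OrderLE L f) {x t e : ℝ → ℝ}
    {w : ℝ → ℕ → ℝ} {x' t' e' : ℝ} {w' : ℕ → ℝ} {S : Set ℝ} {s : ℝ}
    (hx : HasDerivWithinAt x x' S s) (ht : HasDerivWithinAt t t' S s)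
    (he : HasDerivWithinAt e e' S s)
    (hw : ∀ j ≤ L, HasDerivWithinAt (fun τ => w τ j) (w' j) S s) (hs : w s 0 ∈ V) :
    HasDerivWithinAt (fun τ => ev f (x τ, t τ, e τ, w τ))
      (x' * ev (dX f) (x s, t s, e s, w s) + t' * ev (dT f) (x s, t s, e s, w s)
        + e' * ev (dE f) (x s, t s, e s, w s)
        + ∑ k ∈ Finset.range (L + 1), w' k * ev (dJ k f) (x s, t s, e s, w s)) S s := by
  obtain ⟨n₀, G₀, hG₀⟩ := f.2
  obtain ⟨n, hn⟩ : ∃ n, n = max n₀ L := ⟨_, rfl⟩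
  obtain ⟨G, hG⟩ := hG₀.mono (m := n) (by omega)
  -- Only the jet variables up to `L` are known to be differentiable along the curve. The others are
  -- replaced by `0`, which by `OrderLE.ev_eq` does not affect the values.
  let tr : (ℕ → ℝ) → ℕ → ℝ := fun w j => if j ≤ L then w j else 0
  have htr : ∀ {g : JetRing V}, OrderLE L g → ∀ x t e w, ev g (x, t, e, w) = ev g (x, t, e, tr w) :=
    fun hg x t e w => hg.ev_eq fun j hj => by simp [tr, hj]
  have hγ : HasDerivWithinAt (fun τ => jetProj n (x τ, t τ, e τ, tr (w τ)))
      (x', t', e', fun i : Fin (n + 1) => tr w' i) S s := by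
    refine hx.prodMk (ht.prodMk (he.prodMk (hasDerivWithinAt_pi.2 fun i => ?_)))
    by_cases hi : (i : ℕ) ≤ L
    · simpa [tr, hi] using hw i hi
    · simpa [tr, hi] using hasDerivWithinAt_const s S (0 : ℝ)
  have hmem : (x s, t s, e s, tr (w s)) ∈ jetDomain V := by simpa [jetDomain, tr] using hs
  have key := hG.hasDerivWithinAt hγ hmem
  simp only [← htr h] at key
  convert key using 1
  have hpd : ∀ v, ev (StringEq.pd v f) (x s, t s, e s, w s)
      = fderiv ℝ G (jetProj n (x s, t s, e s, tr (w s))) (jetProj n v) := by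
    intro v
    rw [htr (h.pd v), ev_rep (hG.pd v) hmem]
  have hv : ((x', t', e', fun i : Fin (n + 1) => tr w' i) : FinJetSpace n)
      = x' • jetProj n (1, 0, 0, 0) + t' • jetProj n (0, 1, 0, 0) + e' • jetProj n (0, 0, 1, 0)
        + ∑ k ∈ Finset.range (L + 1), w' k • jetProj n (jetDir k) := by
    simp only [← map_smul, ← map_sum, ← map_add]
    have hsum : ∑ k ∈ Finset.range (L + 1), w' k • jetDir k = (0, 0, 0, tr w') := by
      have h0 : ∀ k, w' k • jetDir k = ((0, 0, 0, w' k • Pi.single k 1) : JetSpace) := by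
        intro k
        simp [jetDir]
      rw [Finset.sum_congr rfl fun k _ => h0 k]
      refine Prod.ext (by simp [Prod.fst_sum]) (Prod.ext (by simp [Prod.fst_sum, Prod.snd_sum])
        (Prod.ext (by simp [Prod.fst_sum, Prod.snd_sum]) ?_))
      simp only [Prod.snd_sum]
      funext j
      simp only [tr, Finset.sum_apply, Pi.smul_apply, smul_eq_mul, Pi.single_apply, mul_ite, mul_one,
        mul_zero, Finset.sum_ite_eq, Finset.mem_range, Nat.lt_succ_iff]
    rw [hsum]
    simp [jetProj]
  rw [hv]
  simp only [map_add, map_smul, map_sum, smul_eq_mul, dX, dT, dE, dJ, hpd]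

end StringEq

namespace StringEq

open Filter Topology Set

/-! ### Mixed partial derivatives -/

/-- Equality of mixed partial derivatives: if `g_t = G` and `G_x = P` is continuous, then the
`x`-derivative `p` of `g` has the `t`-derivative `P`. -/
lemma hasDerivWithinAt_of_mixed {g G P : ℝ → ℝ → ℝ} {p : ℝ → ℝ} {S : Set ℝ} (hS : Convex ℝ S)
    {x₀ t₀ : ℝ} (ht₀ : t₀ ∈ S)
    (hg : ∀ᶠ q in 𝓝[univ ×ˢ S] (x₀, t₀), HasDerivWithinAt (fun t => g q.1 t) (G q.1 q.2) S q.2)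
    (hp : ∀ᶠ t in 𝓝[S] t₀, HasDerivAt (fun x => g x t) (p t) x₀)
    (hG : ∀ᶠ q in 𝓝[univ ×ˢ S] (x₀, t₀), HasDerivAt (fun x => G x q.2) (P q.1 q.2) q.1)
    (hP : ContinuousWithinAt (fun q : ℝ × ℝ => P q.1 q.2) (univ ×ˢ S) (x₀, t₀)) :
    HasDerivWithinAt p (P x₀ t₀) S t₀ := by
  rw [hasDerivWithinAt_iff_isLittleO, Asymptotics.isLittleO_iff]
  intro c hc
  have hP' : ∀ᶠ q in 𝓝[univ ×ˢ S] (x₀, t₀), ‖P q.1 q.2 - P x₀ t₀‖ ≤ c := by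
    have := hP.eventually (Metric.closedBall_mem_nhds (P x₀ t₀) hc)
    filter_upwards [this] with q hq
    simpa [dist_eq_norm] using hq
  obtain ⟨δ, hδ, H⟩ := Metric.mem_nhdsWithin_iff.1 (hg.and (hG.and hP'))
  obtain ⟨δ', hδ', H'⟩ := Metric.mem_nhdsWithin_iff.1 hp
  have hbox : ∀ x t, |x - x₀| < δ → |t - t₀| < δ → t ∈ S →
      HasDerivWithinAt (fun t => g x t) (G x t) S t ∧ HasDerivAt (fun x => G x t) (P x t) x ∧
        ‖P x t - P x₀ t₀‖ ≤ c := by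
    intro x t hx ht htS
    exact H (a := (x, t)) ⟨by simp [Prod.dist_eq, Real.dist_eq, hx, ht], by simp [htS]⟩
  have hp' : ∀ t, |t - t₀| < δ' → t ∈ S → HasDerivAt (fun x => g x t) (p t) x₀ :=
    fun t ht htS => H' ⟨by simpa [Real.dist_eq] using ht, htS⟩
  refine eventually_nhdsWithin_iff.2 (Metric.eventually_nhds_iff.2 ⟨min δ δ', lt_min hδ hδ', ?_⟩)
  intro t ht htS
  rw [Real.dist_eq] at ht
  have ht1 : |t - t₀| < δ := ht.trans_le (min_le_left _ _)
  have ht2 : |t - t₀| < δ' := ht.trans_le (min_le_right _ _)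
  -- the increment of `G` in `x`
  have hGx : ∀ x s, |x - x₀| < δ → |s - t₀| < δ → s ∈ S →
      ‖G x s - G x₀ s - (x - x₀) * P x₀ t₀‖ ≤ c * |x - x₀| := by
    intro x s hx hs hsS
    have hd : ∀ y ∈ Metric.ball x₀ δ, HasDerivWithinAt (fun y => G y s - (y - x₀) * P x₀ t₀)
        (P y s - P x₀ t₀) (Metric.ball x₀ δ) y := by
      intro y hy
      have h1 := (hbox y s (by simpa [Real.dist_eq] using hy) hs hsS).2.1
      have h2 := ((hasDerivAt_id y).sub_const x₀).mul_const (P x₀ t₀)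
      exact (h1.sub h2).hasDerivWithinAt.congr_deriv (by simp)
    have := (convex_ball x₀ δ).norm_image_sub_le_of_norm_hasDerivWithin_le hd
      (fun y hy => (hbox y s (by simpa [Real.dist_eq] using hy) hs hsS).2.2)
      (Metric.mem_ball_self hδ) (show x ∈ Metric.ball x₀ δ by simpa [Real.dist_eq] using hx)
    simpa [Real.norm_eq_abs, sub_right_comm] using this
  -- The second difference of `g`, minus its expected value, by the mean value inequality in `t`;
  -- `hGx` bounds the derivative.
  have hψ : ∀ x, |x - x₀| < δ →
      ‖(g x t - g x t₀ - (x - x₀) * ((t - t₀) * P x₀ t₀)) - (g x₀ t - g x₀ t₀)‖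
        ≤ c * |t - t₀| * ‖x - x₀‖ := by
    intro x hx
    have hconv : Convex ℝ (S ∩ Metric.ball t₀ δ) := hS.inter (convex_ball _ _)
    have hd : ∀ s ∈ S ∩ Metric.ball t₀ δ,
        HasDerivWithinAt (fun s => g x s - g x₀ s - s * ((x - x₀) * P x₀ t₀))
          (G x s - G x₀ s - (x - x₀) * P x₀ t₀) (S ∩ Metric.ball t₀ δ) s := by
      intro s hs
      have hs' : |s - t₀| < δ := by simpa [Real.dist_eq] using hs.2
      have h1 := (hbox x s hx hs' hs.1).1.mono (inter_subset_left (t := Metric.ball t₀ δ))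
      have h2 := (hbox x₀ s (by simpa using hδ) hs' hs.1).1.mono (inter_subset_left (t := Metric.ball t₀ δ))
      have h3 := ((hasDerivAt_id s).mul_const ((x - x₀) * P x₀ t₀)).hasDerivWithinAt
        (s := S ∩ Metric.ball t₀ δ)
      exact ((h1.sub h2).sub h3).congr_deriv (by simp)
    have := hconv.norm_image_sub_le_of_norm_hasDerivWithin_le hd (C := c * |x - x₀|)
      (fun s hs => hGx x s hx (by simpa [Real.dist_eq] using hs.2) hs.1)
      ⟨ht₀, Metric.mem_ball_self hδ⟩ (show t ∈ S ∩ Metric.ball t₀ δ from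
        ⟨htS, by simpa [Real.dist_eq] using ht1⟩)
    calc _ = ‖g x t - g x₀ t - t * ((x - x₀) * P x₀ t₀)
              - (g x t₀ - g x₀ t₀ - t₀ * ((x - x₀) * P x₀ t₀))‖ := by congr 1; ring
      _ ≤ _ := this
      _ = _ := by simp only [Real.norm_eq_abs]; ring
  have hder : HasDerivAt (fun x => g x t - g x t₀ - (x - x₀) * ((t - t₀) * P x₀ t₀))
      (p t - p t₀ - (t - t₀) * P x₀ t₀) x₀ := by
    have h2 := ((hasDerivAt_id x₀).sub_const x₀).mul_const ((t - t₀) * P x₀ t₀)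
    exact (((hp' t ht2 htS).sub (hp' t₀ (by simpa using hδ') ht₀)).sub h2).congr_deriv (by simp)
  -- Dividing the bound `hψ` by `x - x₀` and letting `x → x₀` gives the required estimate for the
  -- increment of `p`.
  have := hder.le_of_lip' (C := c * |t - t₀|) (by positivity) (by
    filter_upwards [Metric.ball_mem_nhds x₀ hδ] with x hx
    simpa using hψ x (by simpa [Real.dist_eq] using hx))
  simpa [smul_eq_mul, Real.norm_eq_abs] using this

/-- Taylor's formula of second order with integral remainder. -/
lemma taylor_two {f f' f'' : ℝ → ℝ} {a b : ℝ}
    (h1 : ∀ s ∈ uIcc a b, HasDerivAt f (f' s) s) (h2 : ∀ s ∈ uIcc a b, HasDerivAt f' (f'' s) s)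
    (h3 : ContinuousOn f'' (uIcc a b)) :
    f b = f a + (b - a) * f' a + ∫ s in a..b, (b - s) * f'' s := by
  have h : ∀ s ∈ uIcc a b, HasDerivAt (fun s => f s + (b - s) * f' s) ((b - s) * f'' s) s := by
    intro s hs
    have := (h1 s hs).add (((hasDerivAt_id s).const_sub b).mul (h2 s hs))
    refine this.congr_deriv ?_
    simp
  rw [intervalIntegral.integral_eq_sub_of_hasDerivAt h
    (ContinuousOn.intervalIntegrable (by fun_prop))]
  ring

/-- The derivative of the remainder in Taylor's formula of second order. -/
lemma hasDerivAt_taylor_remainder {f : ℝ → ℝ} {U : Set ℝ} (hU : IsOpen U) (hc : OrdConnected U)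
    (hf : ContinuousOn f U) {a e : ℝ} (ha : a ∈ U) (he : e ∈ U) :
    HasDerivAt (fun e => ∫ s in a..e, (e - s) * f s) (∫ s in a..e, f s) e ∧
      HasDerivAt (fun e => ∫ s in a..e, f s) (f e) e := by
  have hint : ∀ {g : ℝ → ℝ}, ContinuousOn g U → ∀ b ∈ U, IntervalIntegrable g MeasureTheory.volume a b :=
    fun hg b hb => (hg.mono (hc.uIcc_subset ha hb)).intervalIntegrable
  have hd : ∀ {g : ℝ → ℝ}, ContinuousOn g U → HasDerivAt (fun e => ∫ s in a..e, g s) (g e) e :=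
    fun hg => intervalIntegral.integral_hasDerivAt_right (hint hg e he)
      (hg.stronglyMeasurableAtFilter hU e he) (hg.continuousAt (hU.mem_nhds he))
  have hsf : ContinuousOn (fun s => s * f s) U := by fun_prop
  refine ⟨?_, hd hf⟩
  have h1 := ((hasDerivAt_id e).mul (hd hf)).sub (hd hsf)
  refine (h1.congr_of_eventuallyEq ?_).congr_deriv (by simp)
  filter_upwards [hU.mem_nhds he] with b hb
  have : ∀ s, (b - s) * f s = b * f s - s * f s := fun s => by ring
  simp only [this]
  rw [intervalIntegral.integral_sub ((hint hf b hb).const_mul b) (hint hsf b hb),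
    intervalIntegral.integral_const_mul]
  rfl

/-- If `g_ee = G` and `G_x = P`, then the `x`-derivative `p` of `g` satisfies `p_ee = P`. -/
lemma exists_second_deriv_of_mixed {g R G P : ℝ → ℝ → ℝ} {p : ℝ → ℝ} {x₀ e₀ : ℝ}
    (hg : ∀ᶠ q in 𝓝 (x₀, e₀), HasDerivAt (fun e => g q.1 e) (R q.1 q.2) q.2)
    (hR : ∀ᶠ q in 𝓝 (x₀, e₀), HasDerivAt (fun e => R q.1 e) (G q.1 q.2) q.2)
    (hp : ∀ᶠ e in 𝓝 e₀, HasDerivAt (fun x => g x e) (p e) x₀)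
    (hG : ∀ᶠ q in 𝓝 (x₀, e₀), HasDerivAt (fun x => G x q.2) (P q.1 q.2) q.1)
    (hGc : ∀ᶠ q in 𝓝 (x₀, e₀), ContinuousAt (fun q : ℝ × ℝ => G q.1 q.2) q)
    (hPc : ∀ᶠ q in 𝓝 (x₀, e₀), ContinuousAt (fun q : ℝ × ℝ => P q.1 q.2) q) :
    ∃ Q : ℝ → ℝ, ∀ᶠ e in 𝓝 e₀, HasDerivAt p (Q e) e ∧ HasDerivAt Q (P x₀ e) e := by
  obtain ⟨δ, hδ, H⟩ := Metric.eventually_nhds_iff.1 (hg.and (hR.and (hG.and (hGc.and hPc))))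
  obtain ⟨δ', hδ', H'⟩ := Metric.eventually_nhds_iff.1 hp
  obtain ⟨ρ, hρ, hρδ, hρδ'⟩ : ∃ ρ > 0, ρ < δ ∧ ρ < δ' :=
    ⟨min δ δ' / 2, by positivity, by linarith [min_le_left δ δ', lt_min hδ hδ'],
      by linarith [min_le_right δ δ', lt_min hδ hδ']⟩
  have hbox : ∀ x e, |x - x₀| < δ → |e - e₀| < δ → _ := fun x e hx he =>
    H (y := (x, e)) (by simp [Prod.dist_eq, Real.dist_eq, hx, he])
  have hp' : ∀ e, |e - e₀| < δ' → HasDerivAt (fun x => g x e) (p e) x₀ := fun e he =>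
    H' (by simpa [Real.dist_eq] using he)
  set U : Set ℝ := Metric.ball e₀ δ with hUdef
  have hU : ∀ {e}, e ∈ U ↔ |e - e₀| < δ := fun {e} => by simp [U, Real.dist_eq]
  have hUo : IsOpen U := Metric.isOpen_ball
  have hUc : OrdConnected U := (convex_ball e₀ δ).ordConnected
  have he₀ : e₀ ∈ U := Metric.mem_ball_self hδ
  have hGU : ∀ x, |x - x₀| < δ → ContinuousOn (fun s => G x s) U := fun x hx s hs =>
    ((hbox x s hx (hU.1 hs)).2.2.2.1.comp (f := fun s => (x, s))
      (by fun_prop)).continuousWithinAt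
  have hPU : ∀ x, |x - x₀| < δ → ContinuousOn (fun s => P x s) U := fun x hx s hs =>
    ((hbox x s hx (hU.1 hs)).2.2.2.2.comp (f := fun s => (x, s))
      (by fun_prop)).continuousWithinAt
  have hx₀ : |x₀ - x₀| < δ := by simpa using hδ
  -- Taylor's formula for `g`
  have hT : ∀ x e, |x - x₀| < δ → e ∈ U →
      g x e = g x e₀ + (e - e₀) * R x e₀ + ∫ s in e₀..e, (e - s) * G x s := by
    intro x e hx he
    have hsub := hUc.uIcc_subset he₀ he
    exact taylor_two (fun s hs => (hbox x s hx (hU.1 (hsub hs))).1)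
      (fun s hs => (hbox x s hx (hU.1 (hsub hs))).2.1) ((hGU x hx).mono hsub)
  -- differentiation of the remainder
  have hJ : ∀ e, |e - e₀| ≤ ρ → HasDerivAt (fun x => ∫ s in e₀..e, (e - s) * G x s)
      (∫ s in e₀..e, (e - s) * P x₀ s) x₀ := by
    intro e he
    have heU : e ∈ U := hU.2 (he.trans_lt hρδ)
    have hsub := hUc.uIcc_subset he₀ heU
    have hK : IsCompact (Metric.closedBall x₀ ρ ×ˢ uIcc e₀ e) :=
      (isCompact_closedBall _ _).prod isCompact_uIcc
    obtain ⟨C, hC⟩ := hK.exists_bound_of_continuousOn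
      (f := fun q : ℝ × ℝ => (e - q.2) * P q.1 q.2) (fun q hq => by
        have hq1 : |q.1 - x₀| < δ := by
          have := hq.1
          rw [Metric.mem_closedBall, Real.dist_eq] at this
          linarith
        have := (hbox q.1 q.2 hq1 (hU.1 (hsub hq.2))).2.2.2.2
        exact ((continuousAt_const.sub continuousAt_snd).mul this).continuousWithinAt)
    have hball : ∀ x ∈ Metric.ball x₀ ρ, |x - x₀| < δ := fun x hx => by
      rw [Metric.mem_ball, Real.dist_eq] at hx
      linarith
    have hmeas : ∀ {f : ℝ → ℝ}, ContinuousOn f U → MeasureTheory.AEStronglyMeasurable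
        (fun s => (e - s) * f s) (MeasureTheory.volume.restrict (uIoc e₀ e)) := fun {f} hf =>
      (ContinuousOn.aestronglyMeasurable (s := uIoc e₀ e) (by
        have : ContinuousOn f (uIoc e₀ e) := hf.mono (uIoc_subset_uIcc.trans hsub)
        fun_prop) measurableSet_uIoc)
    refine (intervalIntegral.hasDerivAt_integral_of_dominated_loc_of_deriv_le
      (F' := fun x s => (e - s) * P x s) (bound := fun _ => C)
      (Metric.ball_mem_nhds x₀ hρ) ?_ ?_ (hmeas (hPU x₀ hx₀)) ?_ (by simp) ?_).2
    · filter_upwards [Metric.ball_mem_nhds x₀ hρ] with x hx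
      exact hmeas (hGU x (hball x hx))
    · refine ContinuousOn.intervalIntegrable ?_
      have := (hGU x₀ hx₀).mono hsub
      fun_prop
    · refine Eventually.of_forall fun s hs x hx => ?_
      exact hC (x, s) ⟨Metric.ball_subset_closedBall hx, uIoc_subset_uIcc hs⟩
    · refine Eventually.of_forall fun s hs x hx => ?_
      exact ((hbox x s (hball x hx) (hU.1 (hsub (uIoc_subset_uIcc hs)))).2.2.1).const_mul _
  -- the derivative of `R` at the base point
  have hRx : ∃ Q₀, HasDerivAt (fun x => R x e₀) Q₀ x₀ := by
    have hb : |e₀ + ρ - e₀| ≤ ρ := by simp [abs_of_pos hρ]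
    have hbU : e₀ + ρ ∈ U := hU.2 (hb.trans_lt hρδ)
    -- Taylor's formula at `e₀ + ρ` can be solved for `R x e₀`; all other terms in it are already
    -- differentiable in `x` at `x₀`.
    have h1 := (((hp' (e₀ + ρ) (hb.trans_lt hρδ')).sub (hp' e₀ (by simpa using hδ'))).sub
      (hJ _ hb)).div_const ρ
    refine ⟨_, h1.congr_of_eventuallyEq ?_⟩
    filter_upwards [Metric.ball_mem_nhds x₀ hδ] with x hx
    have := hT x (e₀ + ρ) (by simpa [Real.dist_eq] using hx) hbU
    simp only [Pi.sub_apply]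
    rw [this]
    field_simp
    ring
  obtain ⟨Q₀, hQ₀⟩ := hRx
  -- Taylor's formula differentiated in `x`. It exhibits `p` as an affine function plus a twofold
  -- integral of the continuous `P x₀`.
  have hpT : ∀ e, |e - e₀| ≤ ρ → p e = p e₀ + (e - e₀) * Q₀ + ∫ s in e₀..e, (e - s) * P x₀ s := by
    intro e he
    have heU : e ∈ U := hU.2 (he.trans_lt hρδ)
    have h1 := ((hp' e₀ (by simpa using hδ')).add (hQ₀.const_mul (e - e₀))).add (hJ e he)
    refine (hp' e (he.trans_lt hρδ')).unique (h1.congr_of_eventuallyEq ?_)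
    filter_upwards [Metric.ball_mem_nhds x₀ hδ] with x hx
    exact hT x e (by simpa [Real.dist_eq] using hx) heU
  refine ⟨fun e => Q₀ + ∫ s in e₀..e, P x₀ s, ?_⟩
  filter_upwards [Metric.ball_mem_nhds e₀ hρ] with e he
  have he' : |e - e₀| < ρ := by simpa [Real.dist_eq] using he
  have hd := hasDerivAt_taylor_remainder hUo hUc (hPU x₀ hx₀) he₀ (hU.2 (he'.trans hρδ))
  refine ⟨?_, hd.2.const_add _⟩
  have h1 := ((((hasDerivAt_id e).sub_const e₀).mul_const Q₀).const_add (p e₀)).add hd.1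
  rw [one_mul] at h1
  refine h1.congr_of_eventuallyEq ?_
  filter_upwards [Metric.isOpen_ball.mem_nhds he] with s hs
  exact hpT s (by rw [Metric.mem_ball, Real.dist_eq] at hs; exact hs.le)

end StringEq

namespace StringEq

open Filter Topology Set

/-! ### Functions on a relatively open subset of the slab `0 ≤ t ≤ T` -/

/-- The slab `0 ≤ t ≤ T`. -/
def slab (T : ℝ) : Set (ℝ × ℝ × ℝ) := {q | q.2.1 ∈ Icc 0 T}

/-- `D` is a relatively open subset of the slab. -/
structure RelOpen (T : ℝ) (D : Set (ℝ × ℝ × ℝ)) : Prop where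
  subset : D ⊆ slab T
  mem_nhds : ∀ q ∈ D, D ∈ 𝓝[slab T] q

/-- `F'` is the `x`-derivative of `F` on `D`. -/
def HasDx (D : Set (ℝ × ℝ × ℝ)) (F F' : ℝ × ℝ × ℝ → ℝ) : Prop :=
  ∀ q ∈ D, HasDerivAt (fun y => F (y, q.2.1, q.2.2)) (F' q) q.1

/-- `F'` is the `ε`-derivative of `F` on `D`. -/
def HasDe (D : Set (ℝ × ℝ × ℝ)) (F F' : ℝ × ℝ × ℝ → ℝ) : Prop :=
  ∀ q ∈ D, HasDerivAt (fun e => F (q.1, q.2.1, e)) (F' q) q.2.2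

/-- `F'` is the (one-sided at `t = 0`, `t = T`) `t`-derivative of `F` on `D`. -/
def HasDt (T : ℝ) (D : Set (ℝ × ℝ × ℝ)) (F F' : ℝ × ℝ × ℝ → ℝ) : Prop :=
  ∀ q ∈ D, HasDerivWithinAt (fun τ => F (q.1, τ, q.2.2)) (F' q) (Icc 0 T) q.2.1

variable {T : ℝ} {D : Set (ℝ × ℝ × ℝ)}

lemma slab_tendsto_xt (q : ℝ × ℝ × ℝ) : Tendsto (fun p : ℝ × ℝ => (p.1, p.2, q.2.2))
    (𝓝[univ ×ˢ Icc 0 T] (q.1, q.2.1)) (𝓝[slab T] q) := by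
  refine tendsto_nhdsWithin_iff.2 ⟨?_, ?_⟩
  · exact ((show Continuous fun p : ℝ × ℝ => (p.1, p.2, q.2.2) by fun_prop).tendsto
      (q.1, q.2.1)).mono_left nhdsWithin_le_nhds
  · filter_upwards [self_mem_nhdsWithin] with p hp using hp.2

lemma slab_tendsto_t (q : ℝ × ℝ × ℝ) : Tendsto (fun t : ℝ => (q.1, t, q.2.2)) (𝓝[Icc 0 T] q.2.1) (𝓝[slab T] q) := by
  refine tendsto_nhdsWithin_iff.2 ⟨?_, ?_⟩
  · exact ((show Continuous fun t : ℝ => (q.1, t, q.2.2) by fun_prop).tendsto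
      q.2.1).mono_left nhdsWithin_le_nhds
  · filter_upwards [self_mem_nhdsWithin] with p hp using hp

namespace RelOpen

variable (hD : RelOpen T D) {q : ℝ × ℝ × ℝ} (hq : q ∈ D)
include hD hq

lemma tendsto_xe : Tendsto (fun p : ℝ × ℝ => (p.1, q.2.1, p.2))
    (𝓝 (q.1, q.2.2)) (𝓝[slab T] q) := by
  refine tendsto_nhdsWithin_iff.2 ⟨?_, Eventually.of_forall fun _ => (hD.subset hq : q.2.1 ∈ Icc 0 T)⟩
  exact (show Continuous fun p : ℝ × ℝ => (p.1, q.2.1, p.2) by fun_prop).tendsto (q.1, q.2.2)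

lemma tendsto_ex : Tendsto (fun p : ℝ × ℝ => (p.2, q.2.1, p.1))
    (𝓝 (q.2.2, q.1)) (𝓝[slab T] q) := by
  refine tendsto_nhdsWithin_iff.2 ⟨?_, Eventually.of_forall fun _ => (hD.subset hq : q.2.1 ∈ Icc 0 T)⟩
  exact (show Continuous fun p : ℝ × ℝ => (p.2, q.2.1, p.1) by fun_prop).tendsto (q.2.2, q.1)

lemma tendsto_x : Tendsto (fun y : ℝ => (y, q.2.1, q.2.2)) (𝓝 q.1) (𝓝[slab T] q) := by
  refine tendsto_nhdsWithin_iff.2 ⟨?_, Eventually.of_forall fun _ => (hD.subset hq : q.2.1 ∈ Icc 0 T)⟩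
  exact (show Continuous fun y : ℝ => (y, q.2.1, q.2.2) by fun_prop).tendsto q.1

lemma tendsto_e : Tendsto (fun e : ℝ => (q.1, q.2.1, e)) (𝓝 q.2.2) (𝓝[slab T] q) := by
  refine tendsto_nhdsWithin_iff.2 ⟨?_, Eventually.of_forall fun _ => (hD.subset hq : q.2.1 ∈ Icc 0 T)⟩
  exact (show Continuous fun e : ℝ => (q.1, q.2.1, e) by fun_prop).tendsto q.2.2

lemma continuousWithinAt_slab {F : ℝ × ℝ × ℝ → ℝ} (hF : ContinuousOn F D) :
    ContinuousWithinAt F (slab T) q :=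
  (hF q hq).mono_of_mem_nhdsWithin (hD.mem_nhds q hq)

end RelOpen

/-- Supplies the `t`-derivatives of `u_x`, `u_xx`, ..., since the evolution equation directly gives
only that of `u`. -/
lemma RelOpen.hasDt_of_mixed (hD : RelOpen T D) {g G p P : ℝ × ℝ × ℝ → ℝ} (hg : HasDt T D g G)
    (hp : HasDx D g p) (hG : HasDx D G P) (hP : ContinuousOn P D) : HasDt T D p P := by
  intro q hq
  have hxt := (slab_tendsto_xt q).eventually (hD.mem_nhds q hq)
  refine hasDerivWithinAt_of_mixed (g := fun x t => g (x, t, q.2.2))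
    (G := fun x t => G (x, t, q.2.2)) (P := fun x t => P (x, t, q.2.2)) (convex_Icc _ _)
    (hD.subset hq) ?_ ?_ ?_ ?_
  · filter_upwards [hxt] with a ha using hg _ ha
  · filter_upwards [(slab_tendsto_t q).eventually (hD.mem_nhds q hq)] with t ht using hp _ ht
  · filter_upwards [hxt] with a ha using hG _ ha
  · exact (hD.continuousWithinAt_slab hq hP).tendsto.comp (slab_tendsto_xt q)

/-- The mixed derivative theorem with `ε` and `x` in the roles of `x` and `t`. -/
lemma RelOpen.hasDx_of_mixed (hD : RelOpen T D) {g G p P : ℝ × ℝ × ℝ → ℝ} (hg : HasDx D g G)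
    (hp : HasDe D g p) (hG : HasDe D G P) (hP : ContinuousOn P D) : HasDx D p P := by
  intro q hq
  have hex := (hD.tendsto_ex hq).eventually (hD.mem_nhds q hq)
  rw [← hasDerivWithinAt_univ]
  refine hasDerivWithinAt_of_mixed (g := fun e x => g (x, q.2.1, e))
    (G := fun e x => G (x, q.2.1, e)) (P := fun e x => P (x, q.2.1, e)) convex_univ
    (mem_univ _) ?_ ?_ ?_ ?_
  · rw [univ_prod_univ, nhdsWithin_univ]
    filter_upwards [hex] with a ha using (hg _ ha).hasDerivWithinAt
  · rw [nhdsWithin_univ]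
    filter_upwards [(hD.tendsto_x hq).eventually (hD.mem_nhds q hq)] with t ht using hp _ ht
  · rw [univ_prod_univ, nhdsWithin_univ]
    filter_upwards [hex] with a ha using hG _ ha
  · rw [univ_prod_univ, continuousWithinAt_univ]
    exact (hD.continuousWithinAt_slab hq hP).tendsto.comp (hD.tendsto_ex hq)

/-- The derivative of a function with two `ε`-derivatives is continuous if the function and its
second derivative are. -/
lemma RelOpen.continuousOn_of_second_deriv (hD : RelOpen T D) {p Q P : ℝ × ℝ × ℝ → ℝ}
    (hpQ : HasDe D p Q) (hQP : HasDe D Q P) (hp : ContinuousOn p D) (hP : ContinuousOn P D) :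
    ContinuousOn Q D := by
  intro q hq
  refine ContinuousWithinAt.mono ?_ hD.subset
  refine continuousWithinAt_of_locally_uniform_approx_of_continuousWithinAt (hD.subset hq) ?_
  intro u hu
  obtain ⟨η, hη, hηu⟩ := Metric.mem_uniformity_dist.1 hu
  obtain ⟨C, hC, hb⟩ : ∃ C > 0, ∀ᶠ a in 𝓝[slab T] q, |P a| ≤ C := by
    refine ⟨|P q| + 1, by positivity, ?_⟩
    have := (hD.continuousWithinAt_slab hq hP).abs.eventually_lt_const (lt_add_one |P q|)
    filter_upwards [this] with a ha using ha.le
  obtain ⟨δ, hδ, H⟩ := Metric.mem_nhdsWithin_iff.1 (hb.and (hD.mem_nhds q hq))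
  have hbox : ∀ a ∈ slab T, dist a q < δ → |P a| ≤ C ∧ a ∈ D := fun a ha had => H ⟨had, ha⟩
  -- A difference quotient of `p` in `ε` with fixed step `s` is continuous at `q`, and by the mean
  -- value theorem and `|P| ≤ C` it lies within `C * s < η` of `Q` at all nearby points. Thus `Q` is
  -- a locally uniform limit of such quotients.
  obtain ⟨s, hs, hsδ, hsη⟩ : ∃ s > 0, s < δ / 2 ∧ C * s < η :=
    ⟨min (δ / 4) (η / (2 * C)), by positivity, by linarith [min_le_left (δ / 4) (η / (2 * C))], by
      have := min_le_right (δ / 4) (η / (2 * C))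
      calc C * min (δ / 4) (η / (2 * C)) ≤ C * (η / (2 * C)) := by gcongr
        _ = η / 2 := by field_simp
        _ < η := by linarith⟩
  have hshift : ∀ a ∈ slab T, dist a q < δ / 2 → ∀ r, |r| ≤ s →
      (a.1, a.2.1, a.2.2 + r) ∈ slab T ∧ dist (a.1, a.2.1, a.2.2 + r) q < δ := by
    intro a ha had r hr
    refine ⟨ha, ?_⟩
    have h1 : dist (a.1, a.2.1, a.2.2 + r) a ≤ |r| := by
      simp [Prod.dist_eq]
    linarith [dist_triangle (a.1, a.2.1, a.2.2 + r) a q]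
  refine ⟨slab T ∩ Metric.ball q (δ / 2), inter_mem_nhdsWithin _ (Metric.ball_mem_nhds _ (by positivity)),
    fun a => (p (a.1, a.2.1, a.2.2 + s) - p a) / s, ?_, ?_⟩
  · have hqs := hshift q (hD.subset hq) (by simpa using hδ) s (by rw [abs_of_pos hs])
    have hqs' := hD.continuousWithinAt_slab (hbox _ hqs.1 hqs.2).2 hp
    have hc : ContinuousWithinAt (fun a : ℝ × ℝ × ℝ => p (a.1, a.2.1, a.2.2 + s)) (slab T) q :=
      ContinuousWithinAt.comp (f := fun a : ℝ × ℝ × ℝ => (a.1, a.2.1, a.2.2 + s))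
        (t := slab T) (g := p) hqs' (by fun_prop) (fun a ha => ha)
    exact (hc.sub (hD.continuousWithinAt_slab hq hp)).div_const s
  · rintro a ⟨ha, had⟩
    apply hηu
    have hin : ∀ e ∈ Icc a.2.2 (a.2.2 + s), |P (a.1, a.2.1, e)| ≤ C ∧ (a.1, a.2.1, e) ∈ D := by
      intro e he
      have := hshift a ha had (e - a.2.2) (by rw [abs_of_nonneg (by linarith [he.1])]; linarith [he.2])
      simpa using hbox _ this.1 this.2
    have hQd : ∀ e ∈ Icc a.2.2 (a.2.2 + s), |Q (a.1, a.2.1, e) - Q a| ≤ C * s := by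
      intro e he
      have := (convex_Icc a.2.2 (a.2.2 + s)).norm_image_sub_le_of_norm_hasDerivWithin_le
        (f := fun e => Q (a.1, a.2.1, e)) (f' := fun e => P (a.1, a.2.1, e)) (C := C)
        (fun e he => (hQP _ (hin e he).2).hasDerivWithinAt) (fun e he => (hin e he).1)
        (left_mem_Icc.2 (by linarith)) he
      refine this.trans ?_
      gcongr
      rw [Real.norm_eq_abs, abs_of_nonneg (by linarith [he.1])]
      linarith [he.2]
    obtain ⟨ξ, hξ, hξ'⟩ := exists_hasDerivAt_eq_slope (fun e => p (a.1, a.2.1, e))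
      (fun e => Q (a.1, a.2.1, e)) (show a.2.2 < a.2.2 + s by linarith)
      (fun e he => (hpQ _ (hin e he).2).continuousAt.continuousWithinAt)
      (fun e he => hpQ _ (hin e (Ioo_subset_Icc_self he)).2)
    rw [add_sub_cancel_left] at hξ'
    have h2 := hQd ξ (Ioo_subset_Icc_self hξ)
    rw [hξ'] at h2
    rw [dist_comm, Real.dist_eq]
    exact lt_of_le_of_lt h2 hsη

/-- The pointwise existence statement `exists_second_deriv_of_mixed`, where `deriv` serves as a
common choice of the local functions `Q`. -/
lemma RelOpen.exists_second_deriv (hD : RelOpen T D) {g R G p P : ℝ × ℝ × ℝ → ℝ}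
    (hg : HasDe D g R) (hR : HasDe D R G) (hp : HasDx D g p) (hG : HasDx D G P)
    (hGc : ContinuousOn G D) (hpc : ContinuousOn p D) (hPc : ContinuousOn P D) :
    ∃ Q, HasDe D p Q ∧ HasDe D Q P ∧ ContinuousOn Q D := by
  have key : ∀ q ∈ D, ∃ Q : ℝ → ℝ, ∀ᶠ e in 𝓝 q.2.2,
      HasDerivAt (fun e => p (q.1, q.2.1, e)) (Q e) e ∧
        HasDerivAt Q (P (q.1, q.2.1, e)) e := by
    intro q hq
    have hxe := (hD.tendsto_xe hq).eventually (hD.mem_nhds q hq)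
    refine exists_second_deriv_of_mixed (g := fun x e => g (x, q.2.1, e))
      (R := fun x e => R (x, q.2.1, e)) (G := fun x e => G (x, q.2.1, e))
      (P := fun x e => P (x, q.2.1, e)) ?_ ?_ ?_ ?_ ?_ ?_
    · filter_upwards [hxe] with a ha using hg _ ha
    · filter_upwards [hxe] with a ha using hR _ ha
    · filter_upwards [(hD.tendsto_e hq).eventually (hD.mem_nhds q hq)] with t ht using hp _ ht
    · filter_upwards [hxe] with a ha using hG _ ha
    · filter_upwards [hxe] with a ha
      exact (hD.continuousWithinAt_slab ha hGc).tendsto.comp (hD.tendsto_xe ha)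
    · filter_upwards [hxe] with a ha
      exact (hD.continuousWithinAt_slab ha hPc).tendsto.comp (hD.tendsto_xe ha)
  have h1 : HasDe D p (fun q => deriv (fun e => p (q.1, q.2.1, e)) q.2.2) := by
    intro q hq
    obtain ⟨Q, hQ⟩ := key q hq
    exact hQ.self_of_nhds.1.differentiableAt.hasDerivAt
  have h2 : HasDe D (fun q => deriv (fun e => p (q.1, q.2.1, e)) q.2.2) P := by
    intro q hq
    obtain ⟨Q, hQ⟩ := key q hq
    refine hQ.self_of_nhds.2.congr_of_eventuallyEq ?_
    filter_upwards [hQ] with e he using he.1.deriv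
  exact ⟨_, h1, h2, hD.continuousOn_of_second_deriv h1 h2 hpc hPc⟩

/-! ### Functions with continuous `ε`-derivatives -/

/-- `F` has `n` continuous `ε`-derivatives on `D`. -/
def EpsSmooth (D : Set (ℝ × ℝ × ℝ)) : ℕ → (ℝ × ℝ × ℝ → ℝ) → Prop
  | 0, F => ContinuousOn F D
  | n + 1, F => ContinuousOn F D ∧ ∃ F', HasDe D F F' ∧ EpsSmooth D n F'

namespace EpsSmooth

variable {n : ℕ} {F G : ℝ × ℝ × ℝ → ℝ}

lemma continuousOn (h : EpsSmooth D n F) : ContinuousOn F D := by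
  cases n with
  | zero => exact h
  | succ n => exact h.1

lemma of_succ (h : EpsSmooth D (n + 1) F) : EpsSmooth D n F := by
  induction n generalizing F with
  | zero => exact h.1
  | succ n ih =>
    obtain ⟨hc, F', hF', h'⟩ := h
    exact ⟨hc, F', hF', ih h'⟩

lemma mono {m : ℕ} (h : EpsSmooth D n F) (hmn : m ≤ n) : EpsSmooth D m F := by
  induction n, hmn using Nat.le_induction with
  | base => exact h
  | succ k hk ih => exact ih h.of_succ

lemma add (hF : EpsSmooth D n F) (hG : EpsSmooth D n G) :
    EpsSmooth D n (fun q => F q + G q) := by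
  induction n generalizing F G with
  | zero => exact ContinuousOn.add hF hG
  | succ n ih =>
    obtain ⟨hF, F', hFF', hF'⟩ := hF
    obtain ⟨hG, G', hGG', hG'⟩ := hG
    exact ⟨hF.add hG, _, fun q hq => (hFF' q hq).add (hGG' q hq), ih hF' hG'⟩

lemma mul (hF : EpsSmooth D n F) (hG : EpsSmooth D n G) :
    EpsSmooth D n (fun q => F q * G q) := by
  induction n generalizing F G with
  | zero => exact ContinuousOn.mul hF hG
  | succ n ih =>
    have hF0 := hF.of_succ
    have hG0 := hG.of_succ
    obtain ⟨hF, F', hFF', hF'⟩ := hF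
    obtain ⟨hG, G', hGG', hG'⟩ := hG
    exact ⟨hF.mul hG, _, fun q hq => (hFF' q hq).mul (hGG' q hq), (ih hF' hG0).add (ih hF0 hG')⟩

lemma const (n : ℕ) (c : ℝ) : EpsSmooth D n (fun _ => c) := by
  induction n generalizing c with
  | zero => exact continuousOn_const
  | succ n ih => exact ⟨continuousOn_const, _, fun q _ => hasDerivAt_const _ _, ih 0⟩

lemma sum {ι : Type*} (s : Finset ι) {F : ι → ℝ × ℝ × ℝ → ℝ} (h : ∀ i ∈ s, EpsSmooth D n (F i)) :
    EpsSmooth D n (fun q => ∑ i ∈ s, F i q) := by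
  classical
  induction s using Finset.induction_on with
  | empty => simpa using const n 0
  | insert a s ha ih =>
    simp only [Finset.sum_insert ha]
    exact (h a (by simp)).add (ih fun i hi => h i (by simp [hi]))

/-- The sequence of `ε`-derivatives. -/
lemma exists_seq (h : EpsSmooth D n F) : ∃ f : ℕ → ℝ × ℝ × ℝ → ℝ, f 0 = F ∧
    (∀ l < n, HasDe D (f l) (f (l + 1))) ∧ ∀ l ≤ n, ContinuousOn (f l) D := by
  induction n generalizing F with
  | zero => exact ⟨fun _ => F, rfl, by simp, fun l _ => h⟩
  | succ n ih =>
    obtain ⟨hc, F', hF', h'⟩ := h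
    obtain ⟨f, hf0, hf, hfc⟩ := ih h'
    refine ⟨fun l => Nat.casesOn l F f, rfl, ?_, ?_⟩
    · rintro (_ | l) hl
      · simpa [hf0] using hF'
      · exact hf l (by omega)
    · rintro (_ | l) hl
      · exact hc
      · exact hfc l (by omega)

end EpsSmooth

/-- The `x`-derivatives of a function with mixed derivatives of even order in `ε` have
continuous `ε`-derivatives of all orders. -/
lemma RelOpen.epsSmooth_of_even (hD : RelOpen T D) {L N : ℕ} {v : ℕ → ℕ → ℝ × ℝ × ℝ → ℝ}
    {R : ℕ → ℝ × ℝ × ℝ → ℝ} (h1 : ∀ k < N, HasDe D (v 0 k) (R k))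
    (h2 : ∀ k < N, HasDe D (R k) (v 0 (k + 1)))
    (hx : ∀ j < L, ∀ k ≤ N, HasDx D (v j k) (v (j + 1) k))
    (hc : ∀ j ≤ L, ∀ k ≤ N, ContinuousOn (v j k) D) {j : ℕ} (hj : j ≤ L) :
    EpsSmooth D (2 * N) (v j 0) := by
  -- The odd `ε`-derivatives of `v j k` are not among the data for `j > 0`; they are produced by
  -- induction on `j`.
  have step : ∀ j ≤ L, ∀ k < N, ∃ Q, HasDe D (v j k) Q ∧ HasDe D Q (v j (k + 1)) ∧
      ContinuousOn Q D := by
    intro j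
    induction j with
    | zero => exact fun hj k hk => ⟨R k, h1 k hk, h2 k hk,
        hD.continuousOn_of_second_deriv (h1 k hk) (h2 k hk) (hc 0 hj k hk.le) (hc 0 hj (k + 1) hk)⟩
    | succ j ih =>
      intro hj k hk
      obtain ⟨Q, hQ1, hQ2, -⟩ := ih (by omega) k hk
      exact hD.exists_second_deriv hQ1 hQ2 (hx j hj k hk.le) (hx j hj (k + 1) hk)
        (hc j (by omega) _ hk) (hc _ hj _ hk.le) (hc _ hj _ hk)
  -- `d` is the number of pairs of `ε`-derivatives still available beyond order `2 * k`.
  have main : ∀ d k, k + d = N → EpsSmooth D (2 * d) (v j k) := by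
    intro d
    induction d with
    | zero => exact fun k hk => hc j hj k (by omega)
    | succ d ih =>
      intro k hk
      obtain ⟨Q, hQ1, hQ2, hQ3⟩ := step j hj k (by omega)
      exact ⟨hc j hj k (by omega), Q, hQ1, hQ3, _, hQ2, ih (k + 1) (by omega)⟩
  exact main N 0 (by omega)

/-! ### Elements of the jet ring along a family of functions -/

open TopologicalSpace

variable {V : Opens ℝ}

/-- The element `f` of the jet ring, evaluated at the jet variables `w j`. -/
def evW (f : JetRing V) (w : ℕ → ℝ × ℝ × ℝ → ℝ) (q : ℝ × ℝ × ℝ) : ℝ :=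
  ev f (q.1, q.2.1, q.2.2, fun j => w j q)

variable {w : ℕ → ℝ × ℝ × ℝ → ℝ} {L : ℕ} {f : JetRing V}

lemma OrderLE.continuousOn_evW (hf : OrderLE L f) (hV : ∀ q ∈ D, w 0 q ∈ V)
    (hw : ∀ j ≤ L, ContinuousOn (w j) D) : ContinuousOn (evW f w) D := by
  obtain ⟨n, G, hG⟩ := f.2
  let w' : ℕ → ℝ × ℝ × ℝ → ℝ := fun j => if j ≤ L then w j else 0
  have hw' : ∀ j, ContinuousOn (w' j) D := by
    intro j
    by_cases hj : j ≤ L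
    · simpa [w', hj] using hw j hj
    · have : w' j = fun _ => 0 := by
        funext q
        simp [w', hj]
      rw [this]
      exact continuousOn_const
  have hV' : ∀ q ∈ D, (q.1, q.2.1, q.2.2, fun j => w' j q) ∈ jetDomain V := by
    intro q hq
    simpa [jetDomain, w'] using hV q hq
  have h1 : ContinuousOn (fun q : ℝ × ℝ × ℝ => jetProj n (q.1, q.2.1, q.2.2, fun j => w' j q)) D := by
    have : ContinuousOn (fun (q : ℝ × ℝ × ℝ) (i : Fin (n + 1)) => w' i q) D :=
      continuousOn_pi.2 fun i => hw' i
    exact continuousOn_fst.prodMk ((continuous_fst.comp continuous_snd).continuousOn.prodMk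
      ((continuous_snd.comp continuous_snd).continuousOn.prodMk this))
  refine (hG.smooth.continuousOn.comp h1 fun q hq => jetProj_mem.2 (hV' q hq)).congr ?_
  intro q hq
  rw [evW, hf.ev_eq (w' := fun j => w' j q) (fun j hj => by simp [w', hj]), ev_rep hG (hV' q hq)]
  rfl

/-- By the chain rule the `ε`-derivative is a sum of products of `ε`-derivatives of the `w k` with
elements of the jet ring that again have order at most `L`, so the induction on `n` closes. -/
lemma OrderLE.epsSmooth_evW {n : ℕ} (hf : OrderLE L f) (hV : ∀ q ∈ D, w 0 q ∈ V)
    (hw : ∀ j ≤ L, EpsSmooth D n (w j)) : EpsSmooth D n (evW f w) := by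
  induction n generalizing f with
  | zero => exact hf.continuousOn_evW hV hw
  | succ n ih =>
    have hw0 : ∀ j ≤ L, EpsSmooth D n (w j) := fun j hj => (hw j hj).of_succ
    have : ∀ j, ∃ w', j ≤ L → HasDe D (w j) w' ∧ EpsSmooth D n w' := by
      intro j
      by_cases hj : j ≤ L
      · obtain ⟨-, w', h1, h2⟩ := hw j hj
        exact ⟨w', fun _ => ⟨h1, h2⟩⟩
      · exact ⟨0, fun h => absurd h hj⟩
    choose w' hw' using this
    refine ⟨hf.continuousOn_evW hV fun j hj => (hw j hj).continuousOn,
      fun q => evW (dE f) w q + ∑ k ∈ Finset.range (L + 1), w' k q * evW (dJ k f) w q, ?_, ?_⟩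
    · intro q hq
      have := hf.hasDerivWithinAt (x := fun _ => q.1) (t := fun _ => q.2.1) (e := id)
        (w := fun e j => w j (q.1, q.2.1, e)) (w' := fun j => w' j q) (S := univ) (s := q.2.2)
        (hasDerivWithinAt_const _ _ _) (hasDerivWithinAt_const _ _ _) (hasDerivWithinAt_id _ _)
        (fun j hj => ((hw' j hj).1 q hq).hasDerivWithinAt) (hV q hq)
      rw [hasDerivWithinAt_univ] at this
      simpa [evW] using this
    · exact (ih (hf.pd _) hw0).add (EpsSmooth.sum _ fun k hk =>
        (hw' k (by simpa [Nat.lt_succ_iff] using hk)).2.mul (ih (hf.pd _) hw0))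

/-- The `x`-derivative of `f` along a family of functions with `∂ₓ w j = w (j + 1)`. -/
lemma OrderLE.hasDx_evW (hf : OrderLE L f) (hV : ∀ q ∈ D, w 0 q ∈ V)
    (hw : ∀ j ≤ L, HasDx D (w j) (w (j + 1))) : HasDx D (evW f w) (evW (StringEq.totalD f) w) := by
  intro q hq
  have := hf.hasDerivWithinAt (x := id) (t := fun _ => q.2.1) (e := fun _ => q.2.2)
    (w := fun y j => w j (y, q.2.1, q.2.2)) (w' := fun j => w (j + 1) q) (S := univ) (s := q.1)
    (hasDerivWithinAt_id _ _) (hasDerivWithinAt_const _ _ _) (hasDerivWithinAt_const _ _ _)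
    (fun j hj => (hw j hj q hq).hasDerivWithinAt) (hV q hq)
  rw [hasDerivWithinAt_univ] at this
  have hmem : (q.1, q.2.1, q.2.2, fun j => w j q) ∈ jetDomain V := hV q hq
  refine this.congr_deriv ?_
  rw [evW, totalD_apply (n := L + 1) hf, ev_add hmem, ev_sum hmem]
  simp [ev_mul hmem, ev_jetVar hmem]

/-- The `t`-derivative of `f` along a family of functions. -/
lemma OrderLE.hasDt_evW (hf : OrderLE L f) (hV : ∀ q ∈ D, w 0 q ∈ V) {B : JetRing V}
    (hw : ∀ j ≤ L, HasDt T D (w j) (evW (StringEq.totalD^[j] B) w)) :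
    HasDt T D (evW f w) (evW (dT f + frechet StringEq.totalD dJ f B) w) := by
  intro q hq
  have := hf.hasDerivWithinAt (x := fun _ => q.1) (t := id) (e := fun _ => q.2.2)
    (w := fun τ j => w j (q.1, τ, q.2.2)) (w' := fun j => evW (StringEq.totalD^[j] B) w q)
    (S := Icc 0 T) (s := q.2.1)
    (hasDerivWithinAt_const _ _ _) (hasDerivWithinAt_id _ _) (hasDerivWithinAt_const _ _ _)
    (fun j hj => hw j hj q hq) (hV q hq)
  have hmem : (q.1, q.2.1, q.2.2, fun j => w j q) ∈ jetDomain V := hV q hq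
  refine this.congr_deriv ?_
  rw [evW, ev_add hmem, frechet_eq (n := L + 1) hf, ev_sum hmem]
  simp [ev_mul hmem, evW, mul_comm]

end StringEq

namespace StringEq

open Filter Topology Set

/-! ### Sequences of successive derivatives near the origin -/

/-- Starting from the bound on `F m`, the mean value inequality on the ball of radius `|e|` gains
one factor `|e|` at each step down the chain. -/
lemma abs_le_pow_of_deriv_chain {F : ℕ → ℝ → ℝ} {m : ℕ} {r C : ℝ}
    (hF : ∀ l < m, ∀ e, |e| ≤ r → HasDerivAt (F l) (F (l + 1) e) e)
    (h0 : ∀ l < m, F l 0 = 0) (hm : ∀ e, |e| ≤ r → |F m e| ≤ C) (hC : 0 ≤ C) {e : ℝ}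
    (he : |e| ≤ r) : |F 0 e| ≤ C * |e| ^ m := by
  induction m generalizing F e with
  | zero => simpa using hm e he
  | succ m ih =>
    have h1 : ∀ e, |e| ≤ r → |F 1 e| ≤ C * |e| ^ m := fun e he =>
      ih (F := fun l => F (l + 1)) (fun l hl => hF (l + 1) (by omega))
        (fun l hl => h0 (l + 1) (by omega)) hm he
    have hb : ∀ x ∈ Metric.closedBall (0 : ℝ) |e|, |x| ≤ |e| := fun x hx => by simpa using hx
    have := (convex_closedBall (0 : ℝ) |e|).norm_image_sub_le_of_norm_hasDerivWithin_le
      (f := F 0) (f' := F 1) (C := C * |e| ^ m)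
      (fun x hx => (hF 0 (by omega) x ((hb x hx).trans he)).hasDerivWithinAt)
      (fun x hx => (h1 x ((hb x hx).trans he)).trans (by
        have := hb x hx
        gcongr)) (x := 0) (y := e) (by simp) (by simp)
    rw [h0 0 (by omega), sub_zero, sub_zero, Real.norm_eq_abs, Real.norm_eq_abs] at this
    rw [pow_succ, ← mul_assoc]
    exact this

/-- If `F 0 = O(e^(m + 1))`, then the derivatives of `F 0` of order at most `m` vanish. -/
lemma eq_zero_of_deriv_chain {F : ℕ → ℝ → ℝ} {m : ℕ} {r C : ℝ} (hr : 0 < r)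
    (hF : ∀ l < m, ∀ e, |e| < r → HasDerivAt (F l) (F (l + 1) e) e)
    (hm : ContinuousAt (F m) 0) (hC : ∀ e, |e| < r → |F 0 e| ≤ C * |e| ^ (m + 1)) :
    ∀ l ≤ m, F l 0 = 0 := by
  intro j
  induction j using Nat.strong_induction_on with
  | _ j ih =>
  intro hj
  by_contra hc
  set c := F j 0 with hcdef
  have hc' : 0 < |c| := abs_pos.2 hc
  have hcont : ContinuousAt (F j) 0 := by
    rcases hj.lt_or_eq with h | h
    · exact (hF j h 0 (by simpa using hr)).continuousAt
    · exact h ▸ hm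
  -- Half the modulus of the Taylor coefficient `c / j!`. For small `e > 0` it will turn out that
  -- `|F 0 e| < η * e ^ j` and `|F 0 e - c * e ^ j / j!| ≤ η * e ^ j`, which is incompatible with
  -- `|c * e ^ j / j!| = 2 * η * e ^ j`.
  set η : ℝ := |c| / (2 * (Nat.factorial j)) with hη
  have hfac : (0 : ℝ) < Nat.factorial j := by exact_mod_cast Nat.factorial_pos j
  have hηpos : 0 < η := by positivity
  obtain ⟨δ, hδ, hδc⟩ := Metric.continuousAt_iff.1 hcont η hηpos
  set C' : ℝ := |C| + 1 with hC'
  have hC'pos : 0 < C' := by positivity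
  obtain ⟨e, he0, her, heδ, he1, heC⟩ : ∃ e : ℝ, 0 < e ∧ e < r ∧ e < δ ∧ e < 1 ∧ C' * e < η := by
    refine ⟨min (min r δ) (min 1 (η / C')) / 2, by positivity, ?_, ?_, ?_, ?_⟩
    · have := min_le_left (min r δ) (min 1 (η / C'))
      have := min_le_left r δ
      linarith [lt_min hr hδ]
    · have := min_le_left (min r δ) (min 1 (η / C'))
      have := min_le_right r δ
      linarith [lt_min hr hδ]
    · have := min_le_right (min r δ) (min 1 (η / C'))
      have := min_le_left 1 (η / C')
      linarith
    · have h1 := min_le_right (min r δ) (min 1 (η / C'))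
      have h2 := min_le_right 1 (η / C')
      have h3 : C' * (η / C') = η := by field_simp
      calc C' * (min (min r δ) (min 1 (η / C')) / 2) ≤ C' * ((η / C') / 2) := by
            gcongr
            exact h1.trans h2
        _ = (C' * (η / C')) / 2 := by ring
        _ = η / 2 := by rw [h3]
        _ < η := by linarith
  -- The leading Taylor term and its derivatives are subtracted. The new chain vanishes at `0` below
  -- order `j`, and its `j`-th member `F j - c` is bounded by `η`.
  have hG := abs_le_pow_of_deriv_chain (m := j) (r := e) (C := η)
    (F := fun l x => F l x - c * x ^ (j - l) / (Nat.factorial (j - l)))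
    (fun l hl x hx => by
      obtain ⟨p, hp⟩ : ∃ p, j - l = p + 1 := ⟨j - l - 1, by omega⟩
      have hp' : j - (l + 1) = p := by omega
      have h1 := hF l (by omega) x (hx.trans_lt her)
      have h2 := ((hasDerivAt_pow (p + 1) x).const_mul c).div_const ((p + 1).factorial : ℝ)
      simp only [hp, hp']
      refine (h1.sub h2).congr_deriv ?_
      rw [Nat.factorial_succ]
      push_cast
      have : (0 : ℝ) < Nat.factorial p := by exact_mod_cast Nat.factorial_pos p
      field_simp)
    (fun l hl => by
      have : j - l ≠ 0 := by omega
      simp [ih l hl (by omega), this])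
    (fun x hx => by
      have := hδc (x := x) (by rw [Real.dist_eq, sub_zero]; exact hx.trans_lt heδ)
      rw [Real.dist_eq] at this
      simpa using this.le)
    hηpos.le (e := e) (by rw [abs_of_pos he0])
  simp only [Nat.sub_zero, abs_of_pos he0] at hG
  have h1 := hC e (by rwa [abs_of_pos he0])
  rw [abs_of_pos he0] at h1
  have hepow : e ^ (m + 1) ≤ e * e ^ j := by
    rw [← pow_succ']
    exact pow_le_pow_of_le_one he0.le he1.le (by omega)
  have h2 : C * e ^ (m + 1) ≤ C' * e * e ^ j := by
    calc C * e ^ (m + 1) ≤ C' * e ^ (m + 1) := by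
          gcongr
          linarith [le_abs_self C]
      _ ≤ C' * (e * e ^ j) := by gcongr
      _ = _ := by ring
  have hej : 0 < e ^ j := by positivity
  have h3 : C' * e * e ^ j < η * e ^ j := by gcongr
  have h4 : |c * e ^ j / (Nat.factorial j : ℝ)| = 2 * η * e ^ j := by
    rw [abs_div, abs_mul, abs_of_pos hej, abs_of_pos hfac, hη]
    field_simp
  have h5 := abs_sub_abs_le_abs_sub (c * e ^ j / (Nat.factorial j : ℝ)) (F 0 e)
  rw [abs_sub_comm] at h5
  linarith

/-! ### Transport equations -/

variable {T : ℝ} {D : Set (ℝ × ℝ × ℝ)}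

/-- The derivative along a line `x + α t = const`. -/
lemma RelOpen.hasDerivWithinAt_line (hD : RelOpen T D) {g gt gx : ℝ × ℝ × ℝ → ℝ}
    (ht : HasDt T D g gt) (hx : HasDx D g gx) (hc : ContinuousOn gx D) {q : ℝ × ℝ × ℝ} (hq : q ∈ D)
    (α : ℝ) : HasDerivWithinAt (fun τ => g (q.1 + α * (q.2.1 - τ), τ, q.2.2)) (gt q - α * gx q)
      (Icc 0 T) q.2.1 := by
  have h1 := ht q hq
  -- Joint differentiability is not available. The slanted line is compared with the vertical one;
  -- the difference is an increment in `x`, controlled by the continuity of `gx` at `q`.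
  have h2 : HasDerivWithinAt
      (fun τ => g (q.1 + α * (q.2.1 - τ), τ, q.2.2) - g (q.1, τ, q.2.2)) (- (α * gx q))
      (Icc 0 T) q.2.1 := by
    rw [hasDerivWithinAt_iff_isLittleO, Asymptotics.isLittleO_iff]
    intro c hc0
    set η : ℝ := c / (|α| + 1) with hη
    have hηpos : 0 < η := by positivity
    have hev := (hD.continuousWithinAt_slab hq hc).eventually
      (Metric.closedBall_mem_nhds (gx q) hηpos)
    obtain ⟨δ, hδ, H⟩ := Metric.mem_nhdsWithin_iff.1 (hev.and (hD.mem_nhds q hq))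
    set δ' : ℝ := δ / (|α| + 1) with hδ'
    have hδ'pos : 0 < δ' := by positivity
    have hδ'le : δ' ≤ δ := div_le_self hδ.le (by linarith [abs_nonneg α])
    refine eventually_nhdsWithin_iff.2 (Metric.eventually_nhds_iff.2 ⟨δ', hδ'pos, ?_⟩)
    intro τ hτ hτT
    rw [Real.dist_eq] at hτ
    have hαδ : |α| * |q.2.1 - τ| < δ := by
      rw [abs_sub_comm]
      calc |α| * |τ - q.2.1| ≤ (|α| + 1) * |τ - q.2.1| := by gcongr; linarith
        _ < (|α| + 1) * δ' := by gcongr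
        _ = δ := by rw [hδ']; field_simp
    have hball : ∀ y ∈ Metric.ball q.1 δ, |gx (y, τ, q.2.2) - gx q| ≤ η ∧ (y, τ, q.2.2) ∈ D := by
      intro y hy
      have : (y, τ, q.2.2) ∈ Metric.ball q δ ∩ slab T := by
        refine ⟨?_, hτT⟩
        simp only [Metric.mem_ball, Prod.dist_eq, dist_self] at hy ⊢
        simp [Real.dist_eq, hτ.trans_le hδ'le] at hy ⊢
        exact hy
      have := H this
      exact ⟨by simpa [Real.dist_eq] using this.1, this.2⟩
    have key := (convex_ball q.1 δ).norm_image_sub_le_of_norm_hasDerivWithin_le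
      (f := fun y => g (y, τ, q.2.2) - y * gx q) (f' := fun y => gx (y, τ, q.2.2) - gx q) (C := η)
      (fun y hy => (((hx _ (hball y hy).2).sub ((hasDerivAt_id y).mul_const (gx q))).congr_deriv
        (by simp)).hasDerivWithinAt) (fun y hy => (hball y hy).1) (x := q.1)
      (y := q.1 + α * (q.2.1 - τ)) (Metric.mem_ball_self hδ)
      (by simpa [Real.dist_eq, abs_mul] using hαδ)
    have e1 : q.1 + α * (q.2.1 - q.2.1) = q.1 := by ring
    rw [e1, sub_self, sub_zero, smul_eq_mul]
    calc _ = ‖g (q.1 + α * (q.2.1 - τ), τ, q.2.2) - (q.1 + α * (q.2.1 - τ)) * gx q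
            - (g (q.1, τ, q.2.2) - q.1 * gx q)‖ := by congr 1; ring
      _ ≤ η * ‖q.1 + α * (q.2.1 - τ) - q.1‖ := key
      _ = η * |α| * |τ - q.2.1| := by
        rw [add_sub_cancel_left, Real.norm_eq_abs, abs_mul, abs_sub_comm, mul_assoc]
      _ ≤ c * ‖τ - q.2.1‖ := by
        rw [Real.norm_eq_abs]
        gcongr
        calc η * |α| ≤ η * (|α| + 1) := by gcongr; linarith
          _ = c := by rw [hη]; field_simp
  have h3 := h1.add h2
  refine (h3.congr_of_eventuallyEq (Eventually.of_forall fun τ => ?_) ?_).congr_deriv (by ring)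
  · simp
  · simp

/-- The maximum principle, upper bound. -/
lemma transport_le {y A K θ ρ C : ℝ} {σ : ℝ × ℝ → ℝ} {a g : ℝ → ℝ → ℝ} (hK : 0 ≤ K) (hρ : 0 < ρ)
    (hθ : θ ≤ ρ * Real.exp (-(K + 1) * T))
    (hσ : ContinuousOn σ {p | p.2 ∈ Icc 0 T ∧ |p.1 - (y - A * p.2)| ≤ ρ * Real.exp (-(K + 1) * p.2)})
    (hline : ∀ x t, t ∈ Icc 0 T → |x - (y - A * t)| ≤ ρ * Real.exp (-(K + 1) * t) →
      HasDerivWithinAt (fun τ => σ (x + a x t * (t - τ), τ)) (g x t) (Icc 0 T) t)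
    (ha : ∀ x t, t ∈ Icc 0 T → |x - (y - A * t)| ≤ ρ * Real.exp (-(K + 1) * t) →
      |a x t - A| ≤ K * |x - (y - A * t)| + θ)
    (hg : ∀ x t, t ∈ Icc 0 T → |x - (y - A * t)| ≤ ρ * Real.exp (-(K + 1) * t) → g x t ≤ C)
    (h0 : ∀ x, |x - y| ≤ ρ → σ (x, 0) ≤ 0) {x t : ℝ} (ht : t ∈ Icc 0 T)
    (hx : |x - (y - A * t)| ≤ ρ * Real.exp (-(K + 1) * t)) : σ (x, t) ≤ C * t := by
  -- The width decays at the rate `K + 1`, where `K` accounts for the variation of `a` in `x` and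
  -- `1` for the error `θ`. This makes lines of slope `a`, followed backwards in time from a point
  -- of `Z`, stay in `Z`.
  set Z : Set (ℝ × ℝ) :=
    {p | p.2 ∈ Icc 0 T ∧ |p.1 - (y - A * p.2)| ≤ ρ * Real.exp (-(K + 1) * p.2)} with hZ
  have hZc : IsCompact Z := by
    have hcl : IsClosed Z := by
      have hZ' : Z = (Prod.snd ⁻¹' Icc 0 T) ∩
          {p : ℝ × ℝ | |p.1 - (y - A * p.2)| ≤ ρ * Real.exp (-(K + 1) * p.2)} := rfl
      rw [hZ']
      exact (isClosed_Icc.preimage continuous_snd).inter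
        (isClosed_le (by fun_prop) (by fun_prop))
    refine IsCompact.of_isClosed_subset
      ((isCompact_Icc (a := y - |A| * T - ρ) (b := y + |A| * T + ρ)).prod (isCompact_Icc (a := 0) (b := T)))
      hcl ?_
    rintro ⟨x, t⟩ ⟨ht, hx⟩
    refine ⟨?_, ht⟩
    simp only at ht hx
    have h1 : Real.exp (-(K + 1) * t) ≤ 1 := Real.exp_le_one_iff.2 (by nlinarith [ht.1])
    have h2 : |x - (y - A * t)| ≤ ρ := hx.trans (by nlinarith)
    have h3 : |A * t| ≤ |A| * T := by
      rw [abs_mul, abs_of_nonneg ht.1]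
      exact mul_le_mul_of_nonneg_left ht.2 (abs_nonneg _)
    constructor <;> linarith [abs_le.1 h2, abs_le.1 h3]
  by_contra! hlt
  -- The additional `η * t` makes the inequality at an interior maximum strict.
  obtain ⟨η, hη, hηlt⟩ : ∃ η > 0, (C + η) * t < σ (x, t) := by
    refine ⟨(σ (x, t) - C * t) / (2 * (t + 1)), ?_, ?_⟩
    · have := ht.1
      exact div_pos (by linarith) (by linarith)
    · have h1 : 0 < t + 1 := by linarith [ht.1]
      have h2 : (σ (x, t) - C * t) / (2 * (t + 1)) * t ≤ (σ (x, t) - C * t) / 2 := by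
        rw [div_mul_eq_mul_div, div_le_div_iff₀ (by positivity) (by norm_num)]
        nlinarith
      linarith
  obtain ⟨⟨x₀, t₀⟩, hp, hmax⟩ := hZc.exists_isMaxOn ⟨(x, t), ht, hx⟩
    (f := fun p => σ p - (C + η) * p.2) (hσ.sub (by fun_prop))
  have hmax' : ∀ p ∈ Z, σ p - (C + η) * p.2 ≤ σ (x₀, t₀) - (C + η) * t₀ := fun p hp => hmax hp
  have hpos := hmax' (x, t) ⟨ht, hx⟩
  obtain ⟨ht₀, hx₀⟩ := hp
  simp only at ht₀ hx₀ hpos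
  have ht₀pos : 0 < t₀ := by
    rcases ht₀.1.lt_or_eq with h | h
    · exact h
    · exfalso
      rw [← h] at hpos hx₀
      have := h0 x₀ (by simpa using hx₀)
      linarith
  have hd := ((hline x₀ t₀ ht₀ hx₀).sub
    ((hasDerivAt_id t₀).const_mul (C + η)).hasDerivWithinAt).mono
      (show Ico 0 t₀ ⊆ Icc 0 T from fun s hs => ⟨hs.1, hs.2.le.trans ht₀.2⟩)
  rw [hasDerivWithinAt_iff_tendsto_slope' (by simp)] at hd
  have : (𝓝[Ico 0 t₀] t₀).NeBot := right_nhdsWithin_Ico_neBot ht₀pos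
  -- Backwards along its line the function does not exceed its maximal value at `(x₀, t₀)`, so its
  -- left derivative there, `g x₀ t₀ - (C + η)`, is nonnegative. This contradicts `g ≤ C`.
  have hge := ge_of_tendsto hd (b := 0) (by
    filter_upwards [self_mem_nhdsWithin] with τ hτ
    have hmem : (x₀ + a x₀ t₀ * (t₀ - τ), τ) ∈ Z := by
      refine ⟨⟨hτ.1, hτ.2.le.trans ht₀.2⟩, ?_⟩
      simp only
      have hs : 0 < t₀ - τ := by linarith [hτ.2]
      have hθt : θ ≤ ρ * Real.exp (-(K + 1) * t₀) := by
        refine hθ.trans (mul_le_mul_of_nonneg_left (Real.exp_le_exp.2 ?_) hρ.le)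
        nlinarith [ht₀.2]
      have hE : (0 : ℝ) < Real.exp (-(K + 1) * t₀) := Real.exp_pos _
      calc |x₀ + a x₀ t₀ * (t₀ - τ) - (y - A * τ)|
          = |(x₀ - (y - A * t₀)) + (a x₀ t₀ - A) * (t₀ - τ)| := by congr 1; ring
        _ ≤ |x₀ - (y - A * t₀)| + |a x₀ t₀ - A| * (t₀ - τ) := by
          refine (abs_add_le _ _).trans ?_
          rw [abs_mul, abs_of_pos hs]
        _ ≤ ρ * Real.exp (-(K + 1) * t₀)
            + (K * (ρ * Real.exp (-(K + 1) * t₀)) + ρ * Real.exp (-(K + 1) * t₀)) * (t₀ - τ) := by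
          have h1 := ha x₀ t₀ ht₀ hx₀
          have h2 : K * |x₀ - (y - A * t₀)| ≤ K * (ρ * Real.exp (-(K + 1) * t₀)) := by gcongr
          gcongr
          linarith
        _ = ρ * Real.exp (-(K + 1) * t₀) * ((K + 1) * (t₀ - τ) + 1) := by ring
        _ ≤ ρ * Real.exp (-(K + 1) * t₀) * Real.exp ((K + 1) * (t₀ - τ)) := by
          gcongr
          exact Real.add_one_le_exp _
        _ = ρ * Real.exp (-(K + 1) * τ) := by
          rw [mul_assoc, ← Real.exp_add]
          congr 2
          ring
    have h1 := hmax' _ hmem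
    simp only at h1
    rw [slope_def_field]
    refine div_nonneg_of_nonpos ?_ (by linarith [hτ.2])
    simp only [Pi.sub_apply, id, sub_self, mul_zero, add_zero]
    linarith)
  have := hg x₀ t₀ ht₀ hx₀
  linarith

/-- The maximum principle. -/
lemma abs_transport_le {y A K θ ρ C : ℝ} {σ : ℝ × ℝ → ℝ} {a g : ℝ → ℝ → ℝ} (hK : 0 ≤ K)
    (hρ : 0 < ρ) (hθ : θ ≤ ρ * Real.exp (-(K + 1) * T))
    (hσ : ContinuousOn σ {p | p.2 ∈ Icc 0 T ∧ |p.1 - (y - A * p.2)| ≤ ρ * Real.exp (-(K + 1) * p.2)})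
    (hline : ∀ x t, t ∈ Icc 0 T → |x - (y - A * t)| ≤ ρ * Real.exp (-(K + 1) * t) →
      HasDerivWithinAt (fun τ => σ (x + a x t * (t - τ), τ)) (g x t) (Icc 0 T) t)
    (ha : ∀ x t, t ∈ Icc 0 T → |x - (y - A * t)| ≤ ρ * Real.exp (-(K + 1) * t) →
      |a x t - A| ≤ K * |x - (y - A * t)| + θ)
    (hg : ∀ x t, t ∈ Icc 0 T → |x - (y - A * t)| ≤ ρ * Real.exp (-(K + 1) * t) → |g x t| ≤ C)
    (h0 : ∀ x, |x - y| ≤ ρ → σ (x, 0) = 0) {x t : ℝ} (ht : t ∈ Icc 0 T)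
    (hx : |x - (y - A * t)| ≤ ρ * Real.exp (-(K + 1) * t)) : |σ (x, t)| ≤ C * t := by
  refine abs_le'.2 ⟨?_, ?_⟩
  · exact transport_le hK hρ hθ hσ hline ha (fun x t ht hx => (abs_le.1 (hg x t ht hx)).2)
      (fun x hx => (h0 x hx).le) ht hx
  · exact transport_le (σ := fun p => - σ p) (g := fun x t => - g x t) hK hρ hθ hσ.neg
      (fun x t ht hx => (hline x t ht hx).neg) ha
      (fun x t ht hx => by linarith [(abs_le.1 (hg x t ht hx)).1])
      (fun x hx => by simp [h0 x hx]) ht hx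

end StringEq

namespace StringEq

open Filter Topology Set

variable {T : ℝ} {D : Set (ℝ × ℝ × ℝ)}

/-! ### Order of vanishing in `ε` of solutions of perturbed transport equations -/

/-- A tube around the line `x = y - A t`, `0 ≤ t ≤ T`, `ε = 0`. -/
def tube (T y A ρ : ℝ) : Set (ℝ × ℝ × ℝ) :=
  {q | q.2.1 ∈ Icc 0 T ∧ |q.1 - (y - A * q.2.1)| ≤ ρ ∧ |q.2.2| ≤ ρ}

variable {y A ρ : ℝ}

lemma tube_mono {ρ' : ℝ} (h : ρ ≤ ρ') : tube T y A ρ ⊆ tube T y A ρ' :=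
  fun _ hq => ⟨hq.1, hq.2.1.trans h, hq.2.2.trans h⟩

lemma isCompact_tube : IsCompact (tube T y A ρ) := by
  have h : tube T y A ρ = ((fun q : ℝ × ℝ × ℝ => q.2.1) ⁻¹' Icc 0 T) ∩
      ({q : ℝ × ℝ × ℝ | |q.1 - (y - A * q.2.1)| ≤ ρ} ∩ {q : ℝ × ℝ × ℝ | |q.2.2| ≤ ρ}) := rfl
  have hcl : IsClosed (tube T y A ρ) := by
    rw [h]
    exact (isClosed_Icc.preimage (by fun_prop)).inter
      ((isClosed_le (by fun_prop) (by fun_prop)).inter (isClosed_le (by fun_prop) (by fun_prop)))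
  refine IsCompact.of_isClosed_subset
    ((isCompact_Icc (a := y - |A| * T - ρ) (b := y + |A| * T + ρ)).prod
      ((isCompact_Icc (a := 0) (b := T)).prod (isCompact_Icc (a := -ρ) (b := ρ)))) hcl ?_
  rintro ⟨x, t, e⟩ ⟨ht, hx, he⟩
  refine ⟨?_, ht, abs_le.1 he⟩
  simp only at ht hx
  have h3 : |A * t| ≤ |A| * T := by
    rw [abs_mul, abs_of_nonneg ht.1]
    exact mul_le_mul_of_nonneg_left ht.2 (abs_nonneg _)
  constructor <;> linarith [abs_le.1 hx, abs_le.1 h3]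

lemma exists_bound_tube (hsub : tube T y A ρ ⊆ D) {F : ℝ × ℝ × ℝ → ℝ} (hF : ContinuousOn F D) :
    ∃ C, 0 ≤ C ∧ ∀ q ∈ tube T y A ρ, |F q| ≤ C := by
  obtain ⟨C, hC⟩ := isCompact_tube.exists_bound_of_continuousOn (hF.mono hsub)
  exact ⟨max C 0, le_max_right _ _, fun q hq => (hC q hq).trans (le_max_left _ _)⟩

lemma exists_bound_tube_range (hsub : tube T y A ρ ⊆ D) {F : ℕ → ℝ × ℝ × ℝ → ℝ} {n : ℕ}
    (hF : ∀ i ≤ n, ContinuousOn (F i) D) :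
    ∃ C, 0 ≤ C ∧ ∀ i ≤ n, ∀ q ∈ tube T y A ρ, |F i q| ≤ C := by
  have : ∀ i, ∃ C, 0 ≤ C ∧ (i ≤ n → ∀ q ∈ tube T y A ρ, |F i q| ≤ C) := by
    intro i
    by_cases hi : i ≤ n
    · obtain ⟨C, hC, h⟩ := exists_bound_tube hsub (hF i hi)
      exact ⟨C, hC, fun _ => h⟩
    · exact ⟨0, le_rfl, fun h => absurd h hi⟩
  choose C hC h using this
  refine ⟨∑ i ∈ Finset.range (n + 1), C i, Finset.sum_nonneg fun i _ => hC i, fun i hi q hq => ?_⟩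
  exact (h i hi q hq).trans (Finset.single_le_sum (f := C) (fun j _ => hC j)
    (by simpa [Nat.lt_succ_iff] using hi))

/-- An estimate `s 0 = O(ε^m)` extends to the `x`-derivatives, on a smaller tube. -/
lemma RelOpen.exists_bound_derivs (hD : RelOpen T D) (hρ : 0 < ρ) (hsub : tube T y A ρ ⊆ D)
    {s : ℕ → ℝ × ℝ × ℝ → ℝ} {n m : ℕ} (hs : ∀ i ≤ n, EpsSmooth D m (s i))
    (hsx : ∀ i < n, HasDx D (s i) (s (i + 1))) {C : ℝ}
    (hC : ∀ q ∈ tube T y A ρ, |s 0 q| ≤ C * |q.2.2| ^ m) :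
    ∃ C', 0 ≤ C' ∧ ∀ i ≤ n, ∀ q ∈ tube T y A (ρ / 2), |s i q| ≤ C' * |q.2.2| ^ m := by
  have : ∀ i, ∃ f : ℕ → ℝ × ℝ × ℝ → ℝ, i ≤ n → (f 0 = s i ∧
      (∀ l < m, HasDe D (f l) (f (l + 1))) ∧ ∀ l ≤ m, ContinuousOn (f l) D) := by
    intro i
    by_cases hi : i ≤ n
    · obtain ⟨f, hf⟩ := (hs i hi).exists_seq
      exact ⟨f, fun _ => hf⟩
    · exact ⟨0, fun h => absurd h hi⟩
  choose f hf using this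
  have hfx : ∀ i < n, ∀ l ≤ m, HasDx D (f i l) (f (i + 1) l) := by
    intro i hi l
    induction l with
    | zero =>
      intro _
      rw [(hf i hi.le).1, (hf (i + 1) hi).1]
      exact hsx i hi
    | succ l ih =>
      intro hl
      exact hD.hasDx_of_mixed (ih (by omega)) ((hf i hi.le).2.1 l hl) ((hf (i + 1) hi).2.1 l hl)
        ((hf (i + 1) hi).2.2 _ hl)
  -- The estimate on `s 0` forces its `ε`-derivatives of order below `m` to vanish at `ε = 0`. They
  -- vanish on an open set of `x`, hence so do their `x`-derivatives, which by `hfx` are the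
  -- `ε`-derivatives of the `s i`.
  have hzero : ∀ i ≤ n, ∀ l < m, ∀ x t, t ∈ Icc 0 T → |x - (y - A * t)| < ρ → f i l (x, t, 0) = 0 := by
    intro i
    induction i with
    | zero =>
      intro hi l hl x t ht hx
      have hin : ∀ e, |e| < ρ → (x, t, e) ∈ D := fun e he => hsub ⟨ht, hx.le, he.le⟩
      obtain ⟨p, rfl⟩ : ∃ p, m = p + 1 := ⟨m - 1, by omega⟩
      refine eq_zero_of_deriv_chain (F := fun l e => f 0 l (x, t, e)) (m := p) (C := C) hρ
        (fun l hl e he => (hf 0 hi).2.1 l (by omega) _ (hin e he)) ?_ ?_ l (by omega)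
      · exact ((hf 0 hi).2.1 p (by omega) _ (hin 0 (by simpa using hρ))).continuousAt
      · intro e he
        simp only [(hf 0 hi).1]
        exact hC (x, t, e) ⟨ht, hx.le, he.le⟩
    | succ i ih =>
      intro hi l hl x t ht hx
      have h1 := hfx i hi l hl.le (x, t, 0) (hsub ⟨ht, hx.le, by simpa using hρ.le⟩)
      have h2 : (fun z => f i l (z, t, 0)) =ᶠ[𝓝 x] fun _ => 0 := by
        have hc : Continuous fun z : ℝ => |z - (y - A * t)| := by fun_prop
        filter_upwards [hc.continuousAt.eventually_lt_const hx] with z hz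
        exact ih (by omega) l hl z t ht hz
      exact h1.unique ((hasDerivAt_const x (0 : ℝ)).congr_of_eventuallyEq h2)
  obtain ⟨C', hC', hb⟩ := exists_bound_tube_range (F := fun i => f i m) hsub
    (fun i hi => (hf i hi).2.2 m le_rfl)
  refine ⟨C', hC', fun i hi q hq => ?_⟩
  -- Halving the radius provides the strict inequality that `hzero` requires.
  have hx : |q.1 - (y - A * q.2.1)| < ρ := hq.2.1.trans_lt (by linarith)
  have hin : ∀ e, |e| ≤ ρ / 2 → (q.1, q.2.1, e) ∈ tube T y A ρ := fun e he =>
    ⟨hq.1, hx.le, he.trans (by linarith)⟩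
  have := abs_le_pow_of_deriv_chain (F := fun l e => f i l (q.1, q.2.1, e)) (m := m) (r := ρ / 2)
    (C := C') (fun l hl e he => (hf i hi).2.1 l hl _ (hsub (hin e he)))
    (fun l hl => hzero i hi l hl _ _ hq.1 hx) (fun e he => hb i hi _ (hin e he)) hC' hq.2.2
  simpa only [(hf i hi).1] using this

/-- A solution of a transport equation perturbed by terms of order `ε²`, with vanishing initial
data and a forcing of order `ε^(2N+2)`, is of order `ε^(2N+2)`. -/
theorem RelOpen.exists_bound_transport (hD : RelOpen T D) (hT : 0 < T) (hρ : 0 < ρ)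
    (hsub : tube T y A ρ ⊆ D) {s : ℕ → ℝ × ℝ × ℝ → ℝ} {n N : ℕ}
    (hs : ∀ i ≤ n, EpsSmooth D (2 * N) (s i)) (hsx : ∀ i < n, HasDx D (s i) (s (i + 1)))
    {a ax : ℝ × ℝ × ℝ → ℝ} (hac : ContinuousOn a D) (hax : HasDx D a ax)
    (haxc : ContinuousOn ax D) (haA : ∀ t ∈ Icc 0 T, a (y - A * t, t, 0) = A)
    {b : ℕ → ℝ × ℝ × ℝ → ℝ} {r : ℝ × ℝ × ℝ → ℝ} (hb : ∀ i ≤ n, ContinuousOn (b i) D)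
    (hr : ContinuousOn r D)
    (hline : ∀ q ∈ D, HasDerivWithinAt (fun τ => s 0 (q.1 + a q * (q.2.1 - τ), τ, q.2.2))
      (q.2.2 ^ 2 * ∑ i ∈ Finset.range (n + 1), b i q * s i q + q.2.2 ^ (2 * N + 2) * r q)
      (Icc 0 T) q.2.1)
    (h0 : ∀ x ε, |x - y| ≤ ρ → s 0 (x, 0, ε) = 0) :
    ∃ ρ' > 0, ∃ C, ∀ q ∈ tube T y A ρ', |s 0 q| ≤ C * |q.2.2| ^ (2 * N + 2) := by
  obtain ⟨K, hK, hKb⟩ := exists_bound_tube hsub haxc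
  obtain ⟨B, hB, hBb⟩ := exists_bound_tube_range hsub hb
  obtain ⟨R, hR, hRb⟩ := exists_bound_tube hsub hr
  -- the coefficient `a` is close to `A` on the tube
  have haLip : ∀ x t ε, t ∈ Icc 0 T → |x - (y - A * t)| ≤ ρ → |ε| ≤ ρ →
      |a (x, t, ε) - a (y - A * t, t, ε)| ≤ K * |x - (y - A * t)| := by
    intro x t ε ht hx hε
    have hin : ∀ z ∈ Metric.closedBall (y - A * t) ρ, (z, t, ε) ∈ tube T y A ρ := fun z hz =>
      ⟨ht, by rwa [Metric.mem_closedBall, Real.dist_eq] at hz, hε⟩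
    exact (convex_closedBall (y - A * t) ρ).norm_image_sub_le_of_norm_hasDerivWithin_le
      (f := fun z => a (z, t, ε)) (f' := fun z => ax (z, t, ε)) (C := K)
      (fun z hz => (hax _ (hsub (hin z hz))).hasDerivWithinAt) (fun z hz => hKb _ (hin z hz))
      (Metric.mem_closedBall_self hρ.le) (by rwa [Metric.mem_closedBall, Real.dist_eq])
  have haeps : ∀ η > 0, ∃ δ > 0, ∀ t ∈ Icc 0 T, ∀ ε, |ε| ≤ δ → |ε| ≤ ρ →
      |a (y - A * t, t, ε) - A| ≤ η := by
    intro η hη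
    have huc := isCompact_tube.uniformContinuousOn_of_continuous (hac.mono hsub)
    obtain ⟨δ, hδ, H⟩ := Metric.uniformContinuousOn_iff.1 huc η hη
    refine ⟨δ / 2, by positivity, fun t ht ε hε hερ => ?_⟩
    have := H (y - A * t, t, ε) ⟨ht, by simpa using hρ.le, hερ⟩ (y - A * t, t, 0)
      ⟨ht, by simpa using hρ.le, by simpa using hρ.le⟩ (by
        have : |ε| < δ := by linarith
        simpa [Prod.dist_eq, hδ] using this)
    rw [haA t ht, Real.dist_eq] at this
    exact this.le
  -- Each round gains a factor `ε²`. The round from `k` to `k + 1` uses only `2 * k ≤ 2 * N`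
  -- derivatives in `ε`, so the final exponent `2 * N + 2` may exceed the available smoothness. The
  -- condition `ρ' ≤ 1` allows powers of `|ε|` to be compared.
  have main : ∀ k ≤ N + 1, ∃ ρ' > 0, ρ' ≤ ρ ∧ ρ' ≤ 1 ∧ ∃ C, ∀ q ∈ tube T y A ρ',
      |s 0 q| ≤ C * |q.2.2| ^ (2 * k) := by
    intro k
    induction k with
    | zero =>
      intro _
      obtain ⟨C, -, hC⟩ := exists_bound_tube hsub (hs 0 (Nat.zero_le _)).continuousOn
      exact ⟨min ρ 1, by positivity, min_le_left _ _, min_le_right _ _, C, fun q hq => by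
        simpa using hC q (tube_mono (min_le_left _ _) hq)⟩
    | succ k ih =>
      intro hk
      obtain ⟨ρ₁, hρ₁, hρ₁ρ, hρ₁1, C, hC⟩ := ih (by omega)
      obtain ⟨C', hC', hb'⟩ := hD.exists_bound_derivs hρ₁ ((tube_mono hρ₁ρ).trans hsub)
        (fun i hi => (hs i hi).mono (m := 2 * k) (by omega)) hsx hC
      set ρ₂ := ρ₁ / 2 with hρ₂
      have hρ₂pos : 0 < ρ₂ := by positivity
      have hρ₂ρ : ρ₂ ≤ ρ := by linarith
      set E := Real.exp (-(K + 1) * T) with hE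
      have hEpos : 0 < E := Real.exp_pos _
      have hE1 : E ≤ 1 := Real.exp_le_one_iff.2 (by nlinarith)
      -- The tolerance `ρ₂ * E` is the half-width of the shrinking region at time `T`, the largest
      -- `θ` admitted by `abs_transport_le`. A tube of this radius also lies in the region at all
      -- times.
      obtain ⟨δ, hδ, hδa⟩ := haeps (ρ₂ * E) (by positivity)
      set M := (n + 1) * (B * C') + R with hM
      have hMpos : 0 ≤ M := by positivity
      refine ⟨min (ρ₂ * E) δ, by positivity, ?_, ?_, M * T, ?_⟩
      · exact (min_le_left _ _).trans (by nlinarith)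
      · exact (min_le_left _ _).trans (by nlinarith)
      rintro ⟨x, t, ε⟩ ⟨ht, hx, hε⟩
      simp only at ht hx hε ⊢
      have hεδ : |ε| ≤ δ := hε.trans (min_le_right _ _)
      have hερ₂ : |ε| ≤ ρ₂ := (hε.trans (min_le_left _ _)).trans (by nlinarith)
      have hexp : ∀ t ∈ Icc 0 T, Real.exp (-(K + 1) * t) ≤ 1 := fun t ht =>
        Real.exp_le_one_iff.2 (by nlinarith [ht.1])
      have hin : ∀ x t, t ∈ Icc 0 T → |x - (y - A * t)| ≤ ρ₂ * Real.exp (-(K + 1) * t) →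
          (x, t, ε) ∈ tube T y A ρ₂ := by
        intro x t ht hx
        refine ⟨ht, hx.trans ?_, hερ₂⟩
        simpa using mul_le_mul_of_nonneg_left (hexp t ht) hρ₂pos.le
      have htD : tube T y A ρ₂ ⊆ D := (tube_mono hρ₂ρ).trans hsub
      have key := abs_transport_le (x := x) (T := T) (y := y) (A := A) (K := K) (θ := ρ₂ * E) (ρ := ρ₂)
        (C := M * |ε| ^ (2 * (k + 1))) (σ := fun p => s 0 (p.1, p.2, ε))
        (a := fun x t => a (x, t, ε))
        (g := fun x t => ε ^ 2 * ∑ i ∈ Finset.range (n + 1), b i (x, t, ε) * s i (x, t, ε)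
          + ε ^ (2 * N + 2) * r (x, t, ε)) hK hρ₂pos le_rfl
        ((hs 0 (Nat.zero_le _)).continuousOn.comp (by fun_prop)
          fun p hp => htD (hin p.1 p.2 hp.1 hp.2))
        (fun x t ht hx => hline _ (htD (hin x t ht hx))) ?_ ?_ ?_ ht ?_
      · refine key.trans ?_
        calc M * |ε| ^ (2 * (k + 1)) * t ≤ M * |ε| ^ (2 * (k + 1)) * T := by
              gcongr
              exact ht.2
          _ = _ := by ring
      · intro x t ht hx
        have hq := tube_mono hρ₂ρ (hin x t ht hx)
        have h1 := haLip x t ε ht hq.2.1 hq.2.2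
        have h2 := hδa t ht ε hεδ hq.2.2
        calc |a (x, t, ε) - A| ≤ |a (x, t, ε) - a (y - A * t, t, ε)| + |a (y - A * t, t, ε) - A| :=
              abs_sub_le _ _ _
          _ ≤ _ := add_le_add h1 h2
      · intro x t ht hx
        have hq := hin x t ht hx
        have hqρ := tube_mono hρ₂ρ hq
        have h1 : |∑ i ∈ Finset.range (n + 1), b i (x, t, ε) * s i (x, t, ε)|
            ≤ (n + 1) * (B * C') * |ε| ^ (2 * k) := by
          refine (Finset.abs_sum_le_sum_abs _ _).trans ?_
          calc ∑ i ∈ Finset.range (n + 1), |b i (x, t, ε) * s i (x, t, ε)|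
              ≤ ∑ i ∈ Finset.range (n + 1), B * C' * |ε| ^ (2 * k) := by
                refine Finset.sum_le_sum fun i hi => ?_
                have hi' : i ≤ n := by simpa [Nat.lt_succ_iff] using hi
                rw [abs_mul, mul_assoc]
                exact mul_le_mul (hBb i hi' _ hqρ) (hb' i hi' _ hq) (abs_nonneg _) hB
            _ = _ := by
                rw [Finset.sum_const, Finset.card_range, nsmul_eq_mul]
                push_cast
                ring
        have hε1 : |ε| ≤ 1 := hερ₂.trans (by linarith)
        have h2 : |ε| ^ (2 * N + 2) ≤ |ε| ^ (2 * (k + 1)) :=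
          pow_le_pow_of_le_one (abs_nonneg _) hε1 (by omega)
        calc _ ≤ |ε| ^ 2 * |∑ i ∈ Finset.range (n + 1), b i (x, t, ε) * s i (x, t, ε)|
              + |ε| ^ (2 * N + 2) * |r (x, t, ε)| := by
              refine (abs_add_le _ _).trans ?_
              rw [abs_mul, abs_mul, abs_pow, abs_pow]
          _ ≤ |ε| ^ 2 * ((n + 1) * (B * C') * |ε| ^ (2 * k)) + |ε| ^ (2 * (k + 1)) * R := by
              gcongr
              exact hRb _ hqρ
          _ = _ := by
              rw [hM]
              ring
      · intro x hx
        exact h0 x ε (hx.trans hρ₂ρ)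
      · refine hx.trans ((min_le_left _ _).trans ?_)
        refine mul_le_mul_of_nonneg_left (Real.exp_le_exp.2 ?_) hρ₂pos.le
        nlinarith [ht.2]
  obtain ⟨ρ', hρ', -, -, C, hC⟩ := main (N + 1) le_rfl
  exact ⟨ρ', hρ', C, hC⟩

/-- A function with `n` continuous `ε`-derivatives, and its iterated derivatives at `ε = 0`. -/
lemma EpsSmooth.contDiffAt {n : ℕ} {F : ℝ × ℝ × ℝ → ℝ} (hF : EpsSmooth D n F)
    {x t : ℝ} {C ρ : ℝ} (hρ : 0 < ρ) (hsub : ∀ e, |e| < ρ → (x, t, e) ∈ D)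
    (hC : ∀ e, |e| < ρ → |F (x, t, e)| ≤ C * |e| ^ (n + 1)) :
    ContDiffAt ℝ (n : ℕ∞) (fun e => F (x, t, e)) 0 ∧
      ∀ l ≤ n, iteratedDeriv l (fun e => F (x, t, e)) 0 = 0 := by
  obtain ⟨f, rfl, hf, hfc⟩ := hF.exists_seq
  have hU : IsOpen (Metric.ball (0 : ℝ) ρ) := Metric.isOpen_ball
  have h0 : (0 : ℝ) ∈ Metric.ball (0 : ℝ) ρ := Metric.mem_ball_self hρ
  have hin : ∀ e ∈ Metric.ball (0 : ℝ) ρ, (x, t, e) ∈ D := fun e he => hsub e (by simpa using he)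
  have hcont : ∀ l ≤ n, ContinuousOn (fun e => f l (x, t, e)) (Metric.ball 0 ρ) := fun l hl =>
    (hfc l hl).comp (by fun_prop) hin
  have hiter : ∀ l ≤ n, ∀ e ∈ Metric.ball (0 : ℝ) ρ,
      iteratedDeriv l (fun e => f 0 (x, t, e)) e = f l (x, t, e) := by
    intro l
    induction l with
    | zero => simp
    | succ l ih =>
      intro hl e he
      rw [iteratedDeriv_succ]
      refine ((hf l hl _ (hin e he)).congr_of_eventuallyEq ?_).deriv
      filter_upwards [hU.mem_nhds he] with z hz using ih (by omega) z hz
  have hcd : ∀ m l, m + l = n → ContDiffOn ℝ (m : ℕ∞) (fun e => f l (x, t, e)) (Metric.ball 0 ρ) := by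
    intro m
    induction m with
    | zero => exact fun l hl => contDiffOn_zero.2 (hcont l (by omega))
    | succ m ih =>
      intro l hl
      have := (contDiffOn_succ_iff_deriv_of_isOpen (𝕜 := ℝ) (n := ((m : ℕ∞) : WithTop ℕ∞))
        (f := fun e => f l (x, t, e)) hU).2 ⟨?_, by simp, ?_⟩
      · exact_mod_cast this
      · exact fun e he => (hf l (by omega) _ (hin e he)).differentiableAt.differentiableWithinAt
      · exact (ih (l + 1) (by omega)).congr fun e he => (hf l (by omega) _ (hin e he)).deriv
  refine ⟨(hcd n 0 (by omega)).contDiffAt (hU.mem_nhds h0), fun l hl => ?_⟩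
  rw [hiter l hl 0 h0]
  exact eq_zero_of_deriv_chain (F := fun l e => f l (x, t, e)) hρ
    (fun l hl e he => hf l hl _ (hsub e he)) ((hcont n le_rfl).continuousAt (hU.mem_nhds h0)) hC l hl

end StringEq

namespace StringEq

open TopologicalSpace

variable {V : Opens ℝ}

/-! ### The variational derivative of the Hamiltonian -/

/-- A smooth function of `u`. -/
def ofU (g : ℝ → ℝ) (hg : ContDiffOn ℝ ∞ g (V : Set ℝ)) : JetRing V :=
  ofFinFun (n := 0) (fun p => g (p.2.2.2 0)) (hg.comp (ContDiff.contDiffOn (by fun_prop))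
    fun _ hp => hp)

lemma ev_ofU {g : ℝ → ℝ} (hg : ContDiffOn ℝ ∞ g (V : Set ℝ)) {q : JetSpace}
    (hq : q ∈ jetDomain V) : ev (ofU g hg) q = g (q.2.2.2 0) := by
  rw [ev_of_mem _ hq]
  rfl

lemma contDiffOn_deriv {g : ℝ → ℝ} (hg : ContDiffOn ℝ ∞ g (V : Set ℝ)) :
    ContDiffOn ℝ ∞ (deriv g) (V : Set ℝ) :=
  hg.deriv_of_isOpen V.isOpen (by simp)

lemma contDiffOn_iteratedDeriv {g : ℝ → ℝ} (hg : ContDiffOn ℝ ∞ g (V : Set ℝ)) (k : ℕ) :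
    ContDiffOn ℝ ∞ (iteratedDeriv k g) (V : Set ℝ) := by
  induction k with
  | zero => simpa using hg
  | succ k ih =>
    rw [iteratedDeriv_succ]
    exact contDiffOn_deriv ih

lemma dJ_zero_ofU {g : ℝ → ℝ} (hg : ContDiffOn ℝ ∞ g (V : Set ℝ)) :
    dJ 0 (ofU g hg) = ofU (deriv g) (contDiffOn_deriv hg) := by
  apply JetRing.ext_ev
  intro q hq
  rw [dJ, ev_pd _ hq, ev_ofU _ hq]
  have hd : HasDerivAt g (deriv g (q.2.2.2 0)) (q.2.2.2 0 + 0) := by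
    rw [add_zero]
    exact ((hg.contDiffAt (V.isOpen.mem_nhds hq)).differentiableAt (by simp)).hasDerivAt
  have h1 : HasDerivAt (fun τ : ℝ => g (q.2.2.2 0 + τ)) (deriv g (q.2.2.2 0)) 0 :=
    hd.comp_const_add (q.2.2.2 0) 0
  refine (h1.congr_of_eventuallyEq ?_).deriv
  filter_upwards [eventually_line_mem hq (jetDir 0)] with τ hτ
  rw [ev_ofU hg hτ]
  simp [jetDir]

lemma orderLE_ofU {g : ℝ → ℝ} (hg : ContDiffOn ℝ ∞ g (V : Set ℝ)) : OrderLE 0 (ofU g hg) :=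
  fun _ hk => SmoothRep.dJ_eq_zero (ofFinFun_rep _ _) hk

lemma dX_ofU {g : ℝ → ℝ} (hg : ContDiffOn ℝ ∞ g (V : Set ℝ)) : dX (ofU g hg) = 0 := by
  apply JetRing.ext_ev
  intro q hq
  rw [dX, ev_pd _ hq, ev_zero]
  have h1 : HasDerivAt (fun τ : ℝ => g (q.2.2.2 0)) 0 0 := hasDerivAt_const _ _
  refine (h1.congr_of_eventuallyEq ?_).deriv
  filter_upwards [eventually_line_mem hq (1, 0, 0, 0)] with τ hτ
  rw [ev_ofU hg hτ]
  simp

lemma totalD_ofU {g : ℝ → ℝ} (hg : ContDiffOn ℝ ∞ g (V : Set ℝ)) :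
    totalD (ofU g hg) = jetVar V 1 * ofU (deriv g) (contDiffOn_deriv hg) := by
  rw [totalD_apply (n := 1) (orderLE_ofU hg), dX_ofU]
  simp [dJ_zero_ofU]

lemma eulerR_ofU {g : ℝ → ℝ} (hg : ContDiffOn ℝ ∞ g (V : Set ℝ)) :
    eulerR (ofU g hg) = ofU (deriv g) (contDiffOn_deriv hg) := by
  rw [eulerR, eulerOp_eq (n := 1) (orderLE_ofU hg)]
  simp [dJ_zero_ofU]

lemma dJ_epsVar_pow_mul (k j : ℕ) (f : JetRing V) :
    dJ k (epsVar V ^ j * f) = epsVar V ^ j * dJ k f := by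
  have : dJ k (epsVar V) = 0 := by
    rw [dJ, pd_epsVar]
    simp [jetDir]
  rw [Derivation.leibniz, Derivation.leibniz_pow, this]
  simp

lemma totalD_epsVar_pow_mul (j : ℕ) (f : JetRing V) :
    totalD (epsVar V ^ j * f) = epsVar V ^ j * totalD f := by
  have h0 : ∀ k, dJ k (epsVar V) = 0 := fun k => by
    rw [dJ, pd_epsVar]
    simp [jetDir]
  have : totalD (epsVar V) = 0 := by
    rw [totalD_apply (n := 0) fun k _ => h0 k, dX, pd_epsVar]
    simp
  rw [Derivation.leibniz, Derivation.leibniz_pow, this]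
  simp

lemma eulerR_epsVar_pow_mul (j : ℕ) (f : JetRing V) :
    eulerR (epsVar V ^ j * f) = epsVar V ^ j * eulerR f := by
  obtain ⟨n, h⟩ := exists_dJ_eq_zero f
  have hneg : ∀ k (g : JetRing V), negPow totalD k (epsVar V ^ j * g)
      = epsVar V ^ j * negPow totalD k g := by
    intro k g
    induction k with
    | zero => simp
    | succ k ih => rw [negPow_succ, negPow_succ, ih, totalD_epsVar_pow_mul, mul_neg]
  rw [eulerR, eulerR, eulerOp_eq h, eulerOp_eq (n := n)
    (fun k hk => by rw [dJ_epsVar_pow_mul, h k hk, mul_zero]), Finset.mul_sum]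
  simp only [dJ_epsVar_pow_mul, hneg]

/-- Multiplication by a power of `ε` is injective. -/
lemma eq_zero_of_epsVar_pow_mul {j : ℕ} {f : JetRing V} (h : epsVar V ^ j * f = 0) : f = 0 := by
  have h1 : ∀ q ∈ jetDomain V, q.2.2.1 ≠ 0 → ev f q = 0 := by
    intro q hq hε
    have : ev (epsVar V ^ j * f) q = 0 := by rw [h, ev_zero]
    rw [ev_mul hq, ev_pow hq, ev_epsVar hq] at this
    exact (mul_eq_zero.1 this).resolve_left (pow_ne_zero _ hε)
  apply JetRing.ext_ev
  intro q hq
  rw [ev_zero]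
  by_cases hε : q.2.2.1 = 0
  swap
  · exact h1 q hq hε
  -- Where `ε = 0`, the value is the limit of the values with `ε ≠ 0`.
  have hc := (hasDerivAt_line f hq (0, 0, 1, 0)).continuousAt.tendsto
  simp only [zero_smul, add_zero] at hc
  refine tendsto_nhds_unique (hc.mono_left (nhdsWithin_le_nhds (s := {0}ᶜ)))
    (tendsto_const_nhds.congr' ?_)
  have hmem := (eventually_line_mem hq (0, 0, 1, 0)).filter_mono (nhdsWithin_le_nhds (s := {0}ᶜ))
  filter_upwards [hmem, self_mem_nhdsWithin] with τ hτ hτ0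
  refine (h1 _ hτ ?_).symm
  simpa [hε] using hτ0

/-- `∂/∂x` commutes with `D` and with all `∂/∂u^(k)`. This settles the degenerate case of
`exists_orders`: if `E` contains no jet variable at all, then `D E = 0`. -/
lemma dX_eulerR {f : JetRing V} (h : dX f = 0) : dX (eulerR f) = 0 := by
  obtain ⟨n, hn⟩ := exists_dJ_eq_zero f
  have hneg : ∀ k (g : JetRing V), dX (negPow totalD k g) = negPow totalD k (dX g) := by
    intro k g
    induction k with
    | zero => simp
    | succ k ih =>
      rw [negPow_succ, negPow_succ, map_neg, ← ih, dX, pd_totalD_of_eq_zero (fun k => by simp)]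
  rw [eulerR, eulerOp_eq hn, map_sum]
  refine Finset.sum_eq_zero fun k _ => ?_
  rw [hneg, dX, dJ, pd_comm, ← dX, h, map_zero, map_zero]

lemma Represents.dX_eq_zero {f : JetRing V} {F : DiffFun} (h : Represents f F)
    (hF : ∀ x x' t ε w, F x t ε w = F x' t ε w) : dX f = 0 := by
  apply JetRing.ext_ev
  intro q hq
  rw [dX, ev_pd _ hq, ev_zero]
  have h1 : HasDerivAt (fun τ : ℝ => ev f q) 0 0 := hasDerivAt_const _ _
  refine (h1.congr_of_eventuallyEq ?_).deriv
  filter_upwards [eventually_line_mem hq (1, 0, 0, 0)] with τ hτ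
  rw [← h _ hτ, ← h _ hq, hF _ q.1]
  simp

/-- The Hamiltonian density is `h(u) + O(ε²)`. -/
lemma exists_represents_hamDensity {c p s h : ℝ → ℝ} (hh : ContDiffOn ℝ ∞ h (V : Set ℝ))
    (hc : ContDiffOn ℝ ∞ c (V : Set ℝ)) (hp : ContDiffOn ℝ ∞ p (V : Set ℝ))
    (hs : ContDiffOn ℝ ∞ s (V : Set ℝ)) (M : ℕ) {H : ℕ → (ℕ → ℝ) → ℝ}
    (hH : ∀ k, IsDiffFun (V : Set ℝ) (fun _ _ _ w => H k w)) :
    ∃ Q : JetRing V, Represents (ofU h hh + epsVar V ^ 2 * Q) (hamDensity c p s h M H) := by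
  choose Hr hHr using fun k => (hH k).exists_represents
  have h3 := fun k => contDiffOn_iteratedDeriv hh k
  have hC : ContDiffOn ℝ ∞ (coeffC h c) (V : Set ℝ) := hc.mul (h3 3)
  have hP : ContDiffOn ℝ ∞ (coeffP h c p) (V : Set ℝ) :=
    (hp.mul (h3 3)).add ((contDiffOn_const.mul (hc.pow 2)).mul (h3 4))
  have hS : ContDiffOn ℝ ∞ (coeffS h c p s) (V : Set ℝ) :=
    (((((hs.mul (h3 3)).sub (((hc.mul (contDiffOn_iteratedDeriv hc 2)).div_const _).mul (h3 4))).sub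
      (((hc.mul (contDiffOn_deriv hc)).div_const _).mul (h3 5))).sub
      (((hc.pow 2).div_const _).mul (h3 6))).sub
      (((contDiffOn_deriv hp).div_const _).mul (h3 4))).sub ((hp.div_const _).mul (h3 5))
  -- The natural subtraction in `2 * k - 2` is harmless, as `3 ≤ k` in the sum.
  refine ⟨-(algebraMap ℝ (JetRing V) (1 / 2) * ofU _ hC * jetVar V 1 ^ 2)
    + epsVar V ^ 2 * (ofU _ hP * jetVar V 2 ^ 2 + ofU _ hS * jetVar V 1 ^ 4)
    + ∑ k ∈ Finset.Icc 3 M, epsVar V ^ (2 * k - 2) * Hr k, ?_⟩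
  intro q hq
  simp only [ev_add hq, ev_mul hq, ev_pow hq, ev_neg hq, ev_ofU _ hq, ev_jetVar hq, ev_epsVar hq,
    ev_sum hq, ev_algebraMap hq, hamDensity, dOperator, mul_add, Finset.mul_sum]
  have hsum : ∀ k ∈ Finset.Icc 3 M, q.2.2.1 ^ 2 * (q.2.2.1 ^ (2 * k - 2) * ev (Hr k) q)
      = q.2.2.1 ^ (2 * k) * H k q.2.2.2 := by
    intro k hk
    rw [← hHr k q hq, ← mul_assoc, ← pow_add]
    congr 2
    have := (Finset.mem_Icc.1 hk).1
    omega
  rw [Finset.sum_congr rfl hsum]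
  ring

/-! ### Orders in the linearized equation -/

lemma exists_max_order {f : JetRing V} (h : ∃ k, dJ k f ≠ 0) :
    ∃ m, dJ m f ≠ 0 ∧ OrderLE m f := by
  classical
  obtain ⟨n, hn⟩ := exists_dJ_eq_zero f
  obtain ⟨k, hk⟩ := h
  have hkn : k ≤ n := by
    by_contra! hlt
    exact hk (hn k hlt.le)
  refine ⟨Nat.findGreatest (fun k => dJ k f ≠ 0) n, Nat.findGreatest_spec (P := fun k => dJ k f ≠ 0) hkn hk, fun j hj => ?_⟩
  rcases le_or_gt j n with hjn | hjn
  · by_contra hne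
    exact Nat.findGreatest_is_greatest hj hjn hne
  · exact hn j hjn.le

/-- Each `totalD` raises the order by one and keeps the top coefficient `dJ m f`, so no cancellation
can lower the order. -/
lemma orderLE_top_le {f : JetRing V} {m i L : ℕ} (hf : OrderLE m f) (hm : dJ m f ≠ 0)
    (h : OrderLE L (totalD^[i] f)) : m + i ≤ L := by
  by_contra! hlt
  have := h (m + i) hlt
  rw [(isJetAlgebra.d_iterate_D hf i).1] at this
  exact hm this

/-- The orders of the variational derivatives of the functional and of the Hamiltonian. -/
lemma exists_orders {𝓗 S r : DiffFun} {L : ℕ} (hL : LinearEqDependsOnJet (V : Set ℝ) L 𝓗 S r)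
    {A E : JetRing V} (hA : Represents A (euler S)) (hE : Represents E (euler 𝓗))
    (hA0 : ∃ k, dJ k A ≠ 0) (hEx : dX E = 0) :
    ∃ m n, OrderLE m A ∧ m + n ≤ L ∧ OrderLE n (totalD E) ∧ (∀ i, n ≤ i → dJ i E = 0) ∧
      (n = 0 → totalD E = 0) := by
  obtain ⟨m, hm, hmA⟩ := exists_max_order hA0
  by_cases hE0 : ∃ k, dJ k E ≠ 0
  · obtain ⟨n, hn, hnE⟩ := exists_max_order hE0
    -- The second witness is the order of `E` plus one. The bound by `L` comes from `totalD^[n + 1]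
    -- A`, which occurs in the linear equation because its coefficient `∂E/∂u^(n)` is not
    -- identically zero.
    refine ⟨m, n + 1, hmA, ?_, hnE.totalD, fun i hi => hnE i hi, by simp⟩
    have hne : ∃ x t ε w, w 0 ∈ (V : Set ℝ) ∧ jetPartial n (euler 𝓗) x t ε w ≠ 0 := by
      by_contra! hcon
      refine hn (JetRing.ext_ev fun q hq => ?_)
      rw [← hE.jetPartial n q hq, ev_zero]
      exact hcon _ _ _ _ hq
    exact orderLE_top_le hmA hm ((hA.totalDeriv_iterate (n + 1)).orderLE (hL.2.2 n hne).2)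
  · push Not at hE0
    have h0 : totalD E = 0 := by
      rw [totalD_apply (n := 0) fun k _ => hE0 k, hEx]
      simp
    refine ⟨m, 0, hmA, orderLE_top_le hmA hm (i := 0) (hA.orderLE hL.1), ?_, fun i _ => hE0 i,
      fun _ => h0⟩
    rw [h0]
    exact fun k _ => map_zero _

end StringEq

namespace StringEq

open Filter Topology Set TopologicalSpace

/-! ### The interval of monotonicity and the domain of the solution -/

/-- The endpoints of a small interval around `y` have values on both sides of `φ y`, and all values
in between are attained. -/
lemma isOpen_image_of_monotone {I : Set ℝ} {φ : ℝ → ℝ} (hI : IsOpen I) (hφc : ContinuousOn φ I)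
    (hφ : StrictMonoOn φ I ∨ StrictAntiOn φ I) : IsOpen (φ '' I) := by
  rw [isOpen_iff_mem_nhds]
  rintro _ ⟨y, hy, rfl⟩
  obtain ⟨δ, hδ, hsub⟩ := Metric.isOpen_iff.1 hI y hy
  have hin : Icc (y - δ / 2) (y + δ / 2) ⊆ I := fun z hz => hsub (by
    rw [Metric.mem_ball, Real.dist_eq, abs_lt]
    constructor <;> linarith [hz.1, hz.2])
  have ha : y - δ / 2 ∈ I := hin ⟨le_rfl, by linarith⟩
  have hb : y + δ / 2 ∈ I := hin ⟨by linarith, le_rfl⟩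
  rcases hφ with h | h
  · refine mem_of_superset (Icc_mem_nhds (h ha hy (by linarith)) (h hy hb (by linarith))) ?_
    exact (intermediate_value_Icc (by linarith) (hφc.mono hin)).trans (image_mono hin)
  · refine mem_of_superset (Icc_mem_nhds (h hy hb (by linarith)) (h ha hy (by linarith))) ?_
    exact (intermediate_value_Icc' (by linarith) (hφc.mono hin)).trans (image_mono hin)

section Domain

variable {I : Set ℝ} {φ : ℝ → ℝ} {T : ℝ} {u : ℝ → ℝ → ℝ → ℝ}

lemma domainComp_subset : domainComp I φ T u ⊆ domain (φ '' I) T u :=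
  iUnion₂_subset fun _ _ => connectedComponentIn_subset _ _

/-- A connected set meeting one component of the union lies in that component; the components for
different `y` need not be compared. -/
lemma subset_domainComp {C : Set (ℝ × ℝ × ℝ)} (hC : IsPreconnected C)
    (hsub : C ⊆ domain (φ '' I) T u) {q : ℝ × ℝ × ℝ} (hq : q ∈ C) (hq' : q ∈ domainComp I φ T u) :
    C ⊆ domainComp I φ T u := by
  obtain ⟨y, hy, hqy⟩ := mem_iUnion₂.1 hq'
  refine subset_iUnion₂_of_subset y hy ?_
  rw [connectedComponentIn_eq hqy]
  exact hC.subset_connectedComponentIn hq hsub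

lemma initial_mem_domainComp (hT : 0 ≤ T) (hu_init : ∀ x ε, u x 0 ε = φ x) {y : ℝ} (hy : y ∈ I)
    (ε : ℝ) : (y, 0, ε) ∈ domainComp I φ T u := by
  have hsub : (fun e : ℝ => ((y, 0, e) : ℝ × ℝ × ℝ)) '' univ ⊆ domain (φ '' I) T u := by
    rintro _ ⟨e, -, rfl⟩
    refine ⟨⟨le_rfl, hT⟩, ?_⟩
    simp only [hu_init]
    exact mem_image_of_mem _ hy
  have hpre : IsPreconnected ((fun e : ℝ => ((y, 0, e) : ℝ × ℝ × ℝ)) '' univ) :=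
    isPreconnected_univ.image _ (by fun_prop)
  have h0 : ((y, 0, 0) : ℝ × ℝ × ℝ) ∈ domainComp I φ T u :=
    mem_iUnion₂.2 ⟨y, hy, mem_connectedComponentIn (hsub ⟨0, mem_univ _, rfl⟩)⟩
  exact subset_domainComp hpre hsub ⟨0, mem_univ _, rfl⟩ h0 ⟨ε, mem_univ _, rfl⟩

/-- By continuity a small ball, cut with the slab, is mapped into the open set `φ '' I`. It is
convex, hence connected, and so does not leave the component. -/
lemma relOpen_domainComp (hV : IsOpen (φ '' I))
    (hu : ∀ q ∈ domainComp I φ T u,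
      ContinuousWithinAt (fun q : ℝ × ℝ × ℝ => u q.1 q.2.1 q.2.2) {q | q.2.1 ∈ Icc 0 T} q) :
    RelOpen T (domainComp I φ T u) := by
  refine ⟨fun q hq => (domainComp_subset hq).1, fun q hq => ?_⟩
  have hev := (hu q hq).eventually (hV.mem_nhds (domainComp_subset hq).2)
  obtain ⟨δ, hδ, H⟩ := Metric.mem_nhdsWithin_iff.1 hev
  have hslab : Convex ℝ (slab T) :=
    (convex_Icc 0 T).is_linear_preimage (f := fun q : ℝ × ℝ × ℝ => q.2.1)
      ⟨fun _ _ => rfl, fun _ _ => rfl⟩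
  have hpre : IsPreconnected (Metric.ball q δ ∩ slab T) :=
    ((convex_ball q δ).inter hslab).isPreconnected
  have hsub : Metric.ball q δ ∩ slab T ⊆ domain (φ '' I) T u := fun p hp => ⟨hp.2, H hp⟩
  have := subset_domainComp hpre hsub ⟨Metric.mem_ball_self hδ, (domainComp_subset hq).1⟩ hq
  exact Metric.mem_nhdsWithin_iff.2 ⟨δ, hδ, this⟩

end Domain

/-- The times up to which `f` vanishes form a set that is closed by continuity and can be prolonged
to the right by `hloc`. -/
lemma eq_zero_of_local_continuation {f : ℝ → ℝ} {T : ℝ} (hf : ContinuousOn f (Icc 0 T))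
    (h0 : f 0 = 0) (hloc : ∀ s ∈ Ico 0 T, (∀ s' ∈ Icc 0 s, f s' = 0) →
      ∃ δ > 0, ∀ s' ∈ Icc s (s + δ), s' ∈ Icc 0 T → f s' = 0) : ∀ s ∈ Icc 0 T, f s = 0 := by
  set P : Set ℝ := {s | ∀ s' ∈ Icc 0 s, f s' = 0} with hP
  have hcl : IsClosed (P ∩ Icc 0 T) := by
    refine isClosed_of_closure_subset fun s hs => ?_
    have hsT : s ∈ Icc 0 T := by
      have := closure_mono inter_subset_right hs
      rwa [isClosed_Icc.closure_eq] at this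
    refine ⟨fun s' hs' => ?_, hsT⟩
    rcases hs'.2.lt_or_eq with hlt | rfl
    · obtain ⟨p, hp, hps⟩ := mem_closure_iff_nhds.1 hs (Ioi s') (Ioi_mem_nhds hlt)
      exact hps.1 s' ⟨hs'.1, hp.le⟩
    · have hne : (𝓝[P ∩ Icc 0 T] s').NeBot := mem_closure_iff_nhdsWithin_neBot.1 hs
      have h1 : Tendsto f (𝓝[P ∩ Icc 0 T] s') (𝓝 (f s')) :=
        ((hf s' hsT).mono inter_subset_right).tendsto
      refine tendsto_nhds_unique h1 (tendsto_const_nhds.congr' ?_)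
      filter_upwards [self_mem_nhdsWithin] with p hp
      exact (hp.1 p ⟨hp.2.1, le_rfl⟩).symm
  have hmem : (0 : ℝ) ∈ P := fun s' hs' => by
    rw [show s' = 0 from le_antisymm hs'.2 hs'.1, h0]
  have := hcl.Icc_subset_of_forall_exists_gt hmem (by
    rintro s ⟨hsP, hs⟩ z hz
    obtain ⟨δ, hδ, H⟩ := hloc s hs hsP
    refine ⟨min z (min (s + δ) T), fun s' hs' => ?_, ?_, min_le_left _ _⟩
    · have h2 := hs'.2.trans ((min_le_right _ _).trans (min_le_left _ _))
      have h3 := hs'.2.trans ((min_le_right _ _).trans (min_le_right _ _))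
      rcases le_total s' s with h | h
      · exact hsP s' ⟨hs'.1, h⟩
      · exact H s' ⟨h, h2⟩ ⟨hs'.1, h3⟩
    · exact lt_min hz (lt_min (by linarith) hs.2))
  exact fun s hs => this hs s ⟨hs.1, le_rfl⟩

/-- A compact piece of a line in a relatively open set has a tube in that set. -/
lemma RelOpen.exists_tube {T : ℝ} {D : Set (ℝ × ℝ × ℝ)} (hD : RelOpen T D) {y A : ℝ}
    (hline : ∀ t ∈ Icc 0 T, (y - A * t, t, 0) ∈ D) : ∃ ρ > 0, tube T y A ρ ⊆ D := by
  have hK : IsCompact ((fun t : ℝ => ((y - A * t, t, 0) : ℝ × ℝ × ℝ)) '' Icc 0 T) :=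
    isCompact_Icc.image (by fun_prop)
  have hsub : (fun t : ℝ => ((y - A * t, t, 0) : ℝ × ℝ × ℝ)) '' Icc 0 T
      ⊆ interior (D ∪ (slab T)ᶜ) := by
    rintro _ ⟨t, ht, rfl⟩
    rw [mem_interior_iff_mem_nhds, union_comm]
    have := mem_nhdsWithin_iff_eventually.1 (hD.mem_nhds _ (hline t ht))
    filter_upwards [this] with q hq
    by_cases h : q ∈ slab T
    · exact Or.inr (hq h)
    · exact Or.inl h
  obtain ⟨δ, hδ, H⟩ := hK.exists_cthickening_subset_open isOpen_interior hsub
  refine ⟨δ, hδ, fun q hq => ?_⟩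
  have hq' : q ∈ Metric.cthickening δ
      ((fun t : ℝ => ((y - A * t, t, 0) : ℝ × ℝ × ℝ)) '' Icc 0 T) := by
    refine Metric.mem_cthickening_of_dist_le q (y - A * q.2.1, q.2.1, 0) δ _
      ⟨q.2.1, hq.1, rfl⟩ ?_
    simp only [Prod.dist_eq, dist_self, Real.dist_eq, sub_zero]
    exact max_le hq.2.1 (max_le hδ.le hq.2.2)
  exact (interior_subset (H hq')).resolve_right fun h => h hq.1

end StringEq

namespace StringEq

open Filter Topology Set TopologicalSpace

variable {T : ℝ} {D : Set (ℝ × ℝ × ℝ)} {V : Opens ℝ}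

/-! ### Jets of the solution -/

/-- The derivative `∂ₓ^j u`. -/
def solJet (u : ℝ → ℝ → ℝ → ℝ) (j : ℕ) (q : ℝ × ℝ × ℝ) : ℝ :=
  iteratedDeriv j (fun y => u y q.2.1 q.2.2) q.1

lemma solJet_zero (u : ℝ → ℝ → ℝ → ℝ) (q : ℝ × ℝ × ℝ) : solJet u 0 q = u q.1 q.2.1 q.2.2 := by
  simp [solJet]

lemma Represents.along_eq {f : JetRing V} {F : DiffFun} (h : Represents f F)
    {u : ℝ → ℝ → ℝ → ℝ} {x t ε : ℝ} (hV : u x t ε ∈ V) :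
    along F u x t ε = evW f (solJet u) (x, t, ε) :=
  h.apply (by simpa [jet] using hV)

lemma HasMixedDerivs.hasDx {u : ℝ → ℝ → ℝ → ℝ} {L N : ℕ} (h : HasMixedDerivs u L N D) {j : ℕ}
    (hj : j < L) : HasDx D (solJet u j) (solJet u (j + 1)) := by
  intro q hq
  have := (h.diff_x q.1 q.2.1 q.2.2 hq j hj 0 (Nat.zero_le _)).hasDerivAt
  simpa [mixedDeriv, solJet, iteratedDeriv_succ] using this

lemma HasMixedDerivs.epsSmooth {u : ℝ → ℝ → ℝ → ℝ} {L N : ℕ} (hD : RelOpen T D)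
    (h : HasMixedDerivs u L N D) {j : ℕ} (hj : j ≤ L) : EpsSmooth D (2 * N) (solJet u j) := by
  have key := hD.epsSmooth_of_even (L := L) (N := N)
    (v := fun j k q => mixedDeriv u j (2 * k) q.1 q.2.1 q.2.2)
    (R := fun k q => iteratedDeriv (2 * k + 1) (fun e => u q.1 q.2.1 e) q.2.2)
    (fun k hk q hq => by
      have := (h.diff_eps q.1 q.2.1 q.2.2 hq (2 * k) (by omega)).hasDerivAt
      simpa [mixedDeriv, iteratedDeriv_succ] using this)
    (fun k hk q hq => by
      have := (h.diff_eps q.1 q.2.1 q.2.2 hq (2 * k + 1) (by omega)).hasDerivAt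
      have e : 2 * (k + 1) = 2 * k + 1 + 1 := by ring
      simp only [mixedDeriv, iteratedDeriv_zero, e]
      rw [iteratedDeriv_succ (n := 2 * k + 1)]
      exact this)
    (fun j hj k hk q hq => by
      have := (h.diff_x q.1 q.2.1 q.2.2 hq j hj k hk).hasDerivAt
      simpa only [mixedDeriv, iteratedDeriv_succ] using this)
    (fun j hj k hk => h.continuous j hj k hk) hj
  have e : (fun q : ℝ × ℝ × ℝ => mixedDeriv u j (2 * 0) q.1 q.2.1 q.2.2) = solJet u j := by
    funext q
    simp [mixedDeriv, solJet]
  rwa [e] at key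

lemma EpsSmooth.congr {n : ℕ} {F G : ℝ × ℝ × ℝ → ℝ} (hD : RelOpen T D) (hF : EpsSmooth D n F)
    (h : ∀ q ∈ D, G q = F q) : EpsSmooth D n G := by
  cases n with
  | zero => exact ContinuousOn.congr hF h
  | succ n =>
    obtain ⟨hc, F', hF', h'⟩ := hF
    refine ⟨hc.congr h, F', fun q hq => (hF' q hq).congr_of_eventuallyEq ?_, h'⟩
    filter_upwards [(hD.tendsto_e hq).eventually (hD.mem_nhds q hq)] with e he using h _ he

/-- The `t`-derivatives of the jet of a solution of `u_t = B`. -/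
lemma RelOpen.hasDt_jets (hD : RelOpen T D) {w : ℕ → ℝ × ℝ × ℝ → ℝ} {B : JetRing V} {m n L : ℕ}
    (hB : OrderLE n B) (hmn : m + n ≤ L) (hV : ∀ q ∈ D, w 0 q ∈ V)
    (hwc : ∀ j ≤ L, ContinuousOn (w j) D) (hwx : ∀ j < L, HasDx D (w j) (w (j + 1)))
    (h0 : HasDt T D (w 0) (evW B w)) {j : ℕ} (hj : j ≤ m) :
    HasDt T D (w j) (evW (totalD^[j] B) w) := by
  induction j with
  | zero => exact h0
  | succ j ih =>
    -- The order of `totalD^[j + 1] B` is at most `n + j + 1 ≤ n + m ≤ L`, so only available jets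
    -- occur.
    have hBj := hB.totalD_iterate j
    refine hD.hasDt_of_mixed (ih (by omega)) (hwx j (by omega)) ?_
      ((hB.totalD_iterate (j + 1)).continuousOn_evW hV fun k hk => hwc k (by omega))
    rw [Function.iterate_succ_apply']
    exact hBj.hasDx_evW hV fun k hk => hwx k (by omega)

/-- Along the characteristic lines of the unperturbed equation the solution with `ε = 0` is
constant. -/
lemma eq_initial_along_characteristic {I : Set ℝ} {φ g : ℝ → ℝ} {u : ℝ → ℝ → ℝ → ℝ} (hT : 0 < T)
    (hVI : (V : Set ℝ) = φ '' I) (hD : RelOpen T (domainComp I φ T u))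
    (hu_init : ∀ x ε, u x 0 ε = φ x)
    (hu_cont : ContinuousOn (fun q : ℝ × ℝ => u q.1 q.2 0) {q | q.2 ∈ Icc 0 T})
    (hu : ContinuousOn (solJet u 0) (domainComp I φ T u))
    (hg : DifferentiableOn ℝ g (V : Set ℝ))
    {Bw : ℝ × ℝ × ℝ → ℝ} (hdt : HasDt T (domainComp I φ T u) (solJet u 0) Bw)
    (hB : ∀ q ∈ domainComp I φ T u, q.2.2 = 0 → Bw q = g (solJet u 0 q) * solJet u 1 q)
    (hcase : (∀ v ∈ V, g v = 0) ∨ (HasDx (domainComp I φ T u) (solJet u 0) (solJet u 1) ∧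
      ContinuousOn (solJet u 1) (domainComp I φ T u))) {y : ℝ} (hy : y ∈ I) :
    ∀ t ∈ Icc 0 T, u (y - g (φ y) * t) t 0 = φ y ∧
      (y - g (φ y) * t, t, 0) ∈ domainComp I φ T u := by
  set A := g (φ y) with hA
  set D := domainComp I φ T u with hDdef
  have hφy : φ y ∈ (V : Set ℝ) := hVI ▸ mem_image_of_mem _ hy
  have hDV : ∀ q ∈ D, solJet u 0 q ∈ (V : Set ℝ) := fun q hq => by
    rw [solJet_zero, hVI]
    exact (domainComp_subset hq).2
  -- derivative along the line
  have hline : ∀ q ∈ D, q.2.2 = 0 → HasDerivWithinAt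
      (fun τ => solJet u 0 (q.1 + A * (q.2.1 - τ), τ, q.2.2))
      ((g (solJet u 0 q) - A) * solJet u 1 q) (Icc 0 T) q.2.1 := by
    intro q hq hq0
    -- If `g = 0` on `V`, the line is vertical and no `x`-derivative of `u` is needed.
    rcases hcase with h | ⟨h1, h2⟩
    · have hA0 : A = 0 := h _ hφy
      have := hdt q hq
      rw [hB q hq hq0, h _ (hDV q hq), zero_mul] at this
      simpa [hA0, h _ (hDV q hq)] using this
    · refine (hD.hasDerivWithinAt_line hdt h1 h2 hq A).congr_deriv ?_
      rw [hB q hq hq0]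
      ring
  -- A Grönwall inequality for `u - φ y` along the line: `g` is differentiable at `φ y`, and `u_x`
  -- is bounded near `q`.
  have hbound : ∀ q ∈ D, solJet u 0 q = φ y → ∃ K, ∀ᶠ p in 𝓝[slab T] q,
      |(g (solJet u 0 p) - A) * solJet u 1 p| ≤ K * |solJet u 0 p - φ y| := by
    intro q hq hqy
    rcases hcase with h | ⟨-, h2⟩
    · refine ⟨0, ?_⟩
      filter_upwards [hD.mem_nhds q hq] with p hp
      have hA0 : A = 0 := h _ hφy
      rw [h _ (hDV p hp), hA0]
      simp
    · have hgd : HasDerivAt g (deriv g (φ y)) (φ y) :=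
        (hg.differentiableAt (V.isOpen.mem_nhds hφy)).hasDerivAt
      obtain ⟨K₁, hK₁, hO⟩ := hgd.isBigO_sub.exists_pos
      rw [Asymptotics.IsBigOWith] at hO
      have hu' : Tendsto (solJet u 0) (𝓝[slab T] q) (𝓝 (φ y)) := by
        rw [← hqy]
        exact hD.continuousWithinAt_slab hq hu
      have hw1 := (hD.continuousWithinAt_slab hq h2).abs.eventually_lt_const
        (lt_add_one |solJet u 1 q|)
      refine ⟨K₁ * (|solJet u 1 q| + 1), ?_⟩
      filter_upwards [hu'.eventually hO, hw1] with p hp hp1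
      rw [Real.norm_eq_abs, Real.norm_eq_abs] at hp
      rw [abs_mul]
      calc _ ≤ (K₁ * |solJet u 0 p - φ y|) * (|solJet u 1 q| + 1) :=
            mul_le_mul hp hp1.le (abs_nonneg _) (by positivity)
        _ = _ := by ring
  have hmaps : MapsTo (fun t : ℝ => ((y - A * t, t) : ℝ × ℝ)) (Icc 0 T) {q | q.2 ∈ Icc 0 T} :=
    fun t ht => ht
  have hfc : ContinuousOn (fun t => u (y - A * t) t 0 - φ y) (Icc 0 T) :=
    (hu_cont.comp (f := fun t : ℝ => ((y - A * t, t) : ℝ × ℝ)) (by fun_prop) hmaps).sub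
      continuousOn_const
  -- As long as `u = φ y` on it, the segment of the line is a connected part of `Ω` that starts at
  -- `(y, 0, 0)`.
  have hmem : ∀ s ∈ Icc 0 T, (∀ s' ∈ Icc 0 s, u (y - A * s') s' 0 - φ y = 0) →
      (y - A * s, s, 0) ∈ D := by
    intro s hs H
    have hpre : IsPreconnected ((fun t : ℝ => ((y - A * t, t, 0) : ℝ × ℝ × ℝ)) '' Icc 0 s) :=
      isPreconnected_Icc.image _ (by fun_prop)
    refine subset_domainComp (q := (y, 0, 0)) hpre ?_ ⟨0, ⟨le_rfl, hs.1⟩, by simp⟩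
      (initial_mem_domainComp hT.le hu_init hy 0) ⟨s, ⟨hs.1, le_rfl⟩, rfl⟩
    rintro _ ⟨t, ht, rfl⟩
    refine ⟨⟨ht.1, ht.2.trans hs.2⟩, ?_⟩
    simp only [sub_eq_zero.1 (H t ht)]
    exact mem_image_of_mem _ hy
  have hzero := eq_zero_of_local_continuation hfc (by simp [hu_init]) (by
    intro s hs H
    have hsT : s ∈ Icc 0 T := ⟨hs.1, hs.2.le⟩
    have hq := hmem s hsT H
    have hq0 : solJet u 0 (y - A * s, s, 0) = φ y := by
      rw [solJet_zero]
      exact sub_eq_zero.1 (H s ⟨hs.1, le_rfl⟩)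
    obtain ⟨K, hK⟩ := hbound _ hq hq0
    have htend : Tendsto (fun t : ℝ => ((y - A * t, t, 0) : ℝ × ℝ × ℝ)) (𝓝[Icc 0 T] s)
        (𝓝[slab T] (y - A * s, s, 0)) := by
      refine tendsto_nhdsWithin_iff.2 ⟨?_, ?_⟩
      · exact ((show Continuous fun t : ℝ => ((y - A * t, t, 0) : ℝ × ℝ × ℝ) by fun_prop).tendsto
          s).mono_left nhdsWithin_le_nhds
      · filter_upwards [self_mem_nhdsWithin] with t ht using ht
    obtain ⟨δ, hδ, Hδ⟩ := Metric.mem_nhdsWithin_iff.1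
      (htend.eventually (hK.and (hD.mem_nhds _ hq)))
    refine ⟨δ / 2, by positivity, fun s' hs' hs'T => ?_⟩
    have hin : ∀ τ ∈ Icc s s', |(g (solJet u 0 (y - A * τ, τ, 0)) - A) * solJet u 1 (y - A * τ, τ, 0)|
        ≤ K * |solJet u 0 (y - A * τ, τ, 0) - φ y| ∧ (y - A * τ, τ, 0) ∈ D := by
      intro τ hτ
      refine Hδ ⟨?_, hs.1.trans hτ.1, hτ.2.trans hs'T.2⟩
      rw [Metric.mem_ball, Real.dist_eq, abs_of_nonneg (by linarith [hτ.1])]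
      linarith [hτ.2, hs'.2]
    refine eq_zero_of_abs_deriv_le_mul_abs_self_of_eq_zero_right
      (f := fun t => u (y - A * t) t 0 - φ y)
      (f' := fun τ => (g (solJet u 0 (y - A * τ, τ, 0)) - A) * solJet u 1 (y - A * τ, τ, 0)) (K := K)
      (hfc.mono (Icc_subset_Icc hs.1 hs'T.2)) ?_ (H s ⟨hs.1, le_rfl⟩) ?_ s' ⟨hs'.1, le_rfl⟩
    · intro τ hτ
      have h1 := hline _ (hin τ ⟨hτ.1, hτ.2.le⟩).2 rfl
      have h2 : HasDerivWithinAt (fun t => u (y - A * t) t 0 - φ y)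
          ((g (solJet u 0 (y - A * τ, τ, 0)) - A) * solJet u 1 (y - A * τ, τ, 0)) (Icc 0 T) τ := by
        refine (h1.sub_const (φ y)).congr_of_eventuallyEq (Eventually.of_forall fun t => ?_) ?_
        · simp only [solJet_zero]
          congr 2
          ring
        · simp [solJet_zero]
      exact h2.mono_of_mem_nhdsWithin
        (Icc_mem_nhdsGE_of_mem ⟨hs.1.trans hτ.1, hτ.2.trans_le hs'T.2⟩)
    · intro τ hτ
      have := (hin τ ⟨hτ.1, hτ.2.le⟩).1
      rwa [solJet_zero (q := (y - A * τ, τ, 0))] at this)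
  intro t ht
  exact ⟨sub_eq_zero.1 (hzero t ht), hmem t ht fun s' hs' => hzero s' ⟨hs'.1, hs'.2.trans ht.2⟩⟩

end StringEq

/-! ### The linear equation for `σ` and the estimates along characteristics -/

namespace StringEq

open Filter Topology Set TopologicalSpace

variable {T : ℝ} {V : Opens ℝ}

/-- The variational derivative of a string functional depends on `u`. -/
lemma dJ_zero_ne_zero {I : Set ℝ} {φ h c fp : ℝ → ℝ} (hI : IsOpen I) (hI_ne : I.Nonempty)
    (hVI : (V : Set ℝ) = φ '' I) (hφc : ContinuousOn φ I) (hc0 : ∀ x ∈ I, c (φ x) ≠ 0)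
    (hfp : ∀ x ∈ I, fp (φ x) = x / c (φ x)) {S : DiffFun}
    (hdisp : ∀ x t w, w 0 ∈ φ '' I →
      euler S x t 0 w = 1 / c (w 0) * (x + iteratedDeriv 2 h (w 0) * t - c (w 0) * fp (w 0)))
    {A : JetRing V} (hA : Represents A (euler S)) : dJ 0 A ≠ 0 := by
  intro h0
  obtain ⟨y, hy⟩ := hI_ne
  -- At `x = y`, `t = ε = 0`, `u = φ z` the function vanishes only for `z = y`. If `∂A/∂u` were
  -- zero, `A` would be constant for `u` near `φ y`, hence zero for all `z` near `y`.
  have hval : ∀ z ∈ I, ev A (y, 0, 0, Pi.single 0 (φ z)) = (y - z) / c (φ z) := by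
    intro z hz
    have hmem : (Pi.single 0 (φ z) : ℕ → ℝ) 0 ∈ φ '' I := by simpa using mem_image_of_mem φ hz
    rw [← hA.apply (by rw [← SetLike.mem_coe, hVI]; exact hmem), hdisp _ _ _ hmem]
    have := hc0 z hz
    simp only [Pi.single_eq_same, mul_zero, add_zero, hfp z hz]
    field_simp
  have hφy : φ y ∈ (V : Set ℝ) := hVI ▸ mem_image_of_mem _ hy
  obtain ⟨δ, hδ, hδV⟩ := Metric.isOpen_iff.1 V.isOpen (φ y) hφy
  have hq : ∀ τ : ℝ, ((y, 0, 0, Pi.single 0 (φ y)) : JetSpace) + τ • jetDir 0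
      = (y, 0, 0, Pi.single 0 (φ y + τ)) := by
    intro τ
    simp only [jetDir, Prod.smul_mk, Prod.mk_add_mk, add_zero, ← Pi.single_smul,
      ← Pi.single_add, smul_eq_mul, mul_one, mul_zero]
  have hball : ∀ τ : ℝ, |τ| < δ →
      ((y, 0, 0, Pi.single 0 (φ y + τ)) : JetSpace) ∈ jetDomain V := by
    intro τ hτ
    have : φ y + τ ∈ (V : Set ℝ) := hδV (by simpa [Real.dist_eq] using hτ)
    simpa [jetDomain] using this
  have hconst : ∀ τ : ℝ, |τ| < δ → ev A (y, 0, 0, Pi.single 0 (φ y + τ)) = 0 := by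
    intro τ hτ
    have hd : ∀ s ∈ Metric.ball (0 : ℝ) δ, HasDerivWithinAt
        (fun s : ℝ => ev A (((y, 0, 0, Pi.single 0 (φ y)) : JetSpace) + s • jetDir 0)) 0
        (Metric.ball 0 δ) s := by
      intro s hs
      have := hasDerivAt_jetDir A (q := (y, 0, 0, Pi.single 0 (φ y))) (jetDir 0) (τ := s)
        (by rw [hq]; exact hball s (by simpa using hs))
      rw [← dJ, h0, ev_zero] at this
      exact this.hasDerivWithinAt
    have := (convex_ball (0 : ℝ) δ).norm_image_sub_le_of_norm_hasDerivWithin_le hd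
      (C := 0) (fun s _ => by simp) (Metric.mem_ball_self hδ) (y := τ) (by simpa using hτ)
    simp only [hq, zero_mul, norm_le_zero_iff, add_zero, sub_eq_zero] at this
    rw [this, hval y hy, sub_self, zero_div]
  have hev : ∀ᶠ z in 𝓝 y, |φ z - φ y| < δ ∧ z ∈ I := by
    have h1 := (hφc.continuousAt (hI.mem_nhds hy)).eventually (Metric.ball_mem_nhds (φ y) hδ)
    filter_upwards [h1, hI.mem_nhds hy] with z hz hzI
    exact ⟨by simpa [Real.dist_eq] using hz, hzI⟩
  obtain ⟨z, ⟨hz, hzI⟩, hzy⟩ :=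
    ((hev.filter_mono nhdsWithin_le_nhds).and (self_mem_nhdsWithin (s := {y}ᶜ))).exists
  have h1 := hconst (φ z - φ y) hz
  rw [add_sub_cancel, hval z hzI, div_eq_zero_iff] at h1
  rcases h1 with h1 | h1
  · exact hzy (by simp only [mem_singleton_iff]; linarith)
  · exact hc0 z hzI h1

/-- Along a solution, the variational derivative `A` of a string functional satisfies a linear
equation: its derivative along the lines with slope `∂E/∂u`. -/
lemma RelOpen.hasDerivWithinAt_line_evW {D : Set (ℝ × ℝ × ℝ)} (hD : RelOpen T D)
    {w : ℕ → ℝ × ℝ × ℝ → ℝ} (hV : ∀ q ∈ D, w 0 q ∈ V) {A E EQ r g : JetRing V} {m n L N : ℕ}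
    (hwc : ∀ j ≤ L, ContinuousOn (w j) D) (hwx : ∀ j < L, HasDx D (w j) (w (j + 1)))
    (hA : OrderLE m A) (hmn : m + n ≤ L) (hEB : OrderLE n (totalD E))
    (hEn : ∀ i, n ≤ i → dJ i E = 0) (h0 : HasDt T D (w 0) (evW (totalD E) w))
    (hEQ : E = g + epsVar V ^ 2 * EQ) (hg : OrderLE 0 g)
    (hlin : dT A + frechet totalD dJ A (totalD E)
      = frechet totalD dJ E (totalD A) + epsVar V ^ (2 * N + 2) * r) :
    ∀ q ∈ D, HasDerivWithinAt
      (fun τ => evW A w (q.1 + evW (dJ 0 E) w q * (q.2.1 - τ), τ, q.2.2))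
      (q.2.2 ^ 2 * ∑ i ∈ Finset.range (n + 1),
        (if 2 ≤ i then evW (dJ (i - 1) EQ) w q else 0) * evW (totalD^[i] A) w q
        + q.2.2 ^ (2 * N + 2) * evW r w q) (Icc 0 T) q.2.1 := by
  intro q hq
  have hmem : (q.1, q.2.1, q.2.2, fun j => w j q) ∈ jetDomain V := hV q hq
  have hdt : HasDt T D (evW A w) (evW (dT A + frechet totalD dJ A (totalD E)) w) :=
    hA.hasDt_evW hV fun j hj => hD.hasDt_jets hEB hmn hV hwc hwx h0 hj
  have hval : evW (dT A + frechet totalD dJ A (totalD E)) w q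
      = ∑ i ∈ Finset.range n, evW (dJ i E) w q * evW (totalD^[i + 1] A) w q
        + q.2.2 ^ (2 * N + 2) * evW r w q := by
    rw [hlin, evW, ev_add hmem, frechet_eq hEn, ev_sum hmem, ev_mul hmem, ev_pow hmem,
      ev_epsVar hmem]
    simp only [ev_mul hmem, Function.iterate_succ_apply]
    rfl
  -- For `n = 0` all jet derivatives of `E` vanish: the slope is `0` and no `x`-derivative of `σ` is
  -- required.
  rcases n with _ | n
  · have ha : evW (dJ 0 E) w q = 0 := by rw [hEn 0 le_rfl, evW, ev_zero]
    have h1 := hdt q hq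
    rw [hval] at h1
    simpa [ha] using h1
  · have hAx : HasDx D (evW A w) (evW (totalD A) w) := hA.hasDx_evW hV fun j hj => hwx j (by omega)
    have hAxc : ContinuousOn (evW (totalD A) w) D :=
      hA.totalD.continuousOn_evW hV fun j hj => hwc j (by omega)
    refine (hD.hasDerivWithinAt_line hdt hAx hAxc hq _).congr_deriv ?_
    -- Since `g` depends on `u` alone, every coefficient except that of `∂ₓσ` carries `ε²`.
    have hi : ∀ i, 0 < i → evW (dJ i E) w q = q.2.2 ^ 2 * evW (dJ i EQ) w q := by
      intro i hi
      rw [hEQ, map_add, hg i hi, zero_add, dJ_epsVar_pow_mul, evW, ev_mul hmem, ev_pow hmem,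
        ev_epsVar hmem]
      rfl
    -- The term with coefficient `∂E/∂u` is cancelled by the motion along the line. The others are
    -- reindexed by the number of derivatives on `A`, whose entries `0` and `1` have coefficient
    -- zero.
    rw [hval, Finset.sum_range_succ', Finset.sum_range_succ' _ (n + 1), Finset.sum_range_succ' _ n,
      mul_add, mul_add, Finset.mul_sum]
    have hsum : ∀ i ∈ Finset.range n, evW (dJ (i + 1) E) w q * evW (totalD^[i + 1 + 1] A) w q
        = q.2.2 ^ 2 * ((if 2 ≤ i + 1 + 1 then evW (dJ (i + 1 + 1 - 1) EQ) w q else 0)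
          * evW (totalD^[i + 1 + 1] A) w q) := by
      intro i _
      rw [hi (i + 1) (by omega), if_pos (by omega)]
      simp only [Nat.add_sub_cancel]
      ring
    rw [Finset.sum_congr rfl hsum]
    simp
    ring

/-- The estimates for the variational derivative of a string functional along a solution. -/
theorem string_equation_estimates (h c p s φ fp : ℝ → ℝ) (M : ℕ) (H : ℕ → (ℕ → ℝ) → ℝ) (I : Set ℝ)
    (hI_open : IsOpen I) (hI_ne : I.Nonempty) (hφ : StrictMonoOn φ I ∨ StrictAntiOn φ I)
    (hh : ContDiffOn ℝ ∞ h (φ '' I)) (hc : ContDiffOn ℝ ∞ c (φ '' I))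
    (hp : ContDiffOn ℝ ∞ p (φ '' I)) (hs : ContDiffOn ℝ ∞ s (φ '' I))
    (hH : ∀ k, IsDiffFun (φ '' I) (fun _ _ _ w => H k w))
    (hc0 : ∀ x ∈ I, c (φ x) ≠ 0) (hfp : ∀ x ∈ I, fp (φ x) = x / c (φ x))
    (N L : ℕ) (S r : DiffFun)
    (hS : IsStringFunctional I φ h c fp (hamDensity c p s h M H) N S r)
    (hL : LinearEqDependsOnJet (φ '' I) L (hamDensity c p s h M H) S r)
    (hT : 0 < T) (u : ℝ → ℝ → ℝ → ℝ) (hu_init : ∀ x ε, u x 0 ε = φ x)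
    (hu_cont : ∀ ε, ContinuousOn (fun q : ℝ × ℝ => u q.1 q.2 ε) {q | q.2 ∈ Icc 0 T})
    (hu_pde : ∀ x t ε, (x, t, ε) ∈ domainComp I φ T u →
      HasDerivWithinAt (fun τ => u x τ ε)
        (along (totalDeriv (euler (hamDensity c p s h M H))) u x t ε) (Icc 0 T) t)
    (hu_cont' : ∀ q ∈ domainComp I φ T u,
      ContinuousWithinAt (fun q : ℝ × ℝ × ℝ => u q.1 q.2.1 q.2.2) {q | q.2.1 ∈ Icc 0 T} q)
    (hu_reg : HasMixedDerivs u L N (domainComp I φ T u)) :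
    RelOpen T (domainComp I φ T u) ∧
    EpsSmooth (domainComp I φ T u) (2 * N) (fun q => along (euler S) u q.1 q.2.1 q.2.2) ∧
    ∀ y ∈ I, (∀ t ∈ Icc 0 T,
        (y - iteratedDeriv 2 h (φ y) * t, t, 0) ∈ domainComp I φ T u) ∧
      ∃ ρ > 0, tube T y (iteratedDeriv 2 h (φ y)) ρ ⊆ domainComp I φ T u ∧
        ∃ C, ∀ q ∈ tube T y (iteratedDeriv 2 h (φ y)) ρ,
          |along (euler S) u q.1 q.2.1 q.2.2| ≤ C * |q.2.2| ^ (2 * N + 2) := by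
  -- `φ` inherits continuity from `u` at `t = 0`.
  have hφc : ContinuousOn φ I := by
    have h1 := (hu_cont 0).comp (f := fun x : ℝ => ((x, 0) : ℝ × ℝ)) (s := univ) (by fun_prop)
      fun x _ => ⟨le_rfl, hT.le⟩
    refine (h1.mono (subset_univ I)).congr fun x _ => ?_
    simp [hu_init]
  have hVo := isOpen_image_of_monotone hI_open hφc hφ
  obtain ⟨V, hVI⟩ : ∃ V : Opens ℝ, (V : Set ℝ) = φ '' I := ⟨⟨_, hVo⟩, rfl⟩
  have hD := relOpen_domainComp hVo hu_cont'
  set D := domainComp I φ T u with hDdef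
  -- the elements of the jet ring
  rw [← hVI] at hh hc hp hs hH hL
  obtain ⟨Q, hQ⟩ := exists_represents_hamDensity hh hc hp hs M hH
  set 𝓗 := hamDensity c p s h M H with h𝓗
  obtain ⟨Sr, hSr⟩ := IsDiffFun.exists_represents (V := V) (by rw [hVI]; exact hS.smooth)
  obtain ⟨rr, hrr⟩ := IsDiffFun.exists_represents (V := V) (by rw [hVI]; exact hS.smooth_remainder)
  set A := eulerR Sr with hAdef
  set E := eulerR (ofU h hh + epsVar V ^ 2 * Q) with hEdef
  set g : JetRing V := ofU (deriv h) (contDiffOn_deriv hh) with hgdef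
  have hA : Represents A (euler S) := hSr.euler
  have hE : Represents E (euler 𝓗) := hQ.euler
  have hEQ : E = g + epsVar V ^ 2 * eulerR Q := by
    rw [hEdef, eulerR, isJetAlgebra.eulerOp_add, ← eulerR, ← eulerR, eulerR_ofU,
      eulerR_epsVar_pow_mul]
  have hEx : dX E = 0 := dX_eulerR (hQ.dX_eq_zero fun _ _ _ _ _ => rfl)
  have hA0 : dJ 0 A ≠ 0 := dJ_zero_ne_zero hI_open hI_ne hVI hφc hc0 hfp hS.dispersionless hA
  obtain ⟨m, n, hmA, hmn, hEB, hEn, hn0⟩ := exists_orders hL hA hE ⟨0, hA0⟩ hEx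
  -- The left side is the time derivative of `A` along the flow `u_t = D E`; the right side is
  -- linear in `A`. This is where the self-adjointness of both Fréchet derivatives enters.
  have hlin : dT A + frechet totalD dJ A (totalD E)
      = frechet totalD dJ E (totalD A) + epsVar V ^ (2 * N + 2) * rr := by
    have h1 : dT A + eulerR (A * totalD E) = epsVar V ^ (2 * N + 2) * rr := by
      apply JetRing.ext_ev
      intro q hq
      have := hS.quasi_conserved q.1 q.2.1 q.2.2.1 q.2.2.2 (hVI ▸ hq)
      rw [hA.tPartial q hq, (hA.mul hE.totalDeriv).euler q hq, hrr q hq] at this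
      rw [ev_add hq, ev_mul hq, ev_pow hq, ev_epsVar hq, this]
    have h2 : eulerR (A * totalD E) = frechet totalD dJ A (totalD E)
        - frechet totalD dJ E (totalD A) := isJetAlgebra.eulerOp_mul_D_eulerOp _ _
    rw [h2] at h1
    rw [← h1]
    ring
  -- the jets of the solution
  have hDV : ∀ q ∈ D, u q.1 q.2.1 q.2.2 ∈ V := fun q hq => by
    rw [← SetLike.mem_coe, hVI]
    exact (domainComp_subset hq).2
  have hV : ∀ q ∈ D, solJet u 0 q ∈ V := fun q hq => by
    rw [solJet_zero]
    exact hDV q hq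
  have hwe : ∀ j ≤ L, EpsSmooth D (2 * N) (solJet u j) := fun j hj => hu_reg.epsSmooth hD hj
  have hwc : ∀ j ≤ L, ContinuousOn (solJet u j) D := fun j hj => (hwe j hj).continuousOn
  have hwx : ∀ j < L, HasDx D (solJet u j) (solJet u (j + 1)) := fun j hj => hu_reg.hasDx hj
  have h0 : HasDt T D (solJet u 0) (evW (totalD E) (solJet u)) := by
    intro q hq
    have := hu_pde q.1 q.2.1 q.2.2 hq
    rw [hE.totalDeriv.along_eq (hDV q hq)] at this
    simpa only [solJet_zero] using this
  have hσ : ∀ q ∈ D, along (euler S) u q.1 q.2.1 q.2.2 = evW A (solJet u) q := fun q hq =>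
    hA.along_eq (hDV q hq)
  have hAi : ∀ i ≤ n, OrderLE L (totalD^[i] A) := fun i hi =>
    (hmA.totalD_iterate i).mono (by omega)
  have hAe : ∀ i ≤ n, EpsSmooth D (2 * N) (evW (totalD^[i] A) (solJet u)) := fun i hi =>
    (hAi i hi).epsSmooth_evW hV hwe
  refine ⟨hD, EpsSmooth.congr hD (hAe 0 (Nat.zero_le _)) hσ, fun y hy => ?_⟩
  -- the characteristics
  have hg2 : ∀ q ∈ D, evW (dJ 0 E) (solJet u) q = iteratedDeriv 2 h (solJet u 0 q)
      + q.2.2 ^ 2 * evW (dJ 0 (eulerR Q)) (solJet u) q := by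
    intro q hq
    have hmem : (q.1, q.2.1, q.2.2, fun j => solJet u j q) ∈ jetDomain V := hV q hq
    rw [hEQ, map_add, dJ_epsVar_pow_mul, hgdef, dJ_zero_ofU, evW, ev_add hmem, ev_mul hmem,
      ev_pow hmem, ev_epsVar hmem, ev_ofU _ hmem, iteratedDeriv_succ, iteratedDeriv_one]
    rfl
  have hB0 : ∀ q ∈ D, q.2.2 = 0 → evW (totalD E) (solJet u) q
      = iteratedDeriv 2 h (solJet u 0 q) * solJet u 1 q := by
    intro q hq hq0
    have hmem : (q.1, q.2.1, q.2.2, fun j => solJet u j q) ∈ jetDomain V := hV q hq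
    rw [hEQ, map_add, totalD_epsVar_pow_mul, hgdef, totalD_ofU, evW, ev_add hmem, ev_mul hmem,
      ev_mul hmem, ev_jetVar hmem, ev_pow hmem, ev_epsVar hmem, ev_ofU _ hmem, iteratedDeriv_succ,
      iteratedDeriv_one]
    simp [hq0, mul_comm]
  -- If `n = 0` then `∂E/∂u = 0`, which at `ε = 0` reads `h'' = 0`, and the characteristics are
  -- vertical. Otherwise `1 ≤ n ≤ L`, and `u_x` is available.
  have hcase : (∀ v ∈ V, iteratedDeriv 2 h v = 0) ∨ 0 < n := by
    rcases Nat.eq_zero_or_pos n with hn | hn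
    · left
      intro v hv
      have hmem : ((0, 0, 0, fun _ => v) : JetSpace) ∈ jetDomain V := hv
      have h1 : ev (dJ 0 E) (0, 0, 0, fun _ => v) = 0 := by rw [hEn 0 hn.le, ev_zero]
      rw [hEQ, map_add, dJ_epsVar_pow_mul, hgdef, dJ_zero_ofU, ev_add hmem, ev_mul hmem,
        ev_pow hmem, ev_epsVar hmem, ev_ofU _ hmem] at h1
      rw [iteratedDeriv_succ, iteratedDeriv_one]
      simpa using h1
    · exact Or.inr hn
  have hchar := eq_initial_along_characteristic (V := V) hT hVI hD hu_init (hu_cont 0)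
    (hwc 0 (Nat.zero_le _)) ((contDiffOn_iteratedDeriv hh 2).differentiableOn (by simp)) h0 hB0
    (hcase.imp_right fun hn => ⟨hwx 0 (by omega), hwc 1 (by omega)⟩) hy
  refine ⟨fun t ht => (hchar t ht).2, ?_⟩
  -- the tube
  obtain ⟨ρ₀, hρ₀, hsub₀⟩ := hD.exists_tube (fun t ht => (hchar t ht).2)
  obtain ⟨ρ₁, hρ₁, hsub₁⟩ := Metric.isOpen_iff.1 hI_open y hy
  set A₀ := iteratedDeriv 2 h (φ y) with hA₀
  obtain ⟨ρ, hρ, hρρ₀, hρρ₁⟩ : ∃ ρ > 0, ρ ≤ ρ₀ ∧ ρ < ρ₁ :=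
    ⟨min ρ₀ (ρ₁ / 2), by positivity, min_le_left _ _,
      (min_le_right _ _).trans_lt (by linarith)⟩
  have hsub : tube T y A₀ ρ ⊆ D := (tube_mono hρρ₀).trans hsub₀
  have hE0 : OrderLE (n - 1) (dJ 0 E) := by
    intro k hk
    rw [dJ, dJ, pd_comm, ← dJ, ← dJ, hEn k (by omega), map_zero]
  have hE0x : HasDx D (evW (dJ 0 E) (solJet u)) (evW (totalD (dJ 0 E)) (solJet u)) := by
    rcases Nat.eq_zero_or_pos n with hn | hn
    · rw [hEn 0 hn.le, map_zero]
      intro q hq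
      simpa [evW, ev_zero] using hasDerivAt_const q.1 (0 : ℝ)
    · exact hE0.hasDx_evW hV fun j hj => hwx j (by omega)
  have hE0xc : ContinuousOn (evW (totalD (dJ 0 E)) (solJet u)) D := by
    rcases Nat.eq_zero_or_pos n with hn | hn
    · rw [hEn 0 hn.le, map_zero]
      have : evW (0 : JetRing V) (solJet u) = fun _ => 0 := by
        funext q
        rw [evW, ev_zero]
      rw [this]
      exact continuousOn_const
    · exact hE0.totalD.continuousOn_evW hV fun j hj => hwc j (by omega)
  -- Multiplied by `ε²` these coefficients are `∂E/∂u^(i)`, whose order is known; `ε²` can be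
  -- cancelled, also at `ε = 0`.
  have hQi : ∀ i, 0 < i → OrderLE L (dJ i (eulerR Q)) := by
    intro i hi k hk
    apply eq_zero_of_epsVar_pow_mul (j := 2)
    have h1 : epsVar V ^ 2 * dJ i (eulerR Q) = dJ i E := by
      rw [hEQ, map_add, orderLE_ofU _ i hi, zero_add, dJ_epsVar_pow_mul]
    rw [← dJ_epsVar_pow_mul, h1, dJ, dJ, pd_comm, ← dJ, ← dJ, hEn k (by omega), map_zero]
  obtain ⟨ρ', hρ', C, hC⟩ := hD.exists_bound_transport hT hρ hsub
    (s := fun i => evW (totalD^[i] A) (solJet u)) (n := n) (N := N)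
    (a := evW (dJ 0 E) (solJet u)) (ax := evW (totalD (dJ 0 E)) (solJet u))
    (b := fun i q => if 2 ≤ i then evW (dJ (i - 1) (eulerR Q)) (solJet u) q else 0)
    (r := evW rr (solJet u)) hAe
    (fun i hi => by
      simp only [Function.iterate_succ_apply']
      exact (hmA.totalD_iterate i).hasDx_evW hV fun j hj => hwx j (by omega))
    (hE0.continuousOn_evW hV fun j hj => hwc j (by omega)) hE0x hE0xc
    (fun t ht => by
      rw [hg2 _ (hchar t ht).2, solJet_zero, (hchar t ht).1]
      simp [hA₀])
    (fun i hi => by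
      by_cases h2 : 2 ≤ i
      · simp only [h2, if_true]
        exact (hQi (i - 1) (by omega)).continuousOn_evW hV hwc
      · simp only [h2, if_false]
        exact continuousOn_const)
    ((hrr.orderLE hL.2.1).continuousOn_evW hV hwc)
    (hD.hasDerivWithinAt_line_evW hV hwc hwx hmA hmn hEB hEn h0 hEQ (orderLE_ofU _) hlin)
    (fun x ε hx => by
      have hxI : x ∈ I := hsub₁ (by rw [Metric.mem_ball, Real.dist_eq]; linarith)
      have hmem : (x, 0, ε) ∈ D := initial_mem_domainComp hT.le hu_init hxI ε
      have := hσ _ hmem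
      simp only [Function.iterate_zero, id]
      rw [← this]
      have hj : (fun y => u y 0 ε) = φ := funext fun y => hu_init y ε
      simp only [along, hj]
      exact hS.initial ε x hxI)
  refine ⟨min ρ ρ', lt_min hρ hρ', (tube_mono (min_le_left _ _)).trans hsub, C, fun q hq => ?_⟩
  rw [hσ q (hsub (tube_mono (min_le_left _ _) hq))]
  exact hC q (tube_mono (min_le_right _ _) hq)

end StringEq

/-! ### From tubes to compact sets -/

namespace StringEq

open Topology

/-- Near a point with `ε ≠ 0` the function is bounded and `|ε|` is bounded away from zero, so an
estimate holds trivially; near `ε = 0` it is `hloc`. Finitely many local constants suffice. -/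
lemma isCompact_exists_bound {D K : Set (ℝ × ℝ × ℝ)} {F : ℝ × ℝ × ℝ → ℝ} {m : ℕ}
    (hF : ContinuousOn F D) (hK : IsCompact K) (hKD : K ⊆ D)
    (hloc : ∀ q ∈ K, q.2.2 = 0 → ∃ C, ∀ᶠ q' in 𝓝[K] q, |F q'| ≤ C * |q'.2.2| ^ m) :
    ∃ C, ∀ q ∈ K, |F q| ≤ C * |q.2.2| ^ m := by
  refine hK.induction_on (p := fun s => ∃ C, ∀ q ∈ s, |F q| ≤ C * |q.2.2| ^ m)
    ⟨0, by simp⟩ (fun s t hst ⟨C, hC⟩ => ⟨C, fun q hq => hC q (hst hq)⟩) ?_ ?_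
  · rintro s t ⟨C, hC⟩ ⟨C', hC'⟩
    refine ⟨max C C', ?_⟩
    rintro q (hq | hq)
    · exact (hC q hq).trans (by gcongr; exact le_max_left _ _)
    · exact (hC' q hq).trans (by gcongr; exact le_max_right _ _)
  · intro q hq
    by_cases h0 : q.2.2 = 0
    · obtain ⟨C, hC⟩ := hloc q hq h0
      exact ⟨_, hC, C, fun _ h => h⟩
    · have hq0 : 0 < |q.2.2| := abs_pos.2 h0
      have h1 : ∀ᶠ q' in 𝓝[K] q, |F q'| < |F q| + 1 :=
        ((hF.mono hKD) q hq).abs.eventually_lt continuousWithinAt_const (by linarith)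
      have h2 : ∀ᶠ q' in 𝓝[K] q, |q.2.2| / 2 < |q'.2.2| := by
        refine continuousWithinAt_const.eventually_lt
          (Continuous.continuousWithinAt (by fun_prop)) (by linarith)
      refine ⟨_, h1.and h2, (|F q| + 1) / (|q.2.2| / 2) ^ m, fun q' hq' => hq'.1.le.trans ?_⟩
      rw [div_mul_eq_mul_div, le_div_iff₀ (by positivity)]
      gcongr
      exact hq'.2.le

lemma eventually_mem_tube {T y A ρ t : ℝ} (hρ : 0 < ρ) {K : Set (ℝ × ℝ × ℝ)}
    (hK : ∀ q ∈ K, q.2.1 ∈ Set.Icc 0 T) :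
    ∀ᶠ q in 𝓝[K] ((y - A * t, t, 0) : ℝ × ℝ × ℝ), q ∈ tube T y A ρ := by
  have h1 : ∀ᶠ q in 𝓝[K] ((y - A * t, t, 0) : ℝ × ℝ × ℝ), |q.1 - (y - A * q.2.1)| < ρ :=
    Filter.Tendsto.eventually_lt_const (by simpa using hρ)
      (Continuous.continuousWithinAt (by fun_prop))
  have h2 : ∀ᶠ q in 𝓝[K] ((y - A * t, t, 0) : ℝ × ℝ × ℝ), |q.2.2| < ρ :=
    Filter.Tendsto.eventually_lt_const (by simpa using hρ)
      (Continuous.continuousWithinAt (by fun_prop))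
  filter_upwards [h1, h2, self_mem_nhdsWithin] with q hq1 hq2 hq
  exact ⟨hK q hq, hq1.le, hq2.le⟩

end StringEq
end

/-! ### The main theorem -/

theorem mainTheorem1
    -- the Hamiltonian perturbation, the initial datum and the interval of monotonicity
    (h c p s φ fp : ℝ → ℝ) (M : ℕ) (H : ℕ → (ℕ → ℝ) → ℝ) (I : Set ℝ)
    (hI_open : IsOpen I) (hI_conn : I.OrdConnected) (hI_ne : I.Nonempty)
    (hφ : StrictMonoOn φ I ∨ StrictAntiOn φ I)
    (hh : ContDiffOn ℝ ∞ h (φ '' I)) (hc : ContDiffOn ℝ ∞ c (φ '' I))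
    (hp : ContDiffOn ℝ ∞ p (φ '' I)) (hs : ContDiffOn ℝ ∞ s (φ '' I))
    (hH : ∀ k, StringEq.IsDiffFun (φ '' I) (fun _ _ _ w => H k w))
    (hc0 : ∀ x ∈ I, c (φ x) ≠ 0)
    (hfp : ∀ x ∈ I, fp (φ x) = x / c (φ x))
    -- the variational string equation of order `2N`
    (N L : ℕ) (S r : StringEq.DiffFun)
    (hS : StringEq.IsStringFunctional I φ h c fp (StringEq.hamDensity c p s h M H) N S r)
    (hL : StringEq.LinearEqDependsOnJet (φ '' I) L (StringEq.hamDensity c p s h M H) S r)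
    -- the solution of the Cauchy problem
    (T : ℝ) (hT : 0 < T) (u : ℝ → ℝ → ℝ → ℝ)
    (hu_init : ∀ x ε, u x 0 ε = φ x)
    (hu_cont : ∀ ε, ContinuousOn (fun q : ℝ × ℝ => u q.1 q.2 ε) {q | q.2 ∈ Set.Icc 0 T})
    (hu_pde : ∀ x t ε, (x, t, ε) ∈ StringEq.domainComp I φ T u →
      HasDerivWithinAt (fun τ => u x τ ε)
        (StringEq.along (StringEq.totalDeriv
          (StringEq.euler (StringEq.hamDensity c p s h M H))) u x t ε) (Set.Icc 0 T) t)
    -- its regularity as `ε → 0`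
    (hu_cont' : ∀ q ∈ StringEq.domainComp I φ T u,
      ContinuousWithinAt (fun q : ℝ × ℝ × ℝ => u q.1 q.2.1 q.2.2) {q | q.2.1 ∈ Set.Icc 0 T} q)
    (hu_reg : StringEq.HasMixedDerivs u L N (StringEq.domainComp I φ T u)) :
    -- the region filled by the characteristics lies in the slice `ε = 0` of the domain
    (∀ x t, (x, t) ∈ StringEq.charRegion I φ h T → (x, t, 0) ∈ StringEq.domainComp I φ T u) ∧
    -- `σ = O(ε^(2N+2))` on compact sets
    (∀ K : Set (ℝ × ℝ × ℝ), IsCompact K → K ⊆ StringEq.domainComp I φ T u →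
      (∀ x t, (x, t, 0) ∈ K → (x, t) ∈ StringEq.charRegion I φ h T) →
      ∃ C : ℝ, ∀ x t ε, (x, t, ε) ∈ K →
        |StringEq.along (StringEq.euler S) u x t ε| ≤ C * |ε| ^ (2 * N + 2)) ∧
    -- the `ε`-derivatives of `σ` of order `2k`, `k ≤ N`, exist and vanish at `ε = 0`
    (∀ x t, (x, t) ∈ StringEq.charRegion I φ h T →
      ContDiffAt ℝ ((2 * N : ℕ) : ℕ∞) (fun ε => StringEq.along (StringEq.euler S) u x t ε) 0 ∧
      ∀ k ≤ N,
        iteratedDeriv (2 * k) (fun ε => StringEq.along (StringEq.euler S) u x t ε) 0 = 0) := by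
  obtain ⟨hD, hF, hest⟩ := StringEq.string_equation_estimates h c p s φ fp M H I hI_open hI_ne hφ
    hh hc hp hs hH hc0 hfp N L S r hS hL hT u hu_init hu_cont hu_pde hu_cont' hu_reg
  refine ⟨?_, fun K hK hKD hK0 => ?_, ?_⟩
  · rintro x t ⟨ht, y, hy, hx⟩
    obtain rfl : x = y - iteratedDeriv 2 h (φ y) * t := hx
    exact (hest y hy).1 t ht
  · obtain ⟨C, hC⟩ := StringEq.isCompact_exists_bound (m := 2 * N + 2) hF.continuousOn hK hKD (by
      rintro ⟨x, t, ε⟩ hq (rfl : ε = 0)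
      obtain ⟨-, y, hy, hx⟩ := hK0 x t hq
      obtain rfl : x = y - iteratedDeriv 2 h (φ y) * t := hx
      obtain ⟨-, ρ, hρ, -, C, hC⟩ := hest y hy
      exact ⟨C, (StringEq.eventually_mem_tube hρ fun q hq =>
        (StringEq.domainComp_subset (hKD hq)).1).mono hC⟩)
    exact ⟨C, fun x t ε hq => hC (x, t, ε) hq⟩
  · rintro x t ⟨ht, y, hy, hx⟩
    obtain rfl : x = y - iteratedDeriv 2 h (φ y) * t := hx
    obtain ⟨-, ρ, hρ, hsub, C, hC⟩ := hest y hy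
    -- The radius is kept below `1` so that the exponent `2 * N + 2` may be weakened to the `2 * N +
    -- 1` expected by `EpsSmooth.contDiffAt`; `|C|` is used below because the sign of `C` is not
    -- known.
    have hmem : ∀ e, |e| < min ρ 1 → (y - iteratedDeriv 2 h (φ y) * t, t, e) ∈
        StringEq.tube T y (iteratedDeriv 2 h (φ y)) ρ := fun e he =>
      ⟨ht, by simpa using hρ.le, he.le.trans (min_le_left _ _)⟩
    have hcd := hF.contDiffAt (C := |C|) (lt_min hρ one_pos) (fun e he => hsub (hmem e he))
      fun e he => (hC _ (hmem e he)).trans <| by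
        gcongr ?_ * ?_
        · exact le_abs_self C
        · exact pow_le_pow_of_le_one (abs_nonneg e) (he.le.trans (min_le_right _ _)) (by omega)
    exact ⟨hcd.1, fun k hk => hcd.2 (2 * k) (by omega)⟩
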